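/- Let $u=(u_1,u_2,0)$, $B=(B_1,B_2,0)$, $H=(H_1,H_2,0)$, $E=(0,0,E_3)$ be constant real vectors (the velocity and magnetic field of the plasma, and the magnetic and electric fields of the vacuum, in a planar reference state) satisfying the stability condition $$|E|^2<\tfrac12\Big(|B|^2+|H|^2-\sqrt{(|B|^2+|H|^2)^2-4|B\times H|^2}\Big).\tag{H1}$$ For $\nu>0$, $z\in\mathbb C$ with $\operatorname{Re}z>0$ and $j=(j_1,j_2)\in\mathbb Z^2$ put, with $u\cdot j=u_1j_1+u_2j_2$ etc. and the principal square root, $$\Delta(z,j)=\sqrt{\nu^2z^2+|j|^2}\,\big((z+i\,u\cdot j)^2-(i\,B\cdot j)^2\big)+|j|\big((H_1\nu z+iE_3j_2)^2+(H_2\nu z-iE_3j_1)^2-(i\,H\cdot j)^2\big).$$ Let $\mathbb T^2=(\mathbb R/2\pi\mathbb Z)^2$, let $\mathbf c_j$ be the $j$-th Fourier coefficient in $y\in\mathbb T^2$, $\mathfrak L$ the Laplace transform in $t$ with dual variable $z$, and $H^\infty=\bigcap_s H^s$ (real-valued functions). Then there is $\nu_0>0$, depending only on $u,B,H,E$, such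 that for every $0<\nu<\nu_0$, every $T>0$ and every $\mathfrak A\in H^\infty([0,T]\times\mathbb T^2)$ with $\int_{\mathbb T^2}\mathfrak A(t,y)\,dy=0$ for almost every $t$, there is exactly one $\Phi\in H^\infty([0,T]\times\mathbb T^2)$ (taken to be its continuous representative) with $$\int_{\mathbb T^2}\Phi(t,y)\,dy=0\quad(0\le t\le T),\qquad \Phi|_{t=0}=0,\qquad \partial_t\Phi|_{t=0}=0,$$ that solves $$\Delta(z,j)\,\mathfrak L\,\mathbf c_j(\Phi)=\mathfrak L\,\mathbf c_j(\mathfrak A),\qquad j\in\mathbb Z^2\setminus\{0\},$$ on $[0,T]$ in the following sense: for some $\gamma>0$ the functions $\Phi$ and $\mathfrak A$ are, on $(0,T)\times\mathbb T^2$, the restrictions of functions $\Phi'$ and $\mathfrak A'$ on $(0,\infty)\times\mathbb T^2$ with $e^{-\gamma t}\Phi',\,e^{-\gamma t}\mathfrak A'\in L^2((0,\infty)\times\mathbb T^2)$, and $\Delta(z,j)\,\mathfrak L\,\mathbf c_j(\Phi')(z)=\mathfrak L\,\mathbf c_j(\mathfrak A')(z)$ for all $j\in\mathbb Z^2\setminus\{0\}$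 and all $z$ with $\operatorname{Re}z>\gamma$. -/

import Mathlib

open MeasureTheory Set
open scoped ContDiff Matrix

noncomputable section

namespace PlasmaVacuum

/-- The constant parameters of the planar reference plasma-vacuum interface `{x₃ = 0}`:
tangential velocity `(u₁, u₂, 0)` and magnetic field `(B₁, B₂, 0)` of the plasma, magnetic field
`(H₁, H₂, 0)` and electric field `(0, 0, E₃)` of the vacuum. -/
structure RefState where
  u₁ : ℝ
  u₂ : ℝ
  B₁ : ℝ
  B₂ : ℝ
  H₁ : ℝ
  H₂ : ℝ
  E₃ : ℝ

namespace RefState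

/-- Magnetic field of the plasma. -/
def B (S : RefState) : Fin 3 → ℝ := ![S.B₁, S.B₂, 0]

/-- Magnetic field of the vacuum. -/
def H (S : RefState) : Fin 3 → ℝ := ![S.H₁, S.H₂, 0]

/-- Electric field of the vacuum. -/
def E (S : RefState) : Fin 3 → ℝ := ![0, 0, S.E₃]

/-- The stability condition
`|E|² < (|B|² + |H|² - √((|B|² + |H|²)² - 4 |B × H|²)) / 2`,
where `|v|² = v ⬝ᵥ v`. -/
def Stable (S : RefState) : Prop :=
  S.E ⬝ᵥ S.E <
    (S.B ⬝ᵥ S.B + S.H ⬝ᵥ S.H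
      - Real.sqrt ((S.B ⬝ᵥ S.B + S.H ⬝ᵥ S.H) ^ 2 - 4 * ((S.B ⨯₃ S.H) ⬝ᵥ (S.B ⨯₃ S.H)))) / 2

end RefState

/-- Euclidean length of a frequency `j = (j₁, j₂) ∈ ℤ²`. -/
def freqNorm (j : ℤ × ℤ) : ℝ := Real.sqrt ((j.1 : ℝ) ^ 2 + (j.2 : ℝ) ^ 2)

/-- The Lopatinskii symbol
`Δ(z, j) = √(ν²z² + |j|²) ((z + i u·j)² - (i B·j)²)
  + |j| ((H₁νz + iE₃j₂)² + (H₂νz - iE₃j₁)² - (i H·j)²)`.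
The square root is the principal one, which has positive real part when `Re z > 0`. -/
def lopatinskii (S : RefState) (ν : ℝ) (z : ℂ) (j : ℤ × ℤ) : ℂ :=
  ((ν : ℂ) ^ 2 * z ^ 2 + (freqNorm j : ℂ) ^ 2) ^ (1 / 2 : ℂ)
      * ((z + Complex.I * ((S.u₁ : ℂ) * (j.1 : ℂ) + (S.u₂ : ℂ) * (j.2 : ℂ))) ^ 2
        - (Complex.I * ((S.B₁ : ℂ) * (j.1 : ℂ) + (S.B₂ : ℂ) * (j.2 : ℂ))) ^ 2)
    + (freqNorm j : ℂ)
      * (((S.H₁ : ℂ) * (ν : ℂ) * z + Complex.I * (S.E₃ : ℂ) * (j.2 : ℂ)) ^ 2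
        + ((S.H₂ : ℂ) * (ν : ℂ) * z - Complex.I * (S.E₃ : ℂ) * (j.1 : ℂ)) ^ 2
        - (Complex.I * ((S.H₁ : ℂ) * (j.1 : ℂ) + (S.H₂ : ℂ) * (j.2 : ℂ))) ^ 2)

/-! ### Functions on `I × 𝕋²`

The torus is `𝕋² = (ℝ/2πℤ)²`. A function on `I × 𝕋²` is a function of `(t, y₁, y₂)` which is
`2π`-periodic in `y₁` and `y₂` for `t ∈ I`; its values at times outside `I` are irrelevant. -/

/-- `2π`-periodicity in both tangential variables for the times in `I`. -/
def TorusPeriodicOn (I : Set ℝ) (f : ℝ × ℝ × ℝ → ℝ) : Prop :=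
  ∀ t ∈ I, ∀ y₁ y₂ : ℝ,
    f (t, y₁ + 2 * Real.pi, y₂) = f (t, y₁, y₂) ∧ f (t, y₁, y₂ + 2 * Real.pi) = f (t, y₁, y₂)

/-- The fundamental cell of `𝕋²`. -/
def cell : Set (ℝ × ℝ) := Ioc 0 (2 * Real.pi) ×ˢ Ioc 0 (2 * Real.pi)

/-- Partial derivative in `t`. -/
def partialT (f : ℝ × ℝ × ℝ → ℝ) (p : ℝ × ℝ × ℝ) : ℝ := deriv (fun s => f (s, p.2.1, p.2.2)) p.1

/-- Partial derivative in `y₁`. -/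
def partialY₁ (f : ℝ × ℝ × ℝ → ℝ) (p : ℝ × ℝ × ℝ) : ℝ := deriv (fun s => f (p.1, s, p.2.2)) p.2.1

/-- Partial derivative in `y₂`. -/
def partialY₂ (f : ℝ × ℝ × ℝ → ℝ) (p : ℝ × ℝ × ℝ) : ℝ := deriv (fun s => f (p.1, p.2.1, s)) p.2.2

/-- The classical derivative `∂_t^k ∂_{y₁}^l ∂_{y₂}^m ψ`. -/
def mixedPartial (k l m : ℕ) (ψ : ℝ × ℝ × ℝ → ℝ) : ℝ × ℝ × ℝ → ℝ :=
  partialT^[k] (partialY₁^[l] (partialY₂^[m] ψ))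

/-- Test functions: smooth functions with compact support in `(0, T) × 𝕋²`. -/
structure IsTest (T : ℝ) (ψ : ℝ × ℝ × ℝ → ℝ) : Prop where
  smooth : ContDiff ℝ ∞ ψ
  periodic : TorusPeriodicOn univ ψ
  support : ∃ a b : ℝ, 0 < a ∧ b < T ∧ ∀ p, ψ p ≠ 0 → p.1 ∈ Icc a b

/-- `g` is the weak derivative `∂_t^k ∂_{y₁}^l ∂_{y₂}^m f` on `(0, T) × 𝕋²`. -/
def IsWeakDeriv (T : ℝ) (k l m : ℕ) (f g : ℝ × ℝ × ℝ → ℝ) : Prop :=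
  ∀ ψ : ℝ × ℝ × ℝ → ℝ, IsTest T ψ →
    ∫ p in Ioo 0 T ×ˢ cell, f p * mixedPartial k l m ψ p
      = (-1) ^ (k + l + m) * ∫ p in Ioo 0 T ×ˢ cell, g p * ψ p

/-- `f ∈ H^∞([0, T] × 𝕋²)`, the intersection of all Sobolev spaces `H^s`: `f` and all its weak
derivatives are square integrable. -/
structure MemHInfty (T : ℝ) (f : ℝ × ℝ × ℝ → ℝ) : Prop where
  periodic : TorusPeriodicOn (Icc 0 T) f
  memL2 : MemLp f 2 (volume.restrict (Ioo 0 T ×ˢ cell))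
  weakDeriv : ∀ k l m : ℕ, ∃ g : ℝ × ℝ × ℝ → ℝ,
    MemLp g 2 (volume.restrict (Ioo 0 T ×ˢ cell)) ∧ IsWeakDeriv T k l m f g

/-- The weighted space `L²_γ = e^{γt} L²` on `(0, ∞) × 𝕋²`. -/
structure MemWeightedL2 (γ : ℝ) (f : ℝ × ℝ × ℝ → ℝ) : Prop where
  periodic : TorusPeriodicOn (Ioi 0) f
  memL2 : MemLp (fun p => Real.exp (-γ * p.1) * f p) 2 (volume.restrict (Ioi 0 ×ˢ cell))

/-- The Fourier coefficient of index `j ∈ ℤ²` in the variable `y` of `f (t, y)`. -/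
def fourierCoef (j : ℤ × ℤ) (f : ℝ × ℝ × ℝ → ℝ) (t : ℝ) : ℂ :=
  ((2 * Real.pi : ℝ) ^ 2 : ℂ)⁻¹ *
    ∫ y in cell, Complex.exp (-Complex.I * ((j.1 : ℂ) * (y.1 : ℂ) + (j.2 : ℂ) * (y.2 : ℂ)))
      * (f (t, y) : ℂ)

/-- The Laplace transform in time. -/
def laplace (g : ℝ → ℂ) (z : ℂ) : ℂ := ∫ t in Ioi (0 : ℝ), Complex.exp (-z * (t : ℂ)) * g t

/-- `Φ` solves on `[0, T]`, with source `𝔄`, the equation whose symbol is `Δ`: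
`Φ` and `𝔄` are the restrictions to `(0, T) × 𝕋²` of functions `Φ'`, `𝔄'` on
`(0, ∞) × 𝕋²` of at most exponential growth in the `L²_γ` sense, and
`Δ(z, j) 𝓛 c_j(Φ') = 𝓛 c_j(𝔄')` for all nonzero `j ∈ ℤ²` and all `z` with `Re z > γ`
(all the integrals converge absolutely there). -/
def SolvesOn (S : RefState) (ν T : ℝ) (𝔄 Φ : ℝ × ℝ × ℝ → ℝ) : Prop :=
  ∃ (γ : ℝ) (𝔄' Φ' : ℝ × ℝ × ℝ → ℝ), 0 < γ ∧ MemWeightedL2 γ 𝔄' ∧ MemWeightedL2 γ Φ' ∧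
    (∀ᵐ p ∂(volume.restrict (Ioo 0 T ×ˢ cell)), 𝔄' p = 𝔄 p) ∧
    (∀ᵐ p ∂(volume.restrict (Ioo 0 T ×ˢ cell)), Φ' p = Φ p) ∧
    ∀ j : ℤ × ℤ, j ≠ 0 → ∀ z : ℂ, γ < z.re →
      lopatinskii S ν z j * laplace (fourierCoef j Φ') z = laplace (fourierCoef j 𝔄') z

/-- `Φ`, represented by a continuous function, is a solution in `H^∞([0, T] × 𝕋²)` with zero mean
in `y`, for which `Φ` and `∂_t Φ` vanish at `t = 0`. -/
structure IsSlowFront (S : RefState) (ν T : ℝ) (𝔄 Φ : ℝ × ℝ × ℝ → ℝ) : Prop where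
  memHInfty : MemHInfty T Φ
  continuousOn : ContinuousOn Φ (Icc 0 T ×ˢ univ)
  zeroMean : ∀ t ∈ Icc 0 T, ∫ y in cell, Φ (t, y) = 0
  initial : ∀ y : ℝ × ℝ, Φ (0, y) = 0
  initialDeriv : ∀ y : ℝ × ℝ, HasDerivWithinAt (fun t => Φ (t, y)) 0 (Icc 0 T) 0
  solves : SolvesOn S ν T 𝔄 Φ

end PlasmaVacuum

end

/-! For each frequency `j ≠ 0` the equation is scalar: divide by the symbol Δ and invert the Laplace
transform. Two properties of Δ carry the proof: the lower bound |z|³ ≤ C |j| |Δ(z, j)| in Re z ≥ 1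
(`exists_lopatinskii_lower`), and an expansion of z³/Δ in powers of 1/z whose constants grow at most
polynomially in |j| (`polyFamily_div_lopatinskii`).

Lower bound. By homogeneity, with x = νz/|j| and s = √(x² + 1), Δ equals |j|³/ν² times P = s((x +
iνa)² + ν²b²) + ν²(…), where a, b, h are the components of u, B, H along j/|j| and k is the
transverse component of H. For small ν the term s x² dominates, except near x = 0 and near the
branch points x = ±i. Near 0, P resembles (x + iνa)² + ν²(b² + h² - E²). The right side of (H1) is
the smallest eigenvalue of BBᵀ + HHᵀ, so b² + h² - E² is bounded below by a positive constant; the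
model has two simple imaginary roots, and |P| is at least a multiple of ν² Re x. At x = ±i the
bracket after ν² becomes -(k ± E)², of the same sign as the coefficient of s; as Re s ≥ 0, the two
terms cannot cancel.

Existence and smoothness. Extend the source by zero after the time T. Repeated integration by parts
writes the transform of a mode as X - e^{-Tz} Y (`exists_symbol_laplace`): X has an expansion in 1/z
of any prescribed length, with constants decaying rapidly in |j|, and the Y term is invisible for t
≤ T because its contour can be pushed to Re z = +∞ (`invLaplace_eq_zero`). Before T the solution
mode is therefore the inverse transform of z⁻³ times a symbol. The factor z⁻³ gives the two zero
initial conditions; the expansion gives bounded derivatives of every order on (0, T), whatever the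
source does at t = 0 (`IsSymbol.exists_derivs`, `exists_modes`). The rapidly convergent Fourier
series then sums to an H^∞ function, and the symmetry of Δ under conjugation allows its real part to
be taken.

Uniqueness. The difference of two solutions has an extended source that vanishes before T, hence a
transform of size e^{-T Re z}; dividing by Δ and pushing the contour to infinity kills each mode
before T (`ae_eq_zero_of_lopatinskii_mul_laplace`). Fourier uniqueness and continuity finish the
argument. -/

noncomputable section

namespace PlasmaVacuum

open Filter Topology FourierTransform

/-! ### Lower bounds for the scaled symbol -/

/-- The Lopatinskii symbol at a unit frequency, in the rescaled variable `x = ν z / |j|`. -/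
def scaledSymbol (ε a b h k E : ℝ) (x s : ℂ) : ℂ :=
  s * ((x + Complex.I * (ε * a : ℝ)) ^ 2 + (ε ^ 2 * b ^ 2 : ℝ))
    + (ε ^ 2 : ℝ) * ((h ^ 2 + k ^ 2 : ℝ) * x ^ 2 + Complex.I * (2 * E * k : ℝ) * x
      + (h ^ 2 - E ^ 2 : ℝ))

/-- In s² = (x - i)(x + i) both factors have real part Re x. Near the branch points, where the
symbol is only bounded below by a multiple of |s|, this turns |s| into Re x. -/
lemma norm_ge_of_sq_eq {x s : ℂ} (hs : s ^ 2 = x ^ 2 + 1) (hx : 0 < x.re) : x.re ≤ ‖s‖ := by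
  have h1 : ‖s‖ ^ 2 = ‖x - Complex.I‖ * ‖x + Complex.I‖ := by
    rw [← norm_pow, ← norm_mul, hs]; congr 1; ring_nf; simp; ring
  have h2 : x.re ≤ ‖x - Complex.I‖ := by
    have := Complex.re_le_norm (x - Complex.I); simpa using this
  have h3 : x.re ≤ ‖x + Complex.I‖ := by
    have := Complex.re_le_norm (x + Complex.I); simpa using this
  have : x.re ^ 2 ≤ ‖s‖ ^ 2 := by rw [h1]; nlinarith
  exact (abs_le_of_sq_le_sq' this (norm_nonneg _)).2

set_option maxHeartbeats 800000 in
/-- Near the branch points `x = ± i` of the square root. -/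
lemma scaledSymbol_lower_branch {M ε a b h k E σ : ℝ} {x s : ℂ} (hM : 1 ≤ M) (hε : 0 < ε)
    (hεM : ε * M ≤ 1 / 8) (ha : |a| ≤ M) (hb : |b| ≤ M) (hh : |h| ≤ M) (hk : |k| ≤ M)
    (hE : |E| ≤ M) (hσ : σ ^ 2 = 1) (hs : 0 ≤ s.re) (hs8 : ‖s‖ ≤ 1 / 8)
    (hd : ‖x - Complex.I * σ‖ ≤ ‖s‖ ^ 2) :
    ‖s‖ / 4 ≤ ‖scaledSymbol ε a b h k E x s‖ := by
  set d := x - Complex.I * σ with hd_def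
  have hx : x = d + Complex.I * σ := by rw [hd_def]; ring
  have hσC : (σ : ℂ) ^ 2 = 1 := by exact_mod_cast hσ
  have hσ1 : |σ| = 1 := by
    have : |σ| ^ 2 = 1 := by rw [sq_abs]; exact hσ
    nlinarith [abs_nonneg σ]
  set A0 : ℝ := (σ + ε * a) ^ 2 - ε ^ 2 * b ^ 2 with hA0
  have hI : Complex.I ^ 2 = -1 := Complex.I_sq
  -- At x = iσ the bracket after ε² is exactly -(k + σE)², so after a change of sign both main terms
  -- are favourable. Everything else carries a factor d, hence is O(|s|²).
  have key : -scaledSymbol ε a b h k E x s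
      = (s * (A0 : ℂ) + ((ε ^ 2 * (k + σ * E) ^ 2 : ℝ) : ℂ))
        - (s * (d * (d + 2 * Complex.I * (σ + ε * a : ℝ)))
          + (ε ^ 2 : ℝ) * (d * ((h ^ 2 + k ^ 2 : ℝ) * (d + 2 * Complex.I * σ)
            + Complex.I * (2 * E * k : ℝ)))) := by
    rw [hx, hA0]
    unfold scaledSymbol
    push_cast
    linear_combination (ε ^ 2 * k ^ 2 + ε^2*h^2 - ε ^ 2 * E ^ 2 : ℂ) * hσC +
      (-(s * (σ + ε * a) ^ 2) - ε ^ 2 * ((h ^ 2 + k ^ 2) * σ ^ 2 + 2 * E * k * σ) : ℂ) * hI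
  have hεa : |ε * a| ≤ 1 / 8 := by
    rw [abs_mul, abs_of_pos hε]
    exact (mul_le_mul_of_nonneg_left ha hε.le).trans hεM
  have hA0' : 1 / 2 ≤ A0 := by
    have h1 := abs_le.mp hεa
    rw [hA0]
    have h2 : (σ + ε * a) ^ 2 = 1 + 2 * (σ * (ε * a)) + (ε * a) ^ 2 := by rw [← hσ]; ring
    have h3 : |σ * (ε * a)| ≤ ε * M := by
      rw [abs_mul, hσ1, one_mul, abs_mul, abs_of_pos hε]
      exact mul_le_mul_of_nonneg_left ha hε.le
    have h4 := (abs_le.mp h3).1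
    have h5 : ε ^ 2 * b ^ 2 ≤ (ε * M) ^ 2 := by
      rw [← mul_pow]
      apply sq_le_sq'
      · have := abs_le.mp hb; nlinarith
      · have := abs_le.mp hb; nlinarith
    have h6 : (ε * M) ^ 2 ≤ (1 / 8) ^ 2 := by gcongr
    have h7 := sq_nonneg (ε * a)
    linarith
  -- Since Re s ≥ 0 and A0 > 0, adding a nonnegative real number to s A0 cannot decrease the
  -- modulus.
  have h1 : ‖s‖ * A0 ≤ ‖s * (A0 : ℂ) + ((ε ^ 2 * (k + σ * E) ^ 2 : ℝ) : ℂ)‖ := by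
    have hA0p : 0 ≤ A0 := by linarith
    have e : ‖s‖ * A0 = ‖s * (A0 : ℂ)‖ := by
      rw [norm_mul, Complex.norm_real, Real.norm_of_nonneg hA0p]
    rw [e]
    refine (abs_le_of_sq_le_sq' ?_ (norm_nonneg _)).2
    rw [Complex.sq_norm, Complex.sq_norm, Complex.normSq_apply, Complex.normSq_apply]
    have ht : 0 ≤ ε ^ 2 * (k + σ * E) ^ 2 := by positivity
    simp only [Complex.add_re, Complex.add_im, Complex.ofReal_re, Complex.ofReal_im,
      Complex.re_mul_ofReal, Complex.im_mul_ofReal, add_zero]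
    have : 0 ≤ s.re * A0 := mul_nonneg hs hA0p
    nlinarith
  have hd1 : ‖d‖ ≤ 1 / 64 := hd.trans (by nlinarith [norm_nonneg s])
  have hσn : ‖(σ : ℂ)‖ = 1 := by rw [Complex.norm_real, Real.norm_eq_abs, hσ1]
  have h2 : ‖s * (d * (d + 2 * Complex.I * (σ + ε * a : ℝ)))‖ ≤ ‖s‖ * (‖s‖ ^ 2 * 3) := by
    rw [norm_mul, norm_mul]
    gcongr
    refine (norm_add_le _ _).trans ?_
    rw [norm_mul, norm_mul, Complex.norm_I, Complex.norm_real, Real.norm_eq_abs]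
    have := abs_add_le σ (ε * a)
    norm_num
    linarith
  have h3 : ‖((ε ^ 2 : ℝ) : ℂ) * (d * ((h ^ 2 + k ^ 2 : ℝ) * (d + 2 * Complex.I * σ)
            + Complex.I * (2 * E * k : ℝ)))‖ ≤ ε ^ 2 * (‖s‖ ^ 2 * (8 * M ^ 2)) := by
    rw [norm_mul, norm_mul, Complex.norm_real, Real.norm_of_nonneg (sq_nonneg ε)]
    gcongr
    refine (norm_add_le _ _).trans ?_
    rw [norm_mul, norm_mul, Complex.norm_I, Complex.norm_real, Complex.norm_real,
      Real.norm_of_nonneg (by positivity), Real.norm_eq_abs, abs_mul, abs_mul]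
    have e1 : h ^ 2 ≤ M ^ 2 := by rw [← sq_abs]; gcongr
    have e2 : k ^ 2 ≤ M ^ 2 := by rw [← sq_abs]; gcongr
    have e3 : |E| * |k| ≤ M * M := by gcongr
    have e4 : ‖d + 2 * Complex.I * σ‖ ≤ 3 := by
      refine (norm_add_le _ _).trans ?_
      rw [norm_mul, norm_mul, Complex.norm_I, hσn]
      norm_num
      linarith
    have e5 : (h ^ 2 + k ^ 2) * ‖d + 2 * Complex.I * σ‖ ≤ (M ^ 2 + M ^ 2) * 3 := by gcongr
    simp only [abs_two]
    linarith
  have h4 : ‖s‖ * A0 - (‖s‖ * (‖s‖ ^ 2 * 3) + ε ^ 2 * (‖s‖ ^ 2 * (8 * M ^ 2)))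
      ≤ ‖scaledSymbol ε a b h k E x s‖ := by
    rw [← norm_neg (scaledSymbol ε a b h k E x s), key]
    refine le_trans ?_ (norm_sub_norm_le _ _)
    have := norm_add_le (s * (d * (d + 2 * Complex.I * (σ + ε * a : ℝ))))
      (((ε ^ 2 : ℝ) : ℂ) * (d * ((h ^ 2 + k ^ 2 : ℝ) * (d + 2 * Complex.I * σ)
            + Complex.I * (2 * E * k : ℝ))))
    linarith
  refine le_trans ?_ h4
  have h5 : ε ^ 2 * M ^ 2 ≤ 1 / 16 := by
    have : (ε * M) ^ 2 ≤ (1 / 8) ^ 2 := by gcongr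
    linarith [mul_pow ε M 2]
  have hn := norm_nonneg s
  have e1 : ‖s‖ * (1 / 2) ≤ ‖s‖ * A0 := by gcongr
  have e2 : ‖s‖ ^ 2 ≤ 1 / 64 := by nlinarith
  have e3 : ‖s‖ * ‖s‖ ^ 2 ≤ ‖s‖ * (1 / 64) := by gcongr
  have e4 : (ε ^ 2 * M ^ 2) * ‖s‖ ^ 2 ≤ 1 / 16 * (‖s‖ * (1 / 8)) := by
    have : ‖s‖ ^ 2 ≤ ‖s‖ * (1 / 8) := by nlinarith
    gcongr
  nlinarith

/-- Away from `x = 0` and from the branch points the term `s x²` dominates. -/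
lemma scaledSymbol_lower_far {M ε a b h k E δ : ℝ} {x s : ℂ} (hM : 1 ≤ M) (hε : 0 < ε)
    (hδ : 0 < δ) (hδ1 : δ ≤ 1)
    (hεM : ε * M ≤ δ / 64) (ha : |a| ≤ M) (hb : |b| ≤ M) (hh : |h| ≤ M) (hk : |k| ≤ M)
    (hE : |E| ≤ M) (hs : s ^ 2 = x ^ 2 + 1) (hs8 : 1 / 8 ≤ ‖s‖) (hx : δ ≤ ‖x‖) :
    δ ^ 2 / 1536 * (1 + ‖x‖) ^ 3 ≤ ‖scaledSymbol ε a b h k E x s‖ := by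
  have hεa : |ε * a| ≤ δ / 64 := by
    rw [abs_mul, abs_of_pos hε]
    exact (mul_le_mul_of_nonneg_left ha hε.le).trans hεM
  have hεb : (ε * b) ^ 2 ≤ (δ / 64) ^ 2 := by
    have : |ε * b| ≤ δ / 64 := by
      rw [abs_mul, abs_of_pos hε]
      exact (mul_le_mul_of_nonneg_left hb hε.le).trans hεM
    rw [← sq_abs]; gcongr
  -- For |x| ≤ 2 the hypothesis 1/8 ≤ |s| suffices, as (1 + 2)/24 = 1/8; for larger x use |s|² ≥
  -- |x|² - 1.
  have hs1 : (1 + ‖x‖) / 24 ≤ ‖s‖ := by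
    rcases le_or_gt ‖x‖ 2 with h2 | h2
    · linarith
    · have e : ‖x‖ ^ 2 - 1 ≤ ‖s‖ ^ 2 := by
        rw [← norm_pow s, hs, ← norm_pow]
        have := norm_sub_norm_le (x ^ 2) (-1)
        simpa using this
      refine (abs_le_of_sq_le_sq' (le_trans ?_ e) (norm_nonneg _)).2
      nlinarith
  have hw : ‖x‖ ^ 2 / 2 ≤ ‖(x + Complex.I * (ε * a : ℝ)) ^ 2 + (ε ^ 2 * b ^ 2 : ℝ)‖ := by
    have e1 : 63 / 64 * ‖x‖ ≤ ‖x + Complex.I * (ε * a : ℝ)‖ := by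
      have := norm_sub_norm_le x (-(Complex.I * (ε * a : ℝ)))
      rw [norm_neg, norm_mul, Complex.norm_I, Complex.norm_real, Real.norm_eq_abs,
        sub_neg_eq_add] at this
      linarith
    have e2 : (63 / 64 * ‖x‖) ^ 2 ≤ ‖x + Complex.I * (ε * a : ℝ)‖ ^ 2 := by gcongr
    have e3 := norm_sub_norm_le ((x + Complex.I * (ε * a : ℝ)) ^ 2) (-((ε ^ 2 * b ^ 2 : ℝ) : ℂ))
    rw [norm_neg, norm_pow, Complex.norm_real, Real.norm_of_nonneg (by positivity),
      sub_neg_eq_add] at e3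
    nlinarith
  have hR : ‖((ε ^ 2 : ℝ) : ℂ) * ((h ^ 2 + k ^ 2 : ℝ) * x ^ 2 + Complex.I * (2 * E * k : ℝ) * x
      + (h ^ 2 - E ^ 2 : ℝ))‖ ≤ ε ^ 2 * (2 * M ^ 2 * (1 + ‖x‖) ^ 2) := by
    rw [norm_mul, Complex.norm_real, Real.norm_of_nonneg (sq_nonneg ε)]
    gcongr
    refine (norm_add₃_le).trans ?_
    rw [norm_mul, norm_mul, norm_mul, norm_pow, Complex.norm_I, Complex.norm_real,
      Complex.norm_real, Complex.norm_real,
      Real.norm_of_nonneg (by positivity), Real.norm_eq_abs, Real.norm_eq_abs, abs_mul, abs_mul]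
    have e1 : h ^ 2 ≤ M ^ 2 := by rw [← sq_abs]; gcongr
    have e2 : k ^ 2 ≤ M ^ 2 := by rw [← sq_abs]; gcongr
    have e3 : |E| * |k| ≤ M * M := by gcongr
    have e4 : E ^ 2 ≤ M ^ 2 := by rw [← sq_abs]; gcongr
    have e5 : |h ^ 2 - E ^ 2| ≤ M ^ 2 := by
      rw [abs_le]; constructor <;> nlinarith [sq_nonneg h, sq_nonneg E]
    have hx0 := norm_nonneg x
    simp only [abs_two]
    have e6 : (h ^ 2 + k ^ 2) * ‖x‖ ^ 2 ≤ (M ^ 2 + M ^ 2) * ‖x‖ ^ 2 := by gcongr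
    have e7 : 1 * (2 * |E| * |k|) * ‖x‖ ≤ 2 * M ^ 2 * ‖x‖ := by
      have : 1 * (2 * |E| * |k|) ≤ 2 * M ^ 2 := by linarith
      gcongr
    nlinarith [mul_nonneg (sq_nonneg M) hx0]
  have h1 : (1 + ‖x‖) / 24 * (‖x‖ ^ 2 / 2)
      ≤ ‖s * ((x + Complex.I * (ε * a : ℝ)) ^ 2 + (ε ^ 2 * b ^ 2 : ℝ))‖ := by
    rw [norm_mul]; gcongr
  have h2 := norm_sub_norm_le (s * ((x + Complex.I * (ε * a : ℝ)) ^ 2 + (ε ^ 2 * b ^ 2 : ℝ)))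
    (-(((ε ^ 2 : ℝ) : ℂ) * ((h ^ 2 + k ^ 2 : ℝ) * x ^ 2 + Complex.I * (2 * E * k : ℝ) * x
      + (h ^ 2 - E ^ 2 : ℝ))))
  rw [norm_neg, sub_neg_eq_add] at h2
  refine le_trans ?_ h2
  have hx0 := norm_nonneg x
  -- This uses δ ≤ |x| for the term δ/2 and δ ≤ 1 for the term δ|x|/2.
  have h3 : δ / 2 * (1 + ‖x‖) ≤ ‖x‖ := by nlinarith
  have h4 : (δ / 2 * (1 + ‖x‖)) ^ 2 ≤ ‖x‖ ^ 2 := by gcongr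
  have h5 : (1 + ‖x‖) / 24 * ((δ / 2 * (1 + ‖x‖)) ^ 2 / 2)
      ≤ (1 + ‖x‖) / 24 * (‖x‖ ^ 2 / 2) := by gcongr
  have h6 : (ε * M) ^ 2 ≤ (δ / 64) ^ 2 := by gcongr
  have h7 : ε ^ 2 * (2 * M ^ 2 * (1 + ‖x‖) ^ 2) ≤ 2 * (δ / 64) ^ 2 * (1 + ‖x‖) ^ 2 * (1 + ‖x‖) := by
    have e : ε ^ 2 * (2 * M ^ 2 * (1 + ‖x‖) ^ 2) = 2 * (ε * M) ^ 2 * (1 + ‖x‖) ^ 2 * 1 := by ring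
    rw [e]
    gcongr
    linarith
  have h8 : 0 ≤ δ ^ 2 * (1 + ‖x‖) ^ 3 := by positivity
  nlinarith

set_option maxHeartbeats 400000 in
/-- Near `x = 0` the symbol is a small perturbation of `(x + iεa)² + ε²(b² + h² - E²)`. -/
lemma scaledSymbol_lower_near {M ε a b h k E δ κ : ℝ} {x s : ℂ} (hM : 1 ≤ M) (hε : 0 < ε)
    (hκ : κ ≤ b ^ 2 + h ^ 2 - E ^ 2) (hδ1 : δ ≤ 1 / 2) (hδκ : 28 * M ^ 2 * δ ≤ κ / 4)
    (hεM : ε * M ≤ 1 / 8) (hεκ : 20 * M ^ 2 * (ε * M) ≤ κ / 4)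
    (ha : |a| ≤ M) (hh : |h| ≤ M) (hk : |k| ≤ M)
    (hE : |E| ≤ M) (hs : s ^ 2 = x ^ 2 + 1) (hs0 : 0 ≤ s.re) (hx0 : 0 < x.re) (hx : ‖x‖ ≤ δ) :
    x.re * ε ^ 2 * κ / 4 ≤ ‖scaledSymbol ε a b h k E x s‖ := by
  have e1 : h ^ 2 ≤ M ^ 2 := by rw [← sq_abs]; gcongr
  have e2 : k ^ 2 ≤ M ^ 2 := by rw [← sq_abs]; gcongr
  have e3 : |E * k| ≤ M ^ 2 := by
    rw [abs_mul, sq]; gcongr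
  have e4 : E ^ 2 ≤ M ^ 2 := by rw [← sq_abs]; gcongr
  have e5 : |h ^ 2 - E ^ 2| ≤ M ^ 2 := by
    rw [abs_le]; constructor <;> linarith [sq_nonneg h, sq_nonneg E]
  have hM2 : 1 ≤ M ^ 2 := one_le_pow₀ hM
  have hγ : |x.re| ≤ ‖x‖ := Complex.abs_re_le_norm x
  have hτ : |x.im| ≤ ‖x‖ := Complex.abs_im_le_norm x
  have hx12 : ‖x‖ ≤ 1 / 2 := hx.trans hδ1
  have hre : s.re ^ 2 - s.im ^ 2 = 1 + x.re ^ 2 - x.im ^ 2 := by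
    have := congrArg Complex.re hs
    simp only [sq, Complex.mul_re, Complex.add_re, Complex.one_re] at this
    linarith
  have him : s.re * s.im = x.re * x.im := by
    have := congrArg Complex.im hs
    simp only [sq, Complex.mul_im, Complex.add_im, Complex.one_im] at this
    linarith
  have hp : 1 / 2 ≤ s.re := by
    have : x.im ^ 2 ≤ (1 / 2) ^ 2 := by rw [← sq_abs]; gcongr; linarith
    refine (abs_le_of_sq_le_sq' ?_ hs0).2
    linarith [sq_nonneg s.im, sq_nonneg x.re]
  have hsn : 1 / 2 ≤ ‖s‖ := hp.trans (Complex.re_le_norm s)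
  have hs_ne : s ≠ 0 := by intro h; rw [h] at hsn; norm_num at hsn
  -- On the imaginary axis with |x| < 1 both s and R are real, so their imaginary parts are O(Re x).
  -- All errors below must carry this factor, because the lower bound itself degenerates like Re x.
  have hq : |s.im| ≤ x.re := by
    have h1 : s.re * |s.im| = x.re * |x.im| := by
      have := congrArg abs him
      rwa [abs_mul, abs_mul, abs_of_nonneg hs0, abs_of_pos hx0] at this
    have h2 : x.re * |x.im| ≤ x.re * (1 / 2) := by gcongr; linarith
    have h3 : 1 / 2 * |s.im| ≤ s.re * |s.im| := by gcongr
    linarith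
  set R : ℂ := (h ^ 2 + k ^ 2 : ℝ) * x ^ 2 + Complex.I * (2 * E * k : ℝ) * x
      + (h ^ 2 - E ^ 2 : ℝ) with hR
  set w : ℂ := x + Complex.I * (ε * a : ℝ) with hw
  have hεa : |ε * a| ≤ ε * M := by
    rw [abs_mul, abs_of_pos hε]
    exact mul_le_mul_of_nonneg_left ha hε.le
  have hRd : ‖R - (h ^ 2 - E ^ 2 : ℝ)‖ ≤ 3 * M ^ 2 * ‖x‖ := by
    rw [hR, add_sub_cancel_right]
    refine (norm_add_le _ _).trans ?_
    rw [norm_mul, norm_mul, norm_mul, norm_pow, Complex.norm_I, Complex.norm_real,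
      Complex.norm_real, Real.norm_of_nonneg (by positivity), Real.norm_eq_abs, mul_assoc 2,
      abs_mul, abs_two]
    have e6 : (h ^ 2 + k ^ 2) * ‖x‖ ^ 2 ≤ (M ^ 2 + M ^ 2) * (1 / 2 * ‖x‖) := by
      have : ‖x‖ ^ 2 ≤ 1 / 2 * ‖x‖ := by rw [sq]; gcongr
      gcongr
    have e7 : |E * k| * ‖x‖ ≤ M ^ 2 * ‖x‖ := by gcongr
    linarith
  have hsd : ‖1 - s‖ ≤ ‖x‖ := by
    have h1 : (1 - s) * (1 + s) = - x ^ 2 := by linear_combination -hs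
    have h2 := congrArg norm h1
    rw [norm_mul, norm_neg, norm_pow] at h2
    have h3 : 1 ≤ ‖1 + s‖ := by
      have := Complex.re_le_norm (1 + s)
      simp only [Complex.add_re, Complex.one_re] at this
      linarith
    have h4 : ‖1 - s‖ * 1 ≤ ‖1 - s‖ * ‖1 + s‖ := by gcongr
    have h5 : ‖x‖ ^ 2 ≤ 1 * ‖x‖ := by rw [sq]; gcongr; linarith
    linarith
  have hg : ‖R / s - (h ^ 2 - E ^ 2 : ℝ)‖ ≤ 8 * M ^ 2 * ‖x‖ := by
    have : R / s - (h ^ 2 - E ^ 2 : ℝ)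
        = (R - (h ^ 2 - E ^ 2 : ℝ) + (h ^ 2 - E ^ 2 : ℝ) * (1 - s)) / s := by
      field_simp; ring
    rw [this, norm_div, div_le_iff₀ (by linarith)]
    have h6 : ‖((h ^ 2 - E ^ 2 : ℝ) : ℂ) * (1 - s)‖ ≤ M ^ 2 * ‖x‖ := by
      rw [norm_mul, Complex.norm_real, Real.norm_eq_abs]; gcongr
    have h7 := norm_add_le (R - (h ^ 2 - E ^ 2 : ℝ)) ((h ^ 2 - E ^ 2 : ℝ) * (1 - s))
    have h8 : 8 * M ^ 2 * ‖x‖ * (1 / 2) ≤ 8 * M ^ 2 * ‖x‖ * ‖s‖ := by gcongr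
    linarith
  have hgre : h ^ 2 - E ^ 2 - 8 * M ^ 2 * ‖x‖ ≤ (R / s).re := by
    have := (abs_le.mp ((Complex.abs_re_le_norm _).trans hg)).1
    rw [Complex.sub_re, Complex.ofReal_re] at this
    linarith
  have hRn : |R.re| ≤ 3 * M ^ 2 := by
    have h1 := (Complex.abs_re_le_norm _).trans hRd
    rw [Complex.sub_re, Complex.ofReal_re] at h1
    have h2 := abs_add_le (R.re - (h ^ 2 - E ^ 2)) (h ^ 2 - E ^ 2)
    rw [sub_add_cancel] at h2
    have h3 : 3 * M ^ 2 * ‖x‖ ≤ 3 * M ^ 2 * (1 / 2) := by gcongr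
    linarith
  have hRim : |R.im| ≤ 4 * M ^ 2 * x.re := by
    have h1 : R.im = x.re * (2 * ((h ^ 2 + k ^ 2) * x.im) + 2 * (E * k)) := by
      rw [hR]
      simp only [sq, Complex.add_im, Complex.mul_im, Complex.ofReal_re, Complex.ofReal_im,
        Complex.mul_re, Complex.I_re, Complex.I_im]
      ring
    rw [h1, abs_mul, abs_of_pos hx0, mul_comm]
    gcongr
    refine (abs_add_le _ _).trans ?_
    rw [abs_mul, abs_mul 2 (E * k), abs_two, abs_mul (h ^ 2 + k ^ 2),
      abs_of_nonneg (by positivity : 0 ≤ h ^ 2 + k ^ 2)]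
    have : (h ^ 2 + k ^ 2) * |x.im| ≤ (M ^ 2 + M ^ 2) * (1 / 2) := by gcongr; linarith
    linarith
  have hgim : |(R / s).im| ≤ 20 * M ^ 2 * x.re := by
    have hns : 1 / 2 * s.re ≤ Complex.normSq s := by
      rw [Complex.normSq_apply]
      have := mul_le_mul_of_nonneg_right hp hs0
      linarith [mul_self_nonneg s.im]
    have hns0 : 0 < Complex.normSq s := by linarith
    rw [Complex.div_im, ← sub_div, abs_div, abs_of_pos hns0, div_le_iff₀ hns0]
    refine (abs_sub _ _).trans ?_
    rw [abs_mul, abs_mul, abs_of_nonneg hs0]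
    have h1 : |R.im| * s.re ≤ 4 * M ^ 2 * x.re * s.re := by gcongr
    have h2 : |R.re| * |s.im| ≤ 3 * M ^ 2 * x.re := by gcongr
    have h3 : 20 * M ^ 2 * x.re * (1 / 2 * s.re) ≤ 20 * M ^ 2 * x.re * Complex.normSq s := by
      gcongr
    have h4 : M ^ 2 * x.re * (1 / 2) ≤ M ^ 2 * x.re * s.re := by gcongr
    linarith
  have hP : scaledSymbol ε a b h k E x s / s
      = w ^ 2 + (ε ^ 2 * b ^ 2 : ℝ) + (ε ^ 2 : ℝ) * (R / s) := by
    unfold scaledSymbol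
    rw [← hw, ← hR]
    field_simp
  -- Multiplying by the conjugate of w makes the model coercive: Re(w̄ w²) = |w|² Re x, and the
  -- positive constant ε²(b² + h² - E²) contributes its product with Re w = Re x.
  have hRe : ((starRingEnd ℂ) w * (scaledSymbol ε a b h k E x s / s)).re
      = x.re * (w.re ^ 2 + w.im ^ 2 + ε ^ 2 * b ^ 2)
        + ε ^ 2 * (x.re * (R / s).re + (x.im + ε * a) * (R / s).im) := by
    rw [hP]
    have : w.re = x.re := by simp [hw]
    have h2 : w.im = x.im + ε * a := by simp [hw]
    simp only [sq, Complex.mul_re, Complex.add_re, Complex.add_im, Complex.mul_im,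
      Complex.conj_re, Complex.conj_im, Complex.ofReal_re, Complex.ofReal_im, this, h2]
    ring
  have hlow : x.re * ε ^ 2 * κ / 2
      ≤ ((starRingEnd ℂ) w * (scaledSymbol ε a b h k E x s / s)).re := by
    rw [hRe]
    have h1 : x.re * (h ^ 2 - E ^ 2 - 8 * M ^ 2 * δ) ≤ x.re * (R / s).re := by
      gcongr
      have : 8 * M ^ 2 * ‖x‖ ≤ 8 * M ^ 2 * δ := by gcongr
      linarith
    have h2 : |(x.im + ε * a) * (R / s).im| ≤ (δ + ε * M) * (20 * M ^ 2 * x.re) := by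
      have hδ0 : 0 ≤ δ := (norm_nonneg x).trans hx
      rw [abs_mul]
      gcongr
      · exact (abs_add_le _ _).trans (by linarith)
    have h3 := (abs_le.mp h2).1
    have h4 : x.re * (κ / 2) ≤ x.re * b ^ 2
        + (x.re * (R / s).re + (x.im + ε * a) * (R / s).im) := by
      -- The loss is 8M²δ + 20M²δ = 28M²δ from the size of x and 20M²(εM) from the drift a, at most
      -- κ/4 each.
      have h5 : x.re * (κ / 2) ≤ x.re * (b ^ 2 + (h ^ 2 - E ^ 2 - 8 * M ^ 2 * δ)
          - (δ + ε * M) * (20 * M ^ 2)) := by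
        gcongr
        linarith
      linarith
    have h6 := mul_le_mul_of_nonneg_left h4 (sq_nonneg ε)
    have h7 : 0 ≤ x.re * (w.re ^ 2 + w.im ^ 2) := by positivity
    linarith
  have hup := (Complex.re_le_norm ((starRingEnd ℂ) w * (scaledSymbol ε a b h k E x s / s)))
  rw [norm_mul, Complex.norm_conj, norm_div] at hup
  have hwn : ‖w‖ ≤ 1 := by
    refine (norm_add_le _ _).trans ?_
    rw [norm_mul, Complex.norm_I, Complex.norm_real, Real.norm_eq_abs]
    linarith
  have h9 : ‖w‖ * (‖scaledSymbol ε a b h k E x s‖ / ‖s‖)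
      ≤ 1 * (‖scaledSymbol ε a b h k E x s‖ / (1 / 2)) := by gcongr
  linarith

/-- Uniform lower bound for the scaled symbol in the right half-plane. -/
lemma exists_scaledSymbol_lower {M κ : ℝ} (hM : 1 ≤ M) (hκ : 0 < κ) :
    ∃ ε₀ : ℝ, 0 < ε₀ ∧ ∀ ε : ℝ, 0 < ε → ε < ε₀ → ∃ c : ℝ, 0 < c ∧
      ∀ (a b h k E : ℝ) (x s : ℂ), |a| ≤ M → |b| ≤ M → |h| ≤ M → |k| ≤ M → |E| ≤ M →
        κ ≤ b ^ 2 + h ^ 2 - E ^ 2 → s ^ 2 = x ^ 2 + 1 → 0 ≤ s.re → 0 < x.re →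
        c * x.re * (1 + ‖x‖) ^ 3 ≤ ‖scaledSymbol ε a b h k E x s‖ * (1 + x.re) := by
  have hM0 : 0 < M := by linarith
  -- The radius of the region near 0 is fixed by M and κ alone (112 = 4 · 28). The threshold for ε
  -- is then chosen below so that εM ≤ δ/64 and 20M²(εM) ≤ κ/4.
  set δ := min (1 / 2) (κ / (112 * M ^ 2)) with hδ
  have hδ0 : 0 < δ := by positivity
  have hδ1 : δ ≤ 1 / 2 := min_le_left _ _
  have hδκ : 28 * M ^ 2 * δ ≤ κ / 4 := by
    have : δ ≤ κ / (112 * M ^ 2) := min_le_right _ _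
    rw [le_div_iff₀ (by positivity)] at this
    linarith
  refine ⟨min (δ / (64 * M)) (κ / (80 * M ^ 3)), by positivity, fun ε hε hεlt => ?_⟩
  have hε1 : ε * M ≤ δ / 64 := by
    have := hεlt.le.trans (min_le_left _ _)
    rw [le_div_iff₀ (by positivity)] at this
    linarith
  have hε2 : 20 * M ^ 2 * (ε * M) ≤ κ / 4 := by
    have := hεlt.le.trans (min_le_right _ _)
    rw [le_div_iff₀ (by positivity)] at this
    linarith
  have hε3 : ε * M ≤ 1 / 8 := by linarith
  -- One entry for each region. In the two bounded ones |x| ≤ 2, so (1 + |x|)³ ≤ 64, and 256 = 4 ·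
  -- 64 absorbs this and the 1/4 of the local bounds.
  refine ⟨min (min (ε ^ 2 * κ / 256) (1 / 256)) (δ ^ 2 / 1536), by positivity, ?_⟩
  intro a b h k E x s ha hb hh hk hE hκ' hs hs0 hx0
  set c := min (min (ε ^ 2 * κ / 256) (1 / 256)) (δ ^ 2 / 1536) with hc
  have hc1 : c ≤ ε ^ 2 * κ / 256 := (min_le_left _ _).trans (min_le_left _ _)
  have hc2 : c ≤ 1 / 256 := (min_le_left _ _).trans (min_le_right _ _)
  have hc3 : c ≤ δ ^ 2 / 1536 := min_le_right _ _
  have hc0 : 0 < c := by positivity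
  have hsx := norm_ge_of_sq_eq hs hx0
  have hN := norm_nonneg (scaledSymbol ε a b h k E x s)
  have hsmall : ‖x‖ ≤ 2 → (1 + ‖x‖) ^ 3 ≤ 64 := by
    intro hx
    have : (1 + ‖x‖) ^ 3 ≤ (4 : ℝ) ^ 3 := by
      gcongr; linarith
    linarith
  have hmul : ‖scaledSymbol ε a b h k E x s‖ * 1
      ≤ ‖scaledSymbol ε a b h k E x s‖ * (1 + x.re) := by gcongr; linarith
  rcases le_or_gt ‖x‖ δ with hx | hx
  · have h1 := scaledSymbol_lower_near hM hε hκ' hδ1 hδκ hε3 hε2 ha hh hk hE hs hs0 hx0 hx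
    have h2 : c * x.re * (1 + ‖x‖) ^ 3 ≤ ε ^ 2 * κ / 256 * x.re * 64 := by
      gcongr; exact hsmall (by linarith)
    linarith
  rcases le_or_gt ‖s‖ (1 / 8) with h8 | h8
  · have hx2 : ‖x‖ ≤ 2 := by
      have h1 : ‖x‖ ^ 2 ≤ 2 ^ 2 := by
        rw [← norm_pow, show x ^ 2 = s ^ 2 - 1 by rw [hs]; ring]
        refine (norm_sub_le _ _).trans ?_
        rw [norm_pow, norm_one]
        nlinarith [norm_nonneg s]
      exact (abs_le_of_sq_le_sq' h1 (by norm_num)).2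
    have hprod : ‖x - Complex.I‖ * ‖x + Complex.I‖ = ‖s‖ ^ 2 := by
      rw [← norm_pow, ← norm_mul, hs]; congr 1; ring_nf; simp; ring
    -- The distances from x to i and -i have product |s|² and sum at least 2; one of them is at
    -- least 1, so the other is at most |s|².
    have h2 : ∃ σ : ℝ, σ ^ 2 = 1 ∧ ‖x - Complex.I * σ‖ ≤ ‖s‖ ^ 2 := by
      have h3 : 2 ≤ ‖x - Complex.I‖ + ‖x + Complex.I‖ := by
        have := norm_sub_le (x + Complex.I) (x - Complex.I)
        rw [show x + Complex.I - (x - Complex.I) = 2 * Complex.I by ring, norm_mul,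
          Complex.norm_I] at this
        norm_num at this
        linarith
      rcases le_total 1 ‖x + Complex.I‖ with h4 | h4
      · refine ⟨1, by norm_num, ?_⟩
        rw [← hprod]
        simpa using le_mul_of_one_le_right (norm_nonneg (x - Complex.I)) h4
      · refine ⟨-1, by norm_num, ?_⟩
        rw [← hprod]
        simpa using le_mul_of_one_le_left (norm_nonneg (x + Complex.I))
          (by linarith : 1 ≤ ‖x - Complex.I‖)
    obtain ⟨σ, hσ, hd⟩ := h2
    have h1 := scaledSymbol_lower_branch hM hε hε3 ha hb hh hk hE hσ hs0 h8 hd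
    have h5 : c * x.re * (1 + ‖x‖) ^ 3 ≤ 1 / 256 * x.re * 64 := by
      gcongr; exact hsmall hx2
    linarith
  · have h1 := scaledSymbol_lower_far hM hε hδ0 (by linarith) hε1 ha hb hh hk hE hs h8.le hx.le
    have h2 : c * x.re * (1 + ‖x‖) ^ 3 ≤ (δ ^ 2 / 1536 * (1 + ‖x‖) ^ 3) * (1 + x.re) := by
      have : c * x.re * (1 + ‖x‖) ^ 3 ≤ δ ^ 2 / 1536 * (1 + x.re) * (1 + ‖x‖) ^ 3 := by
        gcongr; linarith
      linarith
    refine h2.trans ?_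
    gcongr

/-! ### From the scaled symbol to the Lopatinskii symbol -/

lemma freqNorm_sq (j : ℤ × ℤ) : freqNorm j ^ 2 = (j.1 : ℝ) ^ 2 + (j.2 : ℝ) ^ 2 :=
  Real.sq_sqrt (by positivity)

lemma one_le_freqNorm {j : ℤ × ℤ} (hj : j ≠ 0) : 1 ≤ freqNorm j := by
  rw [freqNorm, Real.one_le_sqrt]
  have : 1 ≤ j.1 ^ 2 + j.2 ^ 2 := by
    by_contra! h
    apply hj
    have h1 : j.1 = 0 := by
      by_contra h0
      have := sq_nonneg j.2
      have : 0 < j.1 ^ 2 := by positivity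
      omega
    have h2 : j.2 = 0 := by
      by_contra h0
      have := sq_nonneg j.1
      have : 0 < j.2 ^ 2 := by positivity
      omega
    exact Prod.ext h1 h2
  exact_mod_cast this

lemma mem_slitPlane_of_re_pos {ν r : ℝ} (hν : 0 < ν) (hr : 0 < r) {z : ℂ} (hz : 0 < z.re) :
    (ν : ℂ) ^ 2 * z ^ 2 + (r : ℂ) ^ 2 ∈ Complex.slitPlane := by
  rw [Complex.mem_slitPlane_iff]
  have e1 : ((ν : ℂ) ^ 2 * z ^ 2 + (r : ℂ) ^ 2).re = ν ^ 2 * (z.re ^ 2 - z.im ^ 2) + r ^ 2 := by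
    simp [sq]
  have e2 : ((ν : ℂ) ^ 2 * z ^ 2 + (r : ℂ) ^ 2).im = ν ^ 2 * (2 * z.re * z.im) := by
    simp only [sq, Complex.add_im, Complex.mul_im, Complex.mul_re, Complex.ofReal_im,
      Complex.ofReal_re]
    ring
  rw [e1, e2]
  by_cases h : z.im = 0
  · left
    have : 0 < ν ^ 2 * z.re ^ 2 + r ^ 2 := by positivity
    rw [h]
    linarith
  · right
    exact mul_ne_zero (by positivity) (mul_ne_zero (by positivity) h)

lemma cpow_half_sq (w : ℂ) : (w ^ (1 / 2 : ℂ)) ^ 2 = w := by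
  rw [← Complex.cpow_nat_mul]; norm_num

lemma cpow_half_re_nonneg (w : ℂ) : 0 ≤ (w ^ (1 / 2 : ℂ)).re := by
  by_cases hw : w = 0
  · rw [hw, Complex.zero_cpow (by norm_num)]; simp
  · rw [Complex.cpow_def_of_ne_zero hw, Complex.exp_re]
    apply mul_nonneg (Real.exp_pos _).le
    apply Real.cos_nonneg_of_mem_Icc
    have e : (Complex.log w * (1 / 2)).im = w.arg / 2 := by
      rw [Complex.mul_im, Complex.log_im]; norm_num; ring
    rw [e]
    have h1 := Complex.neg_pi_lt_arg w
    have h2 := Complex.arg_le_pi w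
    constructor <;> linarith

/-- Let q be the quadratic form (B·ω)² + (H·ω)² at a unit vector ω and q' its value at the rotated
vector. Then q + q' is the trace |B|² + |H|², and qq' is at least the determinant |B × H|² by the
Lagrange identity. Hence q is at least the smaller eigenvalue, and κ is the slack in the stability
condition. -/
lemma RefState.Stable.exists_gap {S : RefState} (hS : S.Stable) :
    ∃ κ : ℝ, 0 < κ ∧ ∀ x y : ℝ, x ^ 2 + y ^ 2 = 1 →
      κ ≤ (S.B₁ * x + S.B₂ * y) ^ 2 + (S.H₁ * x + S.H₂ * y) ^ 2 - S.E₃ ^ 2 := by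
  have h := hS
  simp only [RefState.Stable, RefState.E, RefState.B, RefState.H, dotProduct, crossProduct,
    Fin.sum_univ_three, LinearMap.mk₂_apply] at h
  simp only [Matrix.cons_val_zero, Matrix.cons_val_one, Matrix.cons_val] at h
  set D : ℝ := (S.B₁ * S.B₁ + S.B₂ * S.B₂ + 0 * 0 + (S.H₁ * S.H₁ + S.H₂ * S.H₂ + 0 * 0)) ^ 2
    - 4 * ((S.B₂ * 0 - 0 * S.H₂) * (S.B₂ * 0 - 0 * S.H₂)
      + (0 * S.H₁ - S.B₁ * 0) * (0 * S.H₁ - S.B₁ * 0)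
      + (S.B₁ * S.H₂ - S.B₂ * S.H₁) * (S.B₁ * S.H₂ - S.B₂ * S.H₁)) with hD
  refine ⟨_, sub_pos.mpr h, fun x y hxy => ?_⟩
  set q := (S.B₁ * x + S.B₂ * y) ^ 2 + (S.H₁ * x + S.H₂ * y) ^ 2 with hq
  set q' := (S.B₁ * y - S.B₂ * x) ^ 2 + (S.H₁ * y - S.H₂ * x) ^ 2 with hq'
  have h1 : q + q' = S.B₁ ^ 2 + S.B₂ ^ 2 + S.H₁ ^ 2 + S.H₂ ^ 2 := by
    rw [hq, hq']
    linear_combination (S.B₁ ^ 2 + S.B₂ ^ 2 + S.H₁ ^ 2 + S.H₂ ^ 2) * hxy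
  have h2 : (S.B₁ * S.H₂ - S.B₂ * S.H₁) ^ 2 ≤ q * q' := by
    have e : S.B₁ * S.H₂ - S.B₂ * S.H₁ = -((S.B₁ * x + S.B₂ * y) * (S.H₁ * y - S.H₂ * x)
        - (S.H₁ * x + S.H₂ * y) * (S.B₁ * y - S.B₂ * x)) := by
      linear_combination (-(S.B₁ * S.H₂ - S.B₂ * S.H₁)) * hxy
    rw [e, hq, hq']
    nlinarith [sq_nonneg ((S.B₁ * x + S.B₂ * y) * (S.B₁ * y - S.B₂ * x)
      + (S.H₁ * x + S.H₂ * y) * (S.H₁ * y - S.H₂ * x))]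
  have h3 : (q - q') ^ 2 ≤ D := by
    have : D = (q + q') ^ 2 - 4 * (S.B₁ * S.H₂ - S.B₂ * S.H₁) ^ 2 := by rw [h1, hD]; ring
    rw [this]; linarith
  have h4 : q' - q ≤ Real.sqrt D := by
    apply Real.le_sqrt_of_sq_le; linarith
  linarith

/-- Homogeneity of degree three in (z, j), once the squares are expanded: the electric terms give
the cross term 2iE₃νz(H₁j₂ - H₂j₁) and -E₃²|j|², and |H|² splits as h² + k² along and across j/|j|.
-/
lemma lopatinskii_eq_scaledSymbol (S : RefState) {ν : ℝ} (hν : 0 < ν) (z : ℂ) {j : ℤ × ℤ}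
    (hj : j ≠ 0) :
    lopatinskii S ν z j = ((freqNorm j : ℂ) ^ 3 / (ν : ℂ) ^ 2) *
      scaledSymbol ν (S.u₁ * (j.1 / freqNorm j) + S.u₂ * (j.2 / freqNorm j))
        (S.B₁ * (j.1 / freqNorm j) + S.B₂ * (j.2 / freqNorm j))
        (S.H₁ * (j.1 / freqNorm j) + S.H₂ * (j.2 / freqNorm j))
        (S.H₁ * (j.2 / freqNorm j) - S.H₂ * (j.1 / freqNorm j)) S.E₃ (ν * z / freqNorm j)
        (((ν : ℂ) ^ 2 * z ^ 2 + (freqNorm j : ℂ) ^ 2) ^ (1 / 2 : ℂ) / freqNorm j) := by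
  have hr : (freqNorm j : ℂ) ≠ 0 := by
    exact_mod_cast (zero_lt_one.trans_le (one_le_freqNorm hj)).ne'
  have hν' : (ν : ℂ) ≠ 0 := by exact_mod_cast hν.ne'
  have hsq : (freqNorm j : ℂ) ^ 2 = (j.1 : ℂ) ^ 2 + (j.2 : ℂ) ^ 2 := by
    exact_mod_cast congrArg Complex.ofReal (freqNorm_sq j)
  have hI := Complex.I_sq
  unfold lopatinskii scaledSymbol
  generalize ((ν : ℂ) ^ 2 * z ^ 2 + (freqNorm j : ℂ) ^ 2) ^ (1 / 2 : ℂ) = s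
  push_cast
  generalize (freqNorm j : ℂ) = r at *
  have e : r ^ 3 / (ν : ℂ) ^ 2 * (s / r *
        ((ν * z / r + Complex.I * (ν * (S.u₁ * (j.1 / r) + S.u₂ * (j.2 / r)))) ^ 2
          + ν ^ 2 * (S.B₁ * (j.1 / r) + S.B₂ * (j.2 / r)) ^ 2)
      + ν ^ 2 * (((S.H₁ * (j.1 / r) + S.H₂ * (j.2 / r)) ^ 2
          + (S.H₁ * (j.2 / r) - S.H₂ * (j.1 / r)) ^ 2) * (ν * z / r) ^ 2
        + Complex.I * (2 * S.E₃ * (S.H₁ * (j.2 / r) - S.H₂ * (j.1 / r))) * (ν * z / r)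
        + ((S.H₁ * (j.1 / r) + S.H₂ * (j.2 / r)) ^ 2 - S.E₃ ^ 2)))
      = s * ((z + Complex.I * (S.u₁ * j.1 + S.u₂ * j.2)) ^ 2 + (S.B₁ * j.1 + S.B₂ * j.2) ^ 2)
      + r * ((S.H₁ ^ 2 + S.H₂ ^ 2) * ((j.1 ^ 2 + j.2 ^ 2) / r ^ 2) * (ν * z) ^ 2
        + Complex.I * (2 * S.E₃ * (S.H₁ * j.2 - S.H₂ * j.1)) * (ν * z)
        + ((S.H₁ * j.1 + S.H₂ * j.2) ^ 2 - S.E₃ ^ 2 * r ^ 2)) := by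
    field_simp
    ring
  rw [e, ← hsq, div_self (pow_ne_zero 2 hr), hsq]
  linear_combination (-s * (S.B₁ * j.1 + S.B₂ * j.2) ^ 2
    + r * (S.E₃ ^ 2 * (j.1 ^ 2 + j.2 ^ 2) - (S.H₁ * j.1 + S.H₂ * j.2) ^ 2)) * hI

/-- Uniform stability: the symbol is bounded below by `|z|³ / |j|` in `Re z ≥ 1`. -/
theorem exists_lopatinskii_lower {S : RefState} (hS : S.Stable) :
    ∃ ν₀ : ℝ, 0 < ν₀ ∧ ∀ ν : ℝ, 0 < ν → ν < ν₀ → ∃ C : ℝ, 0 < C ∧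
      ∀ j : ℤ × ℤ, j ≠ 0 → ∀ z : ℂ, 1 ≤ z.re →
        ‖z‖ ^ 3 ≤ C * freqNorm j * ‖lopatinskii S ν z j‖ := by
  obtain ⟨κ, hκ, hgap⟩ := hS.exists_gap
  set M : ℝ := 1 + |S.u₁| + |S.u₂| + |S.B₁| + |S.B₂| + |S.H₁| + |S.H₂| + |S.E₃| with hM
  have h1 : 1 ≤ M := by
    have : 0 ≤ |S.u₁| + |S.u₂| + |S.B₁| + |S.B₂| + |S.H₁| + |S.H₂| + |S.E₃| := by positivity
    linarith
  obtain ⟨ε₀, hε₀, H⟩ := exists_scaledSymbol_lower h1 hκ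
  refine ⟨ε₀, hε₀, fun ν hν hνlt => ?_⟩
  obtain ⟨c, hc, Hc⟩ := H ν hν hνlt
  refine ⟨(1 + ν) / (c * ν ^ 2), by positivity, fun j hj z hz => ?_⟩
  have hr := one_le_freqNorm hj
  have hr0 : 0 < freqNorm j := by linarith
  have hrC : (freqNorm j : ℂ) ≠ 0 := by exact_mod_cast hr0.ne'
  have hunit : (j.1 / freqNorm j) ^ 2 + (j.2 / freqNorm j) ^ 2 = 1 := by
    rw [div_pow, div_pow, ← add_div, ← freqNorm_sq, div_self (by positivity)]
  have hω₁ : |j.1 / freqNorm j| ≤ 1 := by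
    rw [← sq_le_one_iff_abs_le_one]; linarith [sq_nonneg (j.2 / freqNorm j)]
  have hω₂ : |j.2 / freqNorm j| ≤ 1 := by
    rw [← sq_le_one_iff_abs_le_one]; linarith [sq_nonneg (j.1 / freqNorm j)]
  have hlin : ∀ p q x y : ℝ, |p| + |q| ≤ M → |x| ≤ 1 → |y| ≤ 1 → |p * x + q * y| ≤ M := by
    intro p q x y hpq hx hy
    refine ((abs_add_le _ _).trans ?_).trans hpq
    rw [abs_mul, abs_mul]
    have := mul_le_mul_of_nonneg_left hx (abs_nonneg p)
    have := mul_le_mul_of_nonneg_left hy (abs_nonneg q)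
    linarith
  have hu := abs_nonneg S.u₁
  have hu' := abs_nonneg S.u₂
  have hB := abs_nonneg S.B₁
  have hB' := abs_nonneg S.B₂
  have hH := abs_nonneg S.H₁
  have hH' := abs_nonneg S.H₂
  have hE := abs_nonneg S.E₃
  set s : ℂ := ((ν : ℂ) ^ 2 * z ^ 2 + (freqNorm j : ℂ) ^ 2) ^ (1 / 2 : ℂ) / freqNorm j with hs
  have hxre : ((ν : ℂ) * z / freqNorm j).re = ν * z.re / freqNorm j := by
    rw [Complex.div_ofReal_re, Complex.re_ofReal_mul]
  have key := Hc (S.u₁ * (j.1 / freqNorm j) + S.u₂ * (j.2 / freqNorm j))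
        (S.B₁ * (j.1 / freqNorm j) + S.B₂ * (j.2 / freqNorm j))
        (S.H₁ * (j.1 / freqNorm j) + S.H₂ * (j.2 / freqNorm j))
        (S.H₁ * (j.2 / freqNorm j) - S.H₂ * (j.1 / freqNorm j)) S.E₃ (ν * z / freqNorm j) s
        (hlin _ _ _ _ (by linarith) hω₁ hω₂) (hlin _ _ _ _ (by linarith) hω₁ hω₂)
        (hlin _ _ _ _ (by linarith) hω₁ hω₂)
        (by rw [sub_eq_add_neg, ← neg_mul]
            exact hlin _ _ _ _ (by rw [abs_neg]; linarith) hω₂ hω₁)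
        (by linarith) (hgap _ _ hunit)
        (by rw [hs, div_pow, cpow_half_sq]; field_simp)
        (by rw [hs, Complex.div_ofReal_re]; exact div_nonneg (cpow_half_re_nonneg _) hr0.le)
        (by rw [hxre]; positivity)
  rw [lopatinskii_eq_scaledSymbol S hν z hj, ← hs, norm_mul, norm_div, norm_pow, norm_pow,
    Complex.norm_real, Complex.norm_real, Real.norm_of_nonneg hr0.le, Real.norm_of_nonneg hν.le]
  set P := ‖scaledSymbol ν (S.u₁ * (j.1 / freqNorm j) + S.u₂ * (j.2 / freqNorm j))
        (S.B₁ * (j.1 / freqNorm j) + S.B₂ * (j.2 / freqNorm j))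
        (S.H₁ * (j.1 / freqNorm j) + S.H₂ * (j.2 / freqNorm j))
        (S.H₁ * (j.2 / freqNorm j) - S.H₂ * (j.1 / freqNorm j)) S.E₃ (ν * z / freqNorm j) s‖
  have hP : 0 ≤ P := norm_nonneg _
  rw [hxre, norm_div, norm_mul, Complex.norm_real, Complex.norm_real,
    Real.norm_of_nonneg hr0.le, Real.norm_of_nonneg hν.le] at key
  set r := freqNorm j
  have hz0 : 0 < z.re := by linarith
  have h2 : c * (ν * z.re / r) * (ν * ‖z‖ / r) ^ 3 ≤ P * (1 + ν * z.re / r) := by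
    refine le_trans ?_ key
    gcongr
    linarith
  have h3 : c * ν ^ 4 * z.re * ‖z‖ ^ 3 ≤ P * r ^ 3 * (r + ν * z.re) := by
    have e1 : c * (ν * z.re / r) * (ν * ‖z‖ / r) ^ 3 * r ^ 4 = c * ν ^ 4 * z.re * ‖z‖ ^ 3 := by
      field_simp
    have e2 : P * (1 + ν * z.re / r) * r ^ 4 = P * r ^ 3 * (r + ν * z.re) := by
      field_simp
    rw [← e1, ← e2]
    gcongr
  -- As |j| ≥ 1 and Re z ≥ 1, the sum is at most (1 + ν)|j| Re z. The factor Re z then cancels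
  -- against the left side; the extra |j| is the loss in the final estimate.
  have h4 : P * r ^ 3 * (r + ν * z.re) ≤ P * r ^ 3 * ((1 + ν) * r * z.re) := by
    gcongr
    have a1 : r ≤ r * z.re := le_mul_of_one_le_right hr0.le hz
    have a2 : ν * z.re ≤ ν * (r * z.re) := by
      gcongr; exact le_mul_of_one_le_left hz0.le hr
    linarith
  have h5 : c * ν ^ 4 * ‖z‖ ^ 3 ≤ P * r ^ 3 * ((1 + ν) * r) := by
    refine le_of_mul_le_mul_right ?_ hz0
    linarith
  have e3 : (1 + ν) / (c * ν ^ 2) * r * (r ^ 3 / ν ^ 2 * P) = P * r ^ 3 * ((1 + ν) * r) / (c * ν ^ 4) := by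
    field_simp
  rw [e3, le_div_iff₀ (by positivity)]
  linarith

/-! ### The inverse Laplace transform along vertical lines -/

/-- The vertical line `Re z = σ`. -/
def vline (σ τ : ℝ) : ℂ := σ + τ * Complex.I

@[simp] lemma vline_re (σ τ : ℝ) : (vline σ τ).re = σ := by simp [vline]

@[simp] lemma vline_im (σ τ : ℝ) : (vline σ τ).im = τ := by simp [vline]

lemma continuous_vline (σ : ℝ) : Continuous (vline σ) := by
  unfold vline; fun_prop

lemma sq_norm_vline (σ τ : ℝ) : ‖vline σ τ‖ ^ 2 = σ ^ 2 + τ ^ 2 := by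
  rw [Complex.sq_norm, Complex.normSq_apply, vline_re, vline_im]; ring

/-- The open right half-plane `Re z > σ`. -/
def halfPlane (σ : ℝ) : Set ℂ := {z | σ < z.re}

lemma isOpen_halfPlane (σ : ℝ) : IsOpen (halfPlane σ) :=
  isOpen_lt continuous_const Complex.continuous_re

/-- The inverse Laplace transform along `Re z = σ`. -/
def invLaplace (σ : ℝ) (F : ℂ → ℂ) (t : ℝ) : ℂ :=
  (2 * Real.pi : ℂ)⁻¹ * ∫ τ : ℝ, Complex.exp (vline σ τ * t) * F (vline σ τ)

lemma norm_exp_vline_mul (σ τ t : ℝ) :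
    ‖Complex.exp (vline σ τ * t)‖ = Real.exp (σ * t) := by
  rw [Complex.norm_exp, Complex.re_mul_ofReal, vline_re]

lemma integral_inv_sq_add_sq {σ : ℝ} (hσ : 0 < σ) :
    Integrable (fun τ : ℝ => (σ ^ 2 + τ ^ 2)⁻¹) ∧ ∫ τ : ℝ, (σ ^ 2 + τ ^ 2)⁻¹ = Real.pi / σ := by
  have e : (fun τ : ℝ => (σ ^ 2 + τ ^ 2)⁻¹)
      = fun τ => (σ ^ 2)⁻¹ * (fun x : ℝ => (1 + x ^ 2)⁻¹) (τ / σ) := by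
    funext τ
    field_simp
  rw [e]
  constructor
  · exact (integrable_inv_one_add_sq.comp_div hσ.ne').const_mul _
  · rw [integral_const_mul, Measure.integral_comp_div (fun x : ℝ => (1 + x ^ 2)⁻¹) σ,
      integral_univ_inv_one_add_sq, abs_of_pos hσ, smul_eq_mul]
    field_simp

lemma norm_le_of_bound {F : ℂ → ℂ} {σ M : ℝ}
    (hF : ∀ τ, ‖F (vline σ τ)‖ ≤ M / ‖vline σ τ‖ ^ 2) (t τ : ℝ) :
    ‖Complex.exp (vline σ τ * t) * F (vline σ τ)‖
      ≤ Real.exp (σ * t) * M * (σ ^ 2 + τ ^ 2)⁻¹ := by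
  rw [norm_mul, norm_exp_vline_mul, mul_assoc, ← div_eq_mul_inv, ← sq_norm_vline]
  gcongr
  exact hF τ

lemma integrable_invLaplace {F : ℂ → ℂ} {σ M : ℝ} (hσ : 0 < σ)
    (hc : Continuous fun τ => F (vline σ τ))
    (hF : ∀ τ, ‖F (vline σ τ)‖ ≤ M / ‖vline σ τ‖ ^ 2) (t : ℝ) :
    Integrable fun τ : ℝ => Complex.exp (vline σ τ * t) * F (vline σ τ) := by
  refine Integrable.mono' ((integral_inv_sq_add_sq hσ).1.const_mul (Real.exp (σ * t) * M)) ?_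
    (Eventually.of_forall (norm_le_of_bound hF t))
  have := continuous_vline σ
  exact ((by fun_prop : Continuous fun τ => Complex.exp (vline σ τ * t)).mul
    hc).aestronglyMeasurable

lemma norm_invLaplace_le {F : ℂ → ℂ} {σ M : ℝ} (hσ : 0 < σ)
    (hF : ∀ τ, ‖F (vline σ τ)‖ ≤ M / ‖vline σ τ‖ ^ 2) (t : ℝ) :
    ‖invLaplace σ F t‖ ≤ Real.exp (σ * t) * M / σ := by
  obtain ⟨h1, h2⟩ := integral_inv_sq_add_sq hσ
  have hM : 0 ≤ M := by
    have := (norm_nonneg _).trans (hF 0)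
    have h3 : 0 < ‖vline σ 0‖ ^ 2 := by rw [sq_norm_vline]; positivity
    exact (div_nonneg_iff.mp this).elim (fun h => h.1) fun h => absurd h.2 (not_le.mpr h3)
  have h3 := norm_integral_le_of_norm_le (h1.const_mul (Real.exp (σ * t) * M))
    (Eventually.of_forall (norm_le_of_bound hF t))
  rw [integral_const_mul, h2] at h3
  rw [invLaplace, norm_mul, norm_inv, norm_mul, Complex.norm_real, Real.norm_of_nonneg
    Real.pi_pos.le, Complex.norm_two, inv_mul_le_iff₀ (by positivity)]
  refine h3.trans ?_
  have h4 : 0 ≤ Real.exp (σ * t) * M * (Real.pi / σ) := by positivity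
  have e : 2 * Real.pi * (Real.exp (σ * t) * M / σ)
    = 2 * (Real.exp (σ * t) * M * (Real.pi / σ)) := by ring
  rw [e]; linarith

lemma continuous_invLaplace {F : ℂ → ℂ} {σ M : ℝ} (hσ : 0 < σ)
    (hc : Continuous fun τ => F (vline σ τ))
    (hF : ∀ τ, ‖F (vline σ τ)‖ ≤ M / ‖vline σ τ‖ ^ 2) : Continuous (invLaplace σ F) := by
  have e : invLaplace σ F = fun t : ℝ => (2 * Real.pi : ℂ)⁻¹ * (Complex.exp (σ * t) *
      ∫ τ : ℝ, Complex.exp (τ * Complex.I * t) * F (vline σ τ)) := by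
    funext t
    rw [invLaplace, ← integral_const_mul (Complex.exp (σ * t))]
    congr 2
    funext τ
    rw [← mul_assoc, ← Complex.exp_add, vline]
    ring_nf
  rw [e]
  refine continuous_const.mul (Continuous.mul (by fun_prop) ?_)
  refine continuous_of_dominated (bound := fun τ => M * (σ ^ 2 + τ ^ 2)⁻¹) ?_ ?_ ?_ ?_
  · intro t
    exact ((by fun_prop : Continuous fun τ : ℝ => Complex.exp (τ * Complex.I * t)).mul
      hc).aestronglyMeasurable
  · intro t
    refine Eventually.of_forall fun τ => ?_
    have : ‖Complex.exp (τ * Complex.I * t)‖ = 1 := by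
      rw [show (τ * Complex.I * t : ℂ) = ((τ * t : ℝ) : ℂ) * Complex.I by push_cast; ring]
      exact Complex.norm_exp_ofReal_mul_I _
    rw [norm_mul, this, one_mul, ← div_eq_mul_inv, ← sq_norm_vline]
    exact hF τ
  · exact (integral_inv_sq_add_sq hσ).1.const_mul M
  · exact Eventually.of_forall fun τ => by fun_prop

lemma continuous_comp_vline {F : ℂ → ℂ} {σ₀ σ : ℝ}
    (hd : DifferentiableOn ℂ F (halfPlane σ₀)) (h : σ₀ < σ) :
    Continuous fun τ => F (vline σ τ) :=
  hd.continuousOn.comp_continuous (continuous_vline σ) fun τ => by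
    simpa [halfPlane] using h

/-- The inverse Laplace transform does not depend on the abscissa. -/
lemma invLaplace_eq_invLaplace {F : ℂ → ℂ} {σ₀ σ₁ σ₂ M : ℝ} (hσ₀ : 0 ≤ σ₀)
    (hd : DifferentiableOn ℂ F (halfPlane σ₀)) (hF : ∀ z ∈ halfPlane σ₀, ‖F z‖ ≤ M / ‖z‖ ^ 2)
    (h₁ : σ₀ < σ₁) (h₂ : σ₀ < σ₂) (t : ℝ) : invLaplace σ₁ F t = invLaplace σ₂ F t := by
  set f : ℂ → ℂ := fun z => Complex.exp (z * t) * F z with hf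
  have hfd : DifferentiableOn ℂ f (halfPlane σ₀) :=
    DifferentiableOn.mul (by fun_prop) hd
  have hmem : ∀ x ∈ uIcc σ₁ σ₂, σ₀ < x := fun x hx =>
    (lt_min h₁ h₂).trans_le hx.1
  have hvert : ∀ σ : ℝ, σ₀ < σ → Tendsto (fun R : ℝ => ∫ y in (-R)..R, f (σ + y * Complex.I))
      atTop (𝓝 (∫ y : ℝ, f (σ + y * Complex.I))) := fun σ hσ => by
    refine intervalIntegral_tendsto_integral ?_ tendsto_neg_atTop_atBot tendsto_id
    exact integrable_invLaplace (M := M) (hσ₀.trans_lt hσ)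
      (continuous_comp_vline hd hσ)
      (fun τ => hF _ (by simpa [halfPlane] using hσ)) t
  set K : ℝ := Real.exp (max (σ₁ * t) (σ₂ * t)) * M with hK
  -- The horizontal sides of the rectangle have fixed length and the integrand is at most K/R²
  -- there. The function g stands for R or -R, treating both sides at once.
  have hhor : ∀ g : ℝ → ℝ, (∀ R, |g R| = |R|) →
      Tendsto (fun R : ℝ => ∫ x in σ₁..σ₂, f (x + g R * Complex.I)) atTop (𝓝 0) := fun g hg => by
    rw [tendsto_zero_iff_norm_tendsto_zero]
    have hlim : Tendsto (fun R : ℝ => K / R ^ 2 * |σ₂ - σ₁|) atTop (𝓝 0) := by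
      have : Tendsto (fun R : ℝ => K / R ^ 2) atTop (𝓝 0) :=
        tendsto_const_nhds.div_atTop (tendsto_pow_atTop (by norm_num))
      simpa using this.mul_const |σ₂ - σ₁|
    refine squeeze_zero' (Eventually.of_forall fun R => norm_nonneg _) ?_ hlim
    filter_upwards [eventually_gt_atTop 0] with R hR
    refine intervalIntegral.norm_integral_le_of_norm_le_const fun x hx => ?_
    have hx' := uIoc_subset_uIcc hx
    have hz : (x + g R * Complex.I : ℂ) ∈ halfPlane σ₀ := by
      simpa [halfPlane] using hmem x hx'
    have hn : R ^ 2 ≤ ‖(x + g R * Complex.I : ℂ)‖ ^ 2 := by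
      have := sq_norm_vline x (g R)
      rw [vline] at this
      rw [this, ← sq_abs (g R), hg, sq_abs]
      linarith [sq_nonneg x]
    have hM : 0 ≤ M := by
      have h3 := (norm_nonneg _).trans (hF _ hz)
      have h4 : 0 < ‖(x + g R * Complex.I : ℂ)‖ ^ 2 := lt_of_lt_of_le (by positivity) hn
      exact (div_nonneg_iff.mp h3).elim (fun h => h.1) fun h => absurd h.2 (not_le.mpr h4)
    rw [hf]
    simp only [norm_mul]
    rw [hK, mul_div_assoc]
    gcongr
    · have h5 := norm_exp_vline_mul x (g R) t
      rw [vline] at h5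
      rw [h5, Real.exp_le_exp]
      rcases le_total 0 t with ht | ht
      · rcases le_total σ₁ σ₂ with h | h
        · rw [uIcc_of_le h] at hx'
          exact le_max_of_le_right (mul_le_mul_of_nonneg_right hx'.2 ht)
        · rw [uIcc_of_ge h] at hx'
          exact le_max_of_le_left (mul_le_mul_of_nonneg_right hx'.2 ht)
      · rcases le_total σ₁ σ₂ with h | h
        · rw [uIcc_of_le h] at hx'
          exact le_max_of_le_left (mul_le_mul_of_nonpos_right hx'.1 ht)
        · rw [uIcc_of_ge h] at hx'
          exact le_max_of_le_right (mul_le_mul_of_nonpos_right hx'.1 ht)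
    · refine (hF _ hz).trans ?_
      gcongr
  have hrect : ∀ R : ℝ, (∫ x in σ₁..σ₂, f (x + (-R : ℝ) * Complex.I))
      - (∫ x in σ₁..σ₂, f (x + R * Complex.I))
      + Complex.I * (∫ y in (-R)..R, f (σ₂ + y * Complex.I))
      - Complex.I * (∫ y in (-R)..R, f (σ₁ + y * Complex.I)) = 0 := fun R => by
    have := Complex.integral_boundary_rect_eq_zero_of_differentiableOn f (vline σ₁ (-R))
      (vline σ₂ R) (hfd.mono fun z hz => hmem z.re (by
        have := hz.1
        simpa using this))
    simpa using this
  have hlim := (((hhor (fun R => -R) fun R => abs_neg R).sub (hhor (fun R => R) fun R => rfl)).add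
    ((hvert σ₂ h₂).const_mul Complex.I)).sub ((hvert σ₁ h₁).const_mul Complex.I)
  simp only [hrect] at hlim
  have h0 := tendsto_nhds_unique hlim tendsto_const_nhds
  rw [sub_zero, zero_add, ← mul_sub] at h0
  have h1 := (mul_eq_zero.mp h0).resolve_left Complex.I_ne_zero
  have h2 := sub_eq_zero.mp h1
  simp only [invLaplace, vline]
  rw [show (∫ τ : ℝ, Complex.exp ((σ₁ + τ * Complex.I) * t) * F (σ₁ + τ * Complex.I))
    = ∫ τ : ℝ, Complex.exp ((σ₂ + τ * Complex.I) * t) * F (σ₂ + τ * Complex.I) from h2.symm]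

/-- Causality: exponential decay of the transform as `Re z → ∞`. -/
lemma invLaplace_eq_zero {F : ℂ → ℂ} {σ₀ σ M T : ℝ} (hσ₀ : 0 ≤ σ₀)
    (hd : DifferentiableOn ℂ F (halfPlane σ₀)) (hM : 0 ≤ M)
    (hF : ∀ z ∈ halfPlane σ₀, ‖F z‖ ≤ M * Real.exp (-T * z.re) / ‖z‖ ^ 2)
    (h : σ₀ < σ) {t : ℝ} (ht : t ≤ T) : invLaplace σ F t = 0 := by
  set G : ℂ → ℂ := fun z => Complex.exp (T * z) * F z with hG
  have hGn : ∀ z ∈ halfPlane σ₀, ‖G z‖ ≤ M / ‖z‖ ^ 2 := fun z hz => by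
    rw [hG]
    simp only [norm_mul, Complex.norm_exp, Complex.re_ofReal_mul]
    have := mul_le_mul_of_nonneg_left (hF z hz) (Real.exp_pos (T * z.re)).le
    refine this.trans_eq ?_
    rw [← mul_div_assoc, mul_comm M, ← mul_assoc, ← Real.exp_add]
    simp
  have hGd : DifferentiableOn ℂ G (halfPlane σ₀) := DifferentiableOn.mul (by fun_prop) hd
  have e : ∀ σ' : ℝ, invLaplace σ' F t = invLaplace σ' G (t - T) := fun σ' => by
    simp only [invLaplace, hG]
    congr 2
    funext τ
    rw [← mul_assoc, ← Complex.exp_add]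
    push_cast
    ring_nf
  -- After the shift by T the time t - T is nonpositive, so the exponential is at most 1 and the
  -- bound is M/σ'. The abscissa σ' is arbitrary and can go to infinity.
  have hle : ∀ σ' : ℝ, σ₀ < σ' → ‖invLaplace σ F t‖ ≤ M / σ' := fun σ' hσ' => by
    rw [e, invLaplace_eq_invLaplace hσ₀ hGd hGn h hσ' (t - T)]
    have h1 : 0 < σ' := hσ₀.trans_lt hσ'
    refine (norm_invLaplace_le h1 (fun τ => hGn _ (by simpa [halfPlane] using hσ')) _).trans ?_
    gcongr
    refine mul_le_of_le_one_left hM ?_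
    rw [Real.exp_le_one_iff]
    exact mul_nonpos_of_nonneg_of_nonpos h1.le (by linarith)
  have hlim : Tendsto (fun σ' : ℝ => M / σ') atTop (𝓝 0) :=
    tendsto_const_nhds.div_atTop tendsto_id
  have := ge_of_tendsto hlim (by
    filter_upwards [eventually_gt_atTop σ₀] with σ' hσ' using hle σ' hσ')
  exact norm_le_zero_iff.mp this

/-- Inversion: `invLaplace` is a right inverse of the Laplace transform. -/
lemma laplace_invLaplace {F : ℂ → ℂ} {σ₀ σ M : ℝ} (hσ₀ : 0 ≤ σ₀)
    (hd : DifferentiableOn ℂ F (halfPlane σ₀)) (hM : 0 ≤ M)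
    (hF : ∀ z ∈ halfPlane σ₀, ‖F z‖ ≤ M / ‖z‖ ^ 2)
    (h : σ₀ < σ) {z : ℂ} (hz : σ₀ < z.re) : laplace (invLaplace σ F) z = F z := by
  have hneg : ∀ t ≤ 0, invLaplace σ F t = 0 := fun t ht =>
    invLaplace_eq_zero hσ₀ hd hM (T := 0) (fun z hz => by simpa using hF z hz) h ht
  set x := z.re with hx
  have hx0 : 0 < x := hσ₀.trans_lt hz
  have hline : ∀ σ' : ℝ, σ₀ < σ' → ∀ τ, ‖F (vline σ' τ)‖ ≤ M / ‖vline σ' τ‖ ^ 2 :=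
    fun σ' hσ' τ => hF _ (by simpa [halfPlane] using hσ')
  set f : ℝ → ℂ := fun τ => F (vline x τ) with hf
  have hfc : Continuous f := continuous_comp_vline hd hz
  have hfi : Integrable f := by
    have := integrable_invLaplace hx0 hfc (hline x hz) 0
    simpa using this
  set g : ℝ → ℂ := fun t => Complex.exp (-(x * t : ℝ)) * invLaplace σ F t with hg
  -- On the line Re z = x the damped function e^{-xt} f(t) is, up to scaling by 2π, the inverse
  -- Fourier transform of τ ↦ F(x + iτ). The claim becomes Fourier inversion.
  have hgf : ∀ u : ℝ, 𝓕⁻ f u = (2 * Real.pi : ℂ) * g (2 * Real.pi * u) := fun u => by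
    rw [Real.fourierInv_eq']
    simp only [hg]
    rw [invLaplace_eq_invLaplace hσ₀ hd hF h hz, invLaplace, ← mul_assoc, mul_comm (2 * Real.pi : ℂ),
      mul_assoc, ← mul_assoc (2 * Real.pi : ℂ),
      mul_inv_cancel₀ (by simp [Real.pi_ne_zero]), one_mul, ← integral_const_mul]
    congr 1
    funext v
    rw [smul_eq_mul, ← mul_assoc, ← Complex.exp_add, hf]
    simp only [vline, RCLike.inner_apply, conj_trivial]
    congr 2
    push_cast
    ring
  have hgi : Integrable g := by
    -- Moving the contour slightly to the left, to the midpoint x' of σ₀ and x, gives growth e^{x't}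
    -- only, so g decays like e^{-(x - x')t} for t > 0; it vanishes for t ≤ 0.
    set x' := (σ₀ + x) / 2 with hx'
    have h1 : σ₀ < x' := by rw [hx']; linarith
    have h2 : x' < x := by rw [hx']; linarith
    have h3 : 0 < x' := hσ₀.trans_lt h1
    have hgn : ∀ t, ‖g t‖ ≤ (Ioi (0 : ℝ)).indicator
        (fun t => M / x' * Real.exp (-(x - x') * t)) t := fun t => by
      rcases le_or_gt t 0 with ht | ht
      · rw [indicator_of_notMem (by simpa using ht), hg]
        simp [hneg t ht]
      · rw [indicator_of_mem (by simpa using ht), hg]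
        simp only [norm_mul]
        rw [invLaplace_eq_invLaplace hσ₀ hd hF h h1, Complex.norm_exp]
        have := mul_le_mul_of_nonneg_left (norm_invLaplace_le h3 (hline x' h1) t)
          (Real.exp_pos (-(x * t))).le
        simp only [← Complex.ofReal_neg, Complex.ofReal_re]
        refine this.trans_eq ?_
        rw [mul_div_assoc, ← mul_assoc, ← Real.exp_add, mul_comm]
        congr 2
        ring
    refine Integrable.mono' (IntegrableOn.integrable_indicator ?_ measurableSet_Ioi) ?_
      (Eventually.of_forall hgn)
    · exact (exp_neg_integrableOn_Ioi 0 (by linarith)).const_mul _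
    · have := continuous_invLaplace (hσ₀.trans_lt h) (continuous_comp_vline hd h)
        (hline σ h)
      exact Continuous.aestronglyMeasurable (by fun_prop)
  have hFi : Integrable (𝓕⁻ f) := by
    rw [show 𝓕⁻ f = fun u => (2 * Real.pi : ℂ) * g (2 * Real.pi * u) from funext hgf]
    exact (hgi.comp_mul_left' (by positivity)).const_mul _
  have hinv : 𝓕 (𝓕⁻ f) z.im = f z.im := by
    refine hfi.fourier_fourierInv_eq ?_ hfc.continuousAt
    have := hFi.comp_neg
    refine this.congr (Eventually.of_forall fun v => ?_)
    simp only [Real.fourierInv_eq_fourier_neg, neg_neg]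
  have hz' : f z.im = F z := by
    rw [hf]; simp only [vline, hx, Complex.re_add_im]
  rw [← hz', ← hinv, Real.fourier_eq']
  have e1 : ∀ v : ℝ, Complex.exp (↑(-2 * Real.pi * inner ℝ v z.im) * Complex.I) • 𝓕⁻ f v
      = (2 * Real.pi : ℂ) * (fun t : ℝ => Complex.exp (-z * t) * invLaplace σ F t)
        (2 * Real.pi * v) := fun v => by
    rw [hgf, smul_eq_mul]
    simp only [hg, RCLike.inner_apply, conj_trivial]
    rw [mul_left_comm, ← mul_assoc (Complex.exp _), ← Complex.exp_add]
    congr 3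
    conv_rhs => rw [← Complex.re_add_im z]
    push_cast
    ring
  simp only [e1]
  rw [integral_const_mul, Measure.integral_comp_mul_left
    (fun t : ℝ => Complex.exp (-z * t) * invLaplace σ F t), abs_of_pos (by positivity),
    Complex.real_smul, ← mul_assoc]
  push_cast
  rw [mul_inv_cancel₀ (by simp [Real.pi_ne_zero]), one_mul, laplace]
  refine setIntegral_eq_integral_of_forall_compl_eq_zero fun t ht => ?_
  rw [hneg t (by simpa using ht), mul_zero]

lemma vline_ne_zero {σ : ℝ} (hσ : 0 < σ) (τ : ℝ) : vline σ τ ≠ 0 := fun h => by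
  have := congrArg Complex.re h
  simp at this
  exact hσ.ne' this

lemma le_norm_vline {σ : ℝ} (τ : ℝ) : σ ≤ ‖vline σ τ‖ := by
  have := Complex.re_le_norm (vline σ τ)
  simpa using this

/-- Division by z is integration in time. The quadratic decay of G makes the integral differentiated
under the sign absolutely convergent, with a bound uniform for times below t + 1. -/
lemma hasDerivAt_invLaplace {G : ℂ → ℂ} {σ M : ℝ} (hσ : 0 < σ)
    (hc : Continuous fun τ => G (vline σ τ))
    (hG : ∀ τ, ‖G (vline σ τ)‖ ≤ M / ‖vline σ τ‖ ^ 2) (t : ℝ) :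
    HasDerivAt (invLaplace σ fun z => G z / z) (invLaplace σ G t) t := by
  have hcv := continuous_vline σ
  have hc' : Continuous fun τ => G (vline σ τ) / vline σ τ :=
    hc.div hcv fun τ => vline_ne_zero hσ τ
  have hM : 0 ≤ M := by
    have := (norm_nonneg _).trans (hG 0)
    have h3 : 0 < ‖vline σ 0‖ ^ 2 := by rw [sq_norm_vline]; positivity
    exact (div_nonneg_iff.mp this).elim (fun h => h.1) fun h => absurd h.2 (not_le.mpr h3)
  have hG' : ∀ τ, ‖G (vline σ τ) / vline σ τ‖ ≤ (M / σ) / ‖vline σ τ‖ ^ 2 := fun τ => by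
    rw [norm_div, div_right_comm]
    have : 0 < ‖vline σ τ‖ := norm_pos_iff.mpr (vline_ne_zero hσ τ)
    gcongr
    · exact hG τ
    · exact le_norm_vline τ
  refine HasDerivAt.const_mul _ ?_
  refine (hasDerivAt_integral_of_dominated_loc_of_deriv_le
    (F := fun (t : ℝ) τ => Complex.exp (vline σ τ * t) * (G (vline σ τ) / vline σ τ))
    (F' := fun (t : ℝ) τ => Complex.exp (vline σ τ * t) * G (vline σ τ))
    (bound := fun τ => Real.exp (σ * (t + 1)) * M * (σ ^ 2 + τ ^ 2)⁻¹)
    (Iio_mem_nhds (lt_add_one t)) ?_ ?_ ?_ ?_ ?_ ?_).2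
  · exact Eventually.of_forall fun t =>
      (integrable_invLaplace (F := fun z => G z / z) hσ hc' hG' t).aestronglyMeasurable
  · exact integrable_invLaplace (F := fun z => G z / z) hσ hc' hG' t
  · exact (integrable_invLaplace hσ hc hG t).aestronglyMeasurable
  · refine Eventually.of_forall fun τ s hs => (norm_le_of_bound hG s τ).trans ?_
    have hs' : s ≤ t + 1 := le_of_lt hs
    gcongr
  · exact (integral_inv_sq_add_sq hσ).1.const_mul _
  · refine Eventually.of_forall fun τ s _ => ?_
    have h1 : HasDerivAt (fun s : ℝ => vline σ τ * (s : ℂ)) (vline σ τ) s := by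
      simpa using (Complex.ofRealCLM.hasDerivAt (x := s)).const_mul (vline σ τ)
    have h2 := (h1.cexp).mul_const (G (vline σ τ) / vline σ τ)
    refine h2.congr_deriv ?_
    rw [mul_assoc, mul_div_cancel₀ _ (vline_ne_zero hσ τ)]

/-! ### Holomorphy and injectivity of the Laplace transform -/

lemma integrableOn_exp_mul {f : ℝ → ℂ} {σ : ℝ}
    (hf : IntegrableOn (fun t : ℝ => Complex.exp (-σ * t) * f t) (Ioi 0)) {z : ℂ}
    (hz : σ ≤ z.re) : IntegrableOn (fun t : ℝ => Complex.exp (-z * t) * f t) (Ioi 0) := by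
  have e : (fun t : ℝ => Complex.exp (-z * t) * f t)
      = fun t : ℝ => Complex.exp (-(z - σ) * t) * (Complex.exp (-σ * t) * f t) := by
    funext t
    rw [← mul_assoc, ← Complex.exp_add]
    ring_nf
  rw [e]
  refine Integrable.bdd_mul (c := 1) hf (Continuous.aestronglyMeasurable (by fun_prop)) ?_
  refine (ae_restrict_iff' measurableSet_Ioi).mpr (Eventually.of_forall fun t ht => ?_)
  rw [Complex.norm_exp, Real.exp_le_one_iff, Complex.re_mul_ofReal]
  refine mul_nonpos_of_nonpos_of_nonneg ?_ (le_of_lt ht)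
  simpa using hz

/-- Differentiation of the Laplace transform. -/
lemma hasDerivAt_laplace {f : ℝ → ℂ} {σ : ℝ}
    (hf : IntegrableOn (fun t : ℝ => Complex.exp (-σ * t) * f t) (Ioi 0)) {z : ℂ}
    (hz : σ < z.re) : HasDerivAt (laplace f) (laplace (fun t : ℝ => -(t : ℂ) * f t) z) z := by
  set ε := (z.re - σ) / 2 with hε
  have hε0 : 0 < ε := by rw [hε]; linarith
  have hnhds : {w : ℂ | σ + ε < w.re} ∈ 𝓝 z :=
    (isOpen_lt continuous_const Complex.continuous_re).mem_nhds (by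
      change σ + ε < z.re
      rw [hε]; linarith)
  have hint := integrableOn_exp_mul hf (z := z) hz.le
  refine (hasDerivAt_integral_of_dominated_loc_of_deriv_le
    (F := fun (w : ℂ) (t : ℝ) => Complex.exp (-w * t) * f t)
    (F' := fun (w : ℂ) (t : ℝ) => Complex.exp (-w * t) * (-(t : ℂ) * f t))
    (bound := fun t : ℝ => ε⁻¹ * ‖Complex.exp (-σ * t) * f t‖) hnhds ?_ ?_ ?_ ?_ ?_ ?_).2
  · filter_upwards [hnhds] with w hw
    have hw' : σ + ε < w.re := hw
    exact (integrableOn_exp_mul hf (by linarith)).aestronglyMeasurable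
  · exact hint
  · have e : (fun t : ℝ => Complex.exp (-z * t) * (-(t : ℂ) * f t))
        = fun t : ℝ => (-(t : ℂ)) * (Complex.exp (-z * t) * f t) := by
      funext t; ring
    rw [e]
    refine AEStronglyMeasurable.mul ?_ hint.aestronglyMeasurable
    exact (by fun_prop : Continuous fun t : ℝ => -(t : ℂ)).aestronglyMeasurable
  · refine (ae_restrict_iff' measurableSet_Ioi).mpr (Eventually.of_forall fun t ht w hw => ?_)
    have ht0 : 0 < t := ht
    have hw' : σ + ε < w.re := hw
    rw [norm_mul, norm_mul, norm_mul, ← mul_assoc, ← mul_assoc]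
    refine mul_le_mul_of_nonneg_right ?_ (norm_nonneg _)
    rw [norm_neg, Complex.norm_real, Real.norm_of_nonneg ht0.le, Complex.norm_exp,
      Complex.norm_exp, Complex.re_mul_ofReal, Complex.re_mul_ofReal, Complex.neg_re,
      Complex.neg_re, Complex.ofReal_re]
    -- The factor t produced by differentiation is absorbed by half of the gap between Re z and σ.
    have h1 : ε * t ≤ Real.exp (ε * t) := by linarith [Real.add_one_le_exp (ε * t)]
    have h2 : Real.exp (-w.re * t) ≤ Real.exp (-(σ + ε) * t) := by
      rw [Real.exp_le_exp]; gcongr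
    calc Real.exp (-w.re * t) * t ≤ Real.exp (-(σ + ε) * t) * (ε⁻¹ * Real.exp (ε * t)) := by
          gcongr
          rwa [← div_eq_inv_mul, le_div_iff₀ hε0, mul_comm]
      _ = ε⁻¹ * Real.exp (-σ * t) := by
          rw [mul_left_comm, ← Real.exp_add]; ring_nf
  · exact hf.norm.const_mul _
  · refine Eventually.of_forall fun t w _ => ?_
    have h1 : HasDerivAt (fun w : ℂ => -w * (t : ℂ)) (-(t : ℂ)) w := by
      simpa using ((hasDerivAt_id w).neg.mul_const (t : ℂ))
    have h2 := (h1.cexp).mul_const (f t)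
    exact h2.congr_deriv (by ring)

lemma differentiableOn_laplace {f : ℝ → ℂ} {σ : ℝ}
    (hf : IntegrableOn (fun t : ℝ => Complex.exp (-σ * t) * f t) (Ioi 0)) :
    DifferentiableOn ℂ (laplace f) (halfPlane σ) := fun _ hz =>
  (hasDerivAt_laplace hf hz).differentiableAt.differentiableWithinAt

/-- An integrable function with vanishing Fourier transform vanishes. -/
lemma ae_eq_zero_of_fourier_eq_zero {g : ℝ → ℂ} (hg : Integrable g) (h : ∀ w, 𝓕 g w = 0) :
    ∀ᵐ t, g t = 0 := by
  refine ae_eq_zero_of_integral_contDiff_smul_eq_zero hg.locallyIntegrable fun φ hφ hφc => ?_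
  have h1 : HasCompactSupport fun t => (φ t : ℂ) := hφc.comp_left (g := fun x : ℝ => (x : ℂ)) (by simp)
  have h2 : ContDiff ℝ ∞ fun t => (φ t : ℂ) := Complex.ofRealCLM.contDiff.comp hφ
  set Φ : SchwartzMap ℝ ℂ := h1.toSchwartzMap h2 with hΦ
  -- Every test function is the Fourier transform of a Schwartz function ψ, so its pairing with g
  -- equals the pairing of ψ with the transform of g.
  set ψ : SchwartzMap ℝ ℂ := 𝓕⁻ Φ with hψ
  have h3 : 𝓕 ψ = Φ := FourierTransform.fourier_fourierInv_eq Φ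
  have h4 := VectorFourier.integral_fourierIntegral_smul_eq_flip (μ := volume) (ν := volume)
    (L := innerₗ ℝ) (e := Real.fourierChar) (f := g) (g := ψ)
    Real.continuous_fourierChar (by exact continuous_inner) hg ψ.integrable
  have h5 : ∀ x, VectorFourier.fourierIntegral Real.fourierChar volume (innerₗ ℝ).flip ψ x
      = (φ x : ℂ) := fun x => by
    have h6 := congrArg (fun F : SchwartzMap ℝ ℂ => F x) h3
    simp only [SchwartzMap.fourier_coe] at h6
    rw [flip_innerₗ]
    exact h6
  have h7 : ∀ x, VectorFourier.fourierIntegral Real.fourierChar volume (innerₗ ℝ) g x = 0 := h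
  simp only [h5, h7, zero_smul, integral_zero] at h4
  rw [h4]
  congr 1
  funext x
  rw [Complex.real_smul, smul_eq_mul, mul_comm]

/-- Injectivity of the Laplace transform. -/
lemma ae_eq_zero_of_laplace_eq_zero {f : ℝ → ℂ} {σ : ℝ}
    (hf : IntegrableOn (fun t : ℝ => Complex.exp (-σ * t) * f t) (Ioi 0))
    (h : ∀ τ, laplace f (vline σ τ) = 0) : ∀ᵐ t ∂(volume.restrict (Ioi (0 : ℝ))), f t = 0 := by
  set g : ℝ → ℂ := (Ioi (0 : ℝ)).indicator fun t : ℝ => Complex.exp (-σ * t) * f t with hg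
  have hgi : Integrable g := hf.integrable_indicator measurableSet_Ioi
  have h1 : ∀ w, 𝓕 g w = 0 := fun w => by
    rw [← h (2 * Real.pi * w), Real.fourier_eq', laplace, ← integral_indicator measurableSet_Ioi]
    congr 1
    funext t
    by_cases ht : t ∈ Ioi (0 : ℝ)
    · rw [indicator_of_mem ht, hg, indicator_of_mem ht, smul_eq_mul, ← mul_assoc,
        ← Complex.exp_add]
      simp only [vline, RCLike.inner_apply, conj_trivial]
      congr 2
      push_cast
      ring
    · rw [indicator_of_notMem ht, hg, indicator_of_notMem ht, smul_zero]
  have h2 := ae_eq_zero_of_fourier_eq_zero hgi h1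
  refine (ae_restrict_iff' measurableSet_Ioi).mpr (h2.mono fun t ht hmem => ?_)
  rw [hg, indicator_of_mem hmem] at ht
  exact (mul_eq_zero.mp ht).resolve_left (Complex.exp_ne_zero _)

lemma ae_eq_of_laplace_eq {f g : ℝ → ℂ} {σ : ℝ}
    (hf : IntegrableOn (fun t : ℝ => Complex.exp (-σ * t) * f t) (Ioi 0))
    (hg : IntegrableOn (fun t : ℝ => Complex.exp (-σ * t) * g t) (Ioi 0))
    (h : ∀ τ, laplace f (vline σ τ) = laplace g (vline σ τ)) :
    ∀ᵐ t ∂(volume.restrict (Ioi (0 : ℝ))), f t = g t := by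
  have h1 := ae_eq_zero_of_laplace_eq_zero (f := fun t => f t - g t) (σ := σ)
    ((hf.sub hg).congr (Eventually.of_forall fun t => by simp only [Pi.sub_apply]; ring))
    (fun τ => by
      have h2 : laplace (fun t => f t - g t) (vline σ τ)
          = laplace f (vline σ τ) - laplace g (vline σ τ) := by
        rw [laplace, laplace, laplace, ← integral_sub (integrableOn_exp_mul hf (by simp))
          (integrableOn_exp_mul hg (by simp))]
        congr 1; funext t; ring
      rw [h2, h, sub_self])
  exact h1.mono fun t ht => sub_eq_zero.mp ht

lemma integrableOn_exp_mul_of_norm_le {f : ℝ → ℂ} {σ ρ C : ℝ} (hρ : ρ < σ)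
    (hm : AEStronglyMeasurable f (volume.restrict (Ioi 0)))
    (hf : ∀ t, 0 < t → ‖f t‖ ≤ C * Real.exp (ρ * t)) :
    IntegrableOn (fun t : ℝ => Complex.exp (-σ * t) * f t) (Ioi 0) := by
  have h1 : IntegrableOn (fun t : ℝ => C * Real.exp (-(σ - ρ) * t)) (Ioi 0) :=
    (exp_neg_integrableOn_Ioi 0 (by linarith)).const_mul C
  refine Integrable.mono' h1 ?_ ?_
  · exact (Continuous.aestronglyMeasurable (by fun_prop)).mul hm
  · refine (ae_restrict_iff' measurableSet_Ioi).mpr (Eventually.of_forall fun t ht => ?_)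
    have := mul_le_mul_of_nonneg_left (hf t ht) (Real.exp_pos (-σ * t)).le
    rw [norm_mul, Complex.norm_exp, Complex.re_mul_ofReal, Complex.neg_re, Complex.ofReal_re]
    refine this.trans_eq ?_
    rw [mul_left_comm, ← Real.exp_add]
    ring_nf

lemma laplace_one {z : ℂ} (hz : 0 < z.re) : laplace (fun _ => 1) z = 1 / z := by
  have h1 : (-z).re < 0 := by simpa using hz
  have := integral_exp_mul_complex_Ioi h1 0
  simp only [laplace, mul_one]
  rw [this]
  simp

lemma laplace_id {z : ℂ} (hz : 0 < z.re) : laplace (fun t => (t : ℂ)) z = 1 / z ^ 2 := by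
  have h0 : z ≠ 0 := fun h => by rw [h] at hz; simp at hz
  have hi : IntegrableOn (fun t : ℝ => Complex.exp (-((z.re / 2 : ℝ) : ℂ) * t) * 1) (Ioi 0) :=
    integrableOn_exp_mul_of_norm_le (f := fun _ => 1) (ρ := 0) (C := 1) (by linarith)
      aestronglyMeasurable_const (by simp)
  have h1 := hasDerivAt_laplace (f := fun _ => 1) hi (z := z) (by linarith)
  have h2 : HasDerivAt (laplace fun _ => 1) (-(1 / z ^ 2)) z := by
    have h3 : (fun w : ℂ => w⁻¹) =ᶠ[𝓝 z] laplace fun _ => 1 := by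
      filter_upwards [(isOpen_halfPlane 0).mem_nhds hz] with w hw
      rw [laplace_one hw, one_div]
    refine (HasDerivAt.congr_of_eventuallyEq ?_ h3.symm)
    simpa using hasDerivAt_inv h0
  have h4 := h1.unique h2
  have h5 : laplace (fun t => -(t : ℂ) * 1) z = - laplace (fun t => (t : ℂ)) z := by
    rw [laplace, laplace, ← integral_neg]
    congr 1; funext t; ring
  rw [h5] at h4
  exact neg_injective h4

/-- Both sides have transform 1/z², so they agree by injectivity and continuity. This evaluates the
leading term a/z² of a symbol divided by z². -/
lemma invLaplace_inv_sq {σ : ℝ} (hσ : 0 < σ) {t : ℝ} (ht : 0 ≤ t) :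
    invLaplace σ (fun z => 1 / z ^ 2) t = t := by
  have hd : DifferentiableOn ℂ (fun z : ℂ => 1 / z ^ 2) (halfPlane 0) := by
    refine DifferentiableOn.div (by fun_prop) (by fun_prop) fun z hz => ?_
    refine pow_ne_zero 2 fun h => ?_
    rw [h] at hz
    simp [halfPlane] at hz
  have hb : ∀ z ∈ halfPlane 0, ‖1 / z ^ 2‖ ≤ 1 / ‖z‖ ^ 2 := fun z _ => by simp
  have hline : ∀ τ, ‖1 / (vline σ τ) ^ 2‖ ≤ 1 / ‖vline σ τ‖ ^ 2 :=
    fun τ => hb _ (by simpa [halfPlane] using hσ)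
  have hc := continuous_invLaplace hσ (F := fun z => 1 / z ^ 2)
    (continuous_comp_vline hd hσ) hline
  have hae := ae_eq_of_laplace_eq (f := invLaplace σ fun z => 1 / z ^ 2) (g := fun t => (t : ℂ))
    (σ := σ + 1)
    (integrableOn_exp_mul_of_norm_le (ρ := σ) (C := 1 / σ) (by linarith)
      hc.aestronglyMeasurable fun t _ => by
        have := norm_invLaplace_le hσ (F := fun z => 1 / z ^ 2) hline t
        refine this.trans_eq ?_
        ring)
    (integrableOn_exp_mul_of_norm_le (ρ := σ) (C := 1 / σ) (by linarith)
      (Complex.continuous_ofReal.aestronglyMeasurable) fun t ht => by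
        rw [Complex.norm_real, Real.norm_of_nonneg ht.le, div_mul_eq_mul_div, one_mul,
          le_div_iff₀ hσ]
        linarith [Real.add_one_le_exp (σ * t)])
    (fun τ => by
      rw [laplace_invLaplace le_rfl hd zero_le_one hb hσ (by simp; linarith),
        laplace_id (by simp; linarith)])
  have heq : EqOn (invLaplace σ fun z => 1 / z ^ 2) (fun t : ℝ => (t : ℂ)) (Ioi 0) :=
    Measure.eqOn_open_of_ae_eq hae isOpen_Ioi hc.continuousOn
      Complex.continuous_ofReal.continuousOn
  have hcl := heq.closure hc Complex.continuous_ofReal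
  rw [closure_Ioi] at hcl
  exact hcl ht

/-! ### Symbols: expansions in powers of 1/z -/

/-- `F` has an expansion `a₀ + a₁/z + ⋯ + aₙ₋₁/zⁿ⁻¹ + O(z⁻ⁿ)` in `Re z > 1`, all of whose
coefficients and remainders are bounded by `M`. -/
def IsSymbol : ℕ → ℝ → (ℂ → ℂ) → Prop
  | 0, M, F => ∀ z ∈ halfPlane 1, ‖F z‖ ≤ M
  | n + 1, M, F => (∀ z ∈ halfPlane 1, ‖F z‖ ≤ M) ∧ ∃ (a : ℂ) (F₁ : ℂ → ℂ), ‖a‖ ≤ M ∧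
      IsSymbol n M F₁ ∧ ∀ z ∈ halfPlane 1, F z = a + F₁ z / z

lemma one_lt_norm_of_mem {z : ℂ} (hz : z ∈ halfPlane 1) : 1 < ‖z‖ :=
  lt_of_lt_of_le hz (Complex.re_le_norm z)

lemma ne_zero_of_mem_halfPlane {z : ℂ} (hz : z ∈ halfPlane 1) : z ≠ 0 :=
  norm_pos_iff.mp (zero_lt_one.trans (one_lt_norm_of_mem hz))

namespace IsSymbol

lemma norm_le : ∀ {n : ℕ} {M : ℝ} {F : ℂ → ℂ}, IsSymbol n M F → ∀ z ∈ halfPlane 1, ‖F z‖ ≤ M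
  | 0, _, _, h => h
  | _ + 1, _, _, h => h.1

lemma nonneg {n : ℕ} {M : ℝ} {F : ℂ → ℂ} (h : IsSymbol n M F) : 0 ≤ M :=
  (norm_nonneg _).trans (h.norm_le 2 (by simp [halfPlane]))

lemma mono {n : ℕ} {M M' : ℝ} {F : ℂ → ℂ} (h : IsSymbol n M F) (hM : M ≤ M') :
    IsSymbol n M' F := by
  induction n generalizing F with
  | zero => exact fun z hz => (h z hz).trans hM
  | succ n ih =>
    obtain ⟨h0, a, F₁, ha, h1, h2⟩ := h
    exact ⟨fun z hz => (h0 z hz).trans hM, a, F₁, ha.trans hM, ih h1, h2⟩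

lemma of_succ {n : ℕ} {M : ℝ} {F : ℂ → ℂ} (h : IsSymbol (n + 1) M F) : IsSymbol n M F := by
  induction n generalizing F with
  | zero => exact h.1
  | succ n ih =>
    obtain ⟨h0, a, F₁, ha, h1, h2⟩ := h
    exact ⟨h0, a, F₁, ha, ih h1, h2⟩

lemma congr {n : ℕ} {M : ℝ} {F G : ℂ → ℂ} (h : IsSymbol n M F)
    (hFG : ∀ z ∈ halfPlane 1, G z = F z) : IsSymbol n M G := by
  cases n with
  | zero => exact fun z hz => (hFG z hz) ▸ h z hz
  | succ n =>
    obtain ⟨h0, a, F₁, ha, h1, h2⟩ := h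
    exact ⟨fun z hz => (hFG z hz) ▸ h0 z hz, a, F₁, ha, h1,
      fun z hz => (hFG z hz).trans (h2 z hz)⟩

lemma const (n : ℕ) {M : ℝ} {c : ℂ} (hc : ‖c‖ ≤ M) : IsSymbol n M fun _ => c := by
  induction n generalizing c with
  | zero => exact fun z _ => hc
  | succ n ih =>
    exact ⟨fun z _ => hc, c, fun _ => 0, hc, ih (by simpa using (norm_nonneg c).trans hc),
      fun z _ => by simp⟩

lemma add_div {n : ℕ} {M M' : ℝ} {F : ℂ → ℂ} {a : ℂ} (ha : ‖a‖ ≤ M') (h : IsSymbol n M F) :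
    IsSymbol (n + 1) (M' + M) fun z => a + F z / z := by
  have hM' : 0 ≤ M' := (norm_nonneg a).trans ha
  refine ⟨fun z hz => (norm_add_le _ _).trans (add_le_add ha ?_), a, F,
    ha.trans (by linarith [h.nonneg]), h.mono (by linarith), fun z _ => rfl⟩
  rw [norm_div]
  exact (div_le_self (norm_nonneg _) (one_lt_norm_of_mem hz).le).trans (h.norm_le z hz)

lemma div_self {n : ℕ} {M : ℝ} {F : ℂ → ℂ} (h : IsSymbol n M F) :
    IsSymbol (n + 1) M fun z => F z / z := by
  have := add_div (a := 0) (M' := 0) (by simp) h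
  simpa using this

lemma add {n : ℕ} {M M' : ℝ} {F G : ℂ → ℂ} (hF : IsSymbol n M F) (hG : IsSymbol n M' G) :
    IsSymbol n (M + M') fun z => F z + G z := by
  induction n generalizing F G with
  | zero => exact fun z hz => (norm_add_le _ _).trans (add_le_add (hF z hz) (hG z hz))
  | succ n ih =>
    obtain ⟨h0, a, F₁, ha, h1, h2⟩ := hF
    obtain ⟨k0, b, G₁, hb, k1, k2⟩ := hG
    refine ⟨fun z hz => (norm_add_le _ _).trans (add_le_add (h0 z hz) (k0 z hz)), a + b,
      fun z => F₁ z + G₁ z, (norm_add_le _ _).trans (add_le_add ha hb), ih h1 k1, fun z hz => ?_⟩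
    simp only [h2 z hz, k2 z hz, _root_.add_div]
    ring

/-- Writing F = a + F₁/z, the product is aG + (F₁G)/z: the expansion of G is used in the first term
and the induction hypothesis in the second. The constant at most doubles at each order. -/
lemma mul {n : ℕ} {M M' : ℝ} {F G : ℂ → ℂ} (hF : IsSymbol n M F) (hG : IsSymbol n M' G) :
    IsSymbol n (2 ^ n * (M * M')) fun z => F z * G z := by
  have hM := hF.nonneg
  have hM' := hG.nonneg
  induction n generalizing F G with
  | zero =>
    intro z hz
    rw [norm_mul, pow_zero, one_mul]
    exact mul_le_mul (hF z hz) (hG z hz) (norm_nonneg _) hM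
  | succ n ih =>
    have hb' : ∀ z ∈ halfPlane 1, ‖F z * G z‖ ≤ 2 ^ (n + 1) * (M * M') := fun z hz => by
      rw [norm_mul]
      refine (mul_le_mul (hF.norm_le z hz) (hG.norm_le z hz) (norm_nonneg _) hM).trans ?_
      exact le_mul_of_one_le_left (mul_nonneg hM hM') (one_le_pow₀ one_le_two)
    obtain ⟨h0, a, F₁, ha, h1, h2⟩ := hF
    have hG' := hG.of_succ
    obtain ⟨k0, b, G₁, hb, k1, k2⟩ := hG
    -- Multiplication by a constant is treated separately so that it does not cost the factor 2ⁿ.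
    have ha1 : IsSymbol n (M * M') fun z => a * G₁ z := by
      clear ih hb' k0 k2 hb hG'
      induction n generalizing G₁ with
      | zero =>
        intro z hz
        rw [norm_mul]
        exact mul_le_mul ha (k1 z hz) (norm_nonneg _) hM
      | succ n ih' =>
        obtain ⟨l0, c, G₂, hc, l1, l2⟩ := k1
        refine ⟨fun z hz => ?_, a * c, fun z => a * G₂ z, ?_, ih' h1.of_succ G₂ l1, fun z hz => ?_⟩
        · rw [norm_mul]
          exact mul_le_mul ha (l0 z hz) (norm_nonneg _) hM
        · rw [norm_mul]
          exact mul_le_mul ha hc (norm_nonneg _) hM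
        · simp only [l2 z hz]; ring
    refine ⟨hb', a * b, fun z => a * G₁ z + F₁ z * G z, ?_, ?_, fun z hz => ?_⟩
    · rw [norm_mul]
      refine (mul_le_mul ha hb (norm_nonneg _) hM).trans ?_
      exact le_mul_of_one_le_left (mul_nonneg hM hM') (one_le_pow₀ one_le_two)
    · refine (ha1.add (ih h1 hG')).mono ?_
      have : M * M' ≤ 2 ^ n * (M * M') :=
        le_mul_of_one_le_left (mul_nonneg hM hM') (one_le_pow₀ one_le_two)
      rw [pow_succ]
      linarith
    · have hz0 := ne_zero_of_mem_halfPlane hz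
      have e : F z * G z = a * G z + F₁ z / z * G z := by rw [← add_mul, ← h2 z hz]
      simp only [e]
      rw [_root_.add_div, ← add_assoc, show a * b + a * G₁ z / z = a * G z by rw [k2 z hz]; ring]
      ring

/-- From F = a + F₁/z follows 1/F = 1/a - a⁻¹F₁F⁻¹/z, whose remainder is a product of shorter
expansions. The dependence on M is kept polynomial, so that families with polynomial growth in the
frequency stay such. -/
lemma inv (n : ℕ) : ∃ (C : ℝ) (e : ℕ), 1 ≤ C ∧ ∀ (F : ℂ → ℂ) (M : ℝ), 1 ≤ M → IsSymbol n M F →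
    (∀ z ∈ halfPlane 1, F z ≠ 0) → (∀ z ∈ halfPlane 1, ‖(F z)⁻¹‖ ≤ M) →
      IsSymbol n (C * M ^ e) fun z => (F z)⁻¹ := by
  induction n with
  | zero => exact ⟨1, 1, le_rfl, fun F M _ _ _ h z hz => by simpa using h z hz⟩
  | succ n ih =>
    obtain ⟨C, e, hC, H⟩ := ih
    refine ⟨2 ^ n * 2 ^ n * C, e + 2, ?_, fun F M hM hF h0 hi => ?_⟩
    · have : (1 : ℝ) ≤ 2 ^ n := one_le_pow₀ one_le_two
      nlinarith
    have hI := H F M hM hF.of_succ h0 hi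
    obtain ⟨-, a, F₁, ha, h1, h2⟩ := hF
    have h2n : (1 : ℝ) ≤ 2 ^ n := one_le_pow₀ one_le_two
    have hM0 : 0 ≤ M := by linarith
    have hbig : M ≤ 2 ^ n * 2 ^ n * C * M ^ (e + 2) := by
      have a1 : M * 1 ≤ M * M ^ (e + 1) := by gcongr; exact one_le_pow₀ hM
      have a2 : 1 * (M * M ^ (e + 1)) ≤ 2 ^ n * 2 ^ n * C * (M * M ^ (e + 1)) := by
        gcongr
        nlinarith
      calc M ≤ 2 ^ n * 2 ^ n * C * (M * M ^ (e + 1)) := by linarith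
        _ = _ := by ring
    -- The leading coefficient is the limit of F along the real axis; the bound on 1/F thus passes
    -- to 1/a.
    have hlim : Tendsto (fun x : ℝ => F x) atTop (𝓝 a) := by
      have h3 : Tendsto (fun x : ℝ => F₁ x / x) atTop (𝓝 0) := by
        rw [tendsto_zero_iff_norm_tendsto_zero]
        refine squeeze_zero' (Eventually.of_forall fun _ => norm_nonneg _) ?_
          (tendsto_const_nhds (x := M).div_atTop tendsto_id)
        filter_upwards [eventually_gt_atTop 1] with x hx
        have hx0 : 0 < x := by linarith
        rw [norm_div, Complex.norm_real, Real.norm_of_nonneg hx0.le]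
        exact div_le_div_of_nonneg_right (h1.norm_le _ (by simpa [halfPlane] using hx)) hx0.le
      have h4 : Tendsto (fun x : ℝ => a + F₁ x / x) atTop (𝓝 (a + 0)) :=
        tendsto_const_nhds.add h3
      rw [add_zero] at h4
      refine h4.congr' ?_
      filter_upwards [eventually_gt_atTop 1] with x hx
      rw [h2 _ (by simpa [halfPlane] using hx)]
    have ha1 : 1 ≤ M * ‖a‖ := by
      refine ge_of_tendsto (hlim.norm.const_mul M) ?_
      filter_upwards [eventually_gt_atTop 1] with x hx
      have hx' : (x : ℂ) ∈ halfPlane 1 := by simpa [halfPlane] using hx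
      have h5 := hi _ hx'
      rw [norm_inv] at h5
      have h6 : 0 < ‖F x‖ := norm_pos_iff.mpr (h0 _ hx')
      rwa [inv_le_iff_one_le_mul₀ h6] at h5
    have ha0 : a ≠ 0 := fun h => by rw [h, norm_zero] at ha1; linarith
    have hai : ‖-a⁻¹‖ ≤ M := by
      rw [norm_neg, norm_inv, inv_le_iff_one_le_mul₀ (norm_pos_iff.mpr ha0)]
      exact ha1
    refine ⟨fun z hz => (hi z hz).trans hbig, a⁻¹, fun z => -a⁻¹ * (F₁ z * (F z)⁻¹),
      by rw [norm_neg] at hai; exact hai.trans hbig, ?_, fun z hz => ?_⟩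
    · refine ((const n hai).mul (h1.mul hI)).mono (le_of_eq ?_)
      ring
    · have hz0 := ne_zero_of_mem_halfPlane hz
      have hF0 := h0 z hz
      have h7 : F₁ z = (F z - a) * z := by rw [h2 z hz]; field_simp; ring
      simp only [h7]
      field_simp
      ring

end IsSymbol

/-! ### Families of symbols indexed by the frequency -/

/-- A family of symbols with constants growing at most polynomially in the frequency. -/
def PolyFamily (n : ℕ) (F : ℤ × ℤ → ℂ → ℂ) : Prop :=
  ∃ (C : ℝ) (e : ℕ), 0 ≤ C ∧ ∀ j : ℤ × ℤ, j ≠ 0 → IsSymbol n (C * freqNorm j ^ e) (F j)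

/-- A family of symbols with constants decaying rapidly in the frequency. -/
def RapidFamily (n : ℕ) (F : ℤ × ℤ → ℂ → ℂ) : Prop :=
  ∀ p : ℕ, ∃ C : ℝ, 0 ≤ C ∧ ∀ j : ℤ × ℤ, j ≠ 0 → IsSymbol n (C / freqNorm j ^ p) (F j)

namespace PolyFamily

lemma congr {n : ℕ} {F G : ℤ × ℤ → ℂ → ℂ} (h : PolyFamily n F)
    (hFG : ∀ j, j ≠ 0 → ∀ z ∈ halfPlane 1, G j z = F j z) : PolyFamily n G := by
  obtain ⟨C, e, hC, h⟩ := h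
  exact ⟨C, e, hC, fun j hj => (h j hj).congr (hFG j hj)⟩

lemma const (n : ℕ) {c : ℤ × ℤ → ℂ} {C : ℝ} {e : ℕ}
    (hc : ∀ j, j ≠ 0 → ‖c j‖ ≤ C * freqNorm j ^ e) : PolyFamily n fun j _ => c j := by
  refine ⟨max C 0, e, le_max_right _ _, fun j hj => IsSymbol.const n ((hc j hj).trans ?_)⟩
  have := one_le_freqNorm hj
  gcongr
  exact le_max_left _ _

lemma div_self {n : ℕ} {F : ℤ × ℤ → ℂ → ℂ} (h : PolyFamily n F) :
    PolyFamily n fun j z => F j z / z := by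
  obtain ⟨C, e, hC, h⟩ := h
  exact ⟨C, e, hC, fun j hj => (h j hj).div_self.of_succ⟩

lemma add_div {n : ℕ} {F : ℤ × ℤ → ℂ → ℂ} {c : ℤ × ℤ → ℂ} {C : ℝ} {e : ℕ}
    (hc : ∀ j, j ≠ 0 → ‖c j‖ ≤ C * freqNorm j ^ e) (h : PolyFamily n F) :
    PolyFamily (n + 1) fun j z => c j + F j z / z := by
  obtain ⟨C', e', hC', h⟩ := h
  refine ⟨max C 0 + C', e + e', by positivity, fun j hj =>
    (IsSymbol.add_div (hc j hj) (h j hj)).mono ?_⟩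
  have hr := one_le_freqNorm hj
  have h1 : C * freqNorm j ^ e ≤ max C 0 * freqNorm j ^ (e + e') := by
    gcongr
    · exact le_max_left _ _
    · omega
  have h2 : C' * freqNorm j ^ e' ≤ C' * freqNorm j ^ (e + e') := by
    gcongr
    · omega
  linarith

lemma add {n : ℕ} {F G : ℤ × ℤ → ℂ → ℂ} (hF : PolyFamily n F) (hG : PolyFamily n G) :
    PolyFamily n fun j z => F j z + G j z := by
  obtain ⟨C, e, hC, h⟩ := hF
  obtain ⟨C', e', hC', h'⟩ := hG
  refine ⟨C + C', e + e', by positivity, fun j hj => ((h j hj).add (h' j hj)).mono ?_⟩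
  have hr := one_le_freqNorm hj
  have h1 : C * freqNorm j ^ e ≤ C * freqNorm j ^ (e + e') := by
    gcongr
    · omega
  have h2 : C' * freqNorm j ^ e' ≤ C' * freqNorm j ^ (e + e') := by
    gcongr
    · omega
  linarith

lemma mul {n : ℕ} {F G : ℤ × ℤ → ℂ → ℂ} (hF : PolyFamily n F) (hG : PolyFamily n G) :
    PolyFamily n fun j z => F j z * G j z := by
  obtain ⟨C, e, hC, h⟩ := hF
  obtain ⟨C', e', hC', h'⟩ := hG
  refine ⟨2 ^ n * (C * C'), e + e', by positivity, fun j hj =>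
    ((h j hj).mul (h' j hj)).mono (le_of_eq ?_)⟩
  rw [pow_add]
  ring

/-- Polynomial growth of degree e is compensated by asking for the decay of order e + p in the other
factor. -/
lemma mul_rapid {n : ℕ} {F G : ℤ × ℤ → ℂ → ℂ} (hF : PolyFamily n F) (hG : RapidFamily n G) :
    RapidFamily n fun j z => F j z * G j z := by
  obtain ⟨C, e, hC, h⟩ := hF
  intro p
  obtain ⟨C', hC', h'⟩ := hG (e + p)
  refine ⟨2 ^ n * (C * C'), by positivity, fun j hj =>
    ((h j hj).mul (h' j hj)).mono (le_of_eq ?_)⟩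
  have hr := one_le_freqNorm hj
  have hr0 : freqNorm j ≠ 0 := by positivity
  rw [pow_add]
  field_simp

lemma inv {n : ℕ} {F : ℤ × ℤ → ℂ → ℂ} {C : ℝ} {e : ℕ} (hF : PolyFamily n F)
    (h0 : ∀ j, j ≠ 0 → ∀ z ∈ halfPlane 1, F j z ≠ 0)
    (hi : ∀ j, j ≠ 0 → ∀ z ∈ halfPlane 1, ‖(F j z)⁻¹‖ ≤ C * freqNorm j ^ e) :
    PolyFamily n fun j z => (F j z)⁻¹ := by
  obtain ⟨C', e', hC', h⟩ := hF
  obtain ⟨K, k, hK, H⟩ := IsSymbol.inv n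
  refine ⟨K * (1 + |C| + C') ^ k, (e + e') * k, by positivity, fun j hj => ?_⟩
  have hr := one_le_freqNorm hj
  have hp : 1 ≤ freqNorm j ^ (e + e') := one_le_pow₀ hr
  have hC0 := abs_nonneg C
  refine (H (F j) ((1 + |C| + C') * freqNorm j ^ (e + e')) ?_ ((h j hj).mono ?_) (h0 j hj)
    fun z hz => (hi j hj z hz).trans ?_).mono (le_of_eq ?_)
  · nlinarith
  · gcongr
    · linarith
    · omega
  · gcongr
    · linarith [le_abs_self C]
    · omega
  · rw [mul_pow, pow_mul]
    ring

end PolyFamily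

/-- Sums of linear forms grow at most linearly. -/
lemma norm_linear_le {p q : ℝ} {j : ℤ × ℤ} :
    ‖(p : ℂ) * (j.1 : ℂ) + (q : ℂ) * (j.2 : ℂ)‖ ≤ (|p| + |q|) * freqNorm j ^ 1 := by
  have h1 : |(j.1 : ℝ)| ≤ freqNorm j :=
    Real.abs_le_sqrt (by linarith [sq_nonneg (j.2 : ℝ)])
  have h2 : |(j.2 : ℝ)| ≤ freqNorm j :=
    Real.abs_le_sqrt (by linarith [sq_nonneg (j.1 : ℝ)])
  have e1 : ‖(j.1 : ℂ)‖ = |(j.1 : ℝ)| := by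
    rw [← Complex.ofReal_intCast, Complex.norm_real, Real.norm_eq_abs]
  have e2 : ‖(j.2 : ℂ)‖ = |(j.2 : ℝ)| := by
    rw [← Complex.ofReal_intCast, Complex.norm_real, Real.norm_eq_abs]
  refine (norm_add_le _ _).trans ?_
  rw [norm_mul, norm_mul, e1, e2, Complex.norm_real, Complex.norm_real, Real.norm_eq_abs,
    Real.norm_eq_abs, pow_one, add_mul]
  gcongr

/-! ### The square root and the reciprocal of the Lopatinskii symbol -/

/-- The square root in the symbol. -/
def rootSymbol (ν : ℝ) (j : ℤ × ℤ) (z : ℂ) : ℂ :=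
  ((ν : ℂ) ^ 2 * z ^ 2 + (freqNorm j : ℂ) ^ 2) ^ (1 / 2 : ℂ)

/-- Taking imaginary parts of s² gives Re s · Im s = ν² Re z · Im z. With Re s ≥ 0 and Re z > 0 the
vectors s and νz then have nonnegative inner product, so their sum is at least as long as νz. -/
lemma norm_le_norm_rootSymbol_add {ν : ℝ} (hν : 0 < ν) (j : ℤ × ℤ) {z : ℂ} (hz : 0 < z.re) :
    ν * ‖z‖ ≤ ‖rootSymbol ν j z + ν * z‖ := by
  set s := rootSymbol ν j z with hs
  have hsq : s ^ 2 = (ν : ℂ) ^ 2 * z ^ 2 + (freqNorm j : ℂ) ^ 2 := cpow_half_sq _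
  have hre : 0 ≤ s.re := cpow_half_re_nonneg _
  have him : s.re * s.im = ν ^ 2 * (z.re * z.im) := by
    have := congrArg Complex.im hsq
    simp only [sq, Complex.add_im, Complex.mul_im, Complex.mul_re, Complex.ofReal_im,
      Complex.ofReal_re] at this
    linarith
  have hdot : 0 ≤ s.re * (ν * z.re) + s.im * (ν * z.im) := by
    have h1 : 0 ≤ s.re * (ν * z.re) := by positivity
    -- If Re s = 0 the sign of Im s is not determined by the product identity, but that identity
    -- forces Im z = 0 and the second summand vanishes.
    rcases hre.eq_or_lt with h | h
    · have h2 : z.im = 0 := by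
        rw [← h, zero_mul] at him
        by_contra h3
        have : ν ^ 2 * (z.re * z.im) ≠ 0 := by
          have h4 := hz.ne'
          have h5 := hν.ne'
          positivity
        exact this him.symm
      rw [h2]; simpa using h1
    · have h2 : 0 ≤ s.re * (s.im * (ν * z.im)) := by
        have : s.re * (s.im * (ν * z.im)) = ν ^ 3 * z.re * z.im ^ 2 := by
          rw [← mul_assoc, him]; ring
        rw [this]; positivity
      have := nonneg_of_mul_nonneg_right h2 h
      linarith
  have hsqle : (ν * ‖z‖) ^ 2 ≤ ‖s + ν * z‖ ^ 2 := by
    rw [mul_pow, Complex.sq_norm, Complex.sq_norm, Complex.normSq_apply, Complex.normSq_apply]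
    simp only [Complex.add_re, Complex.add_im, Complex.re_ofReal_mul, Complex.im_ofReal_mul]
    nlinarith [sq_nonneg s.re, sq_nonneg s.im]
  exact (abs_le_of_sq_le_sq' hsqle (norm_nonneg _)).2

/-- From (s - νz)(s + νz) = |j|² one gets s/z = ν + |j|² (s/z + ν)⁻¹ / z². An expansion of s/z of
order n on the right thus yields one of order n + 1 on the left, since |s/z + ν| ≥ ν. -/
lemma polyFamily_rootSymbol {ν : ℝ} (hν : 0 < ν) (n : ℕ) :
    PolyFamily n fun j z => rootSymbol ν j z / z := by
  induction n with
  | zero =>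
    refine ⟨ν + 1, 1, by positivity, fun j hj z hz => ?_⟩
    have hr := one_le_freqNorm hj
    have hr0 : 0 ≤ freqNorm j := by linarith
    have hz1 := one_lt_norm_of_mem hz
    rw [norm_div, div_le_iff₀ (by linarith), pow_one]
    have h1 : ‖rootSymbol ν j z‖ ^ 2 ≤ ((ν + 1) * freqNorm j * ‖z‖) ^ 2 := by
      rw [← norm_pow, rootSymbol, cpow_half_sq]
      refine (norm_add_le _ _).trans ?_
      rw [norm_mul, norm_pow, norm_pow, norm_pow, Complex.norm_real, Complex.norm_real,
        Real.norm_of_nonneg hν.le, Real.norm_of_nonneg hr0]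
      have h2 : ν ^ 2 * ‖z‖ ^ 2 ≤ ν ^ 2 * (freqNorm j * ‖z‖) ^ 2 := by
        gcongr; exact le_mul_of_one_le_left (norm_nonneg z) hr
      have h3 : freqNorm j ^ 2 ≤ (freqNorm j * ‖z‖) ^ 2 := by
        gcongr; exact le_mul_of_one_le_right hr0 hz1.le
      have h4 : 0 ≤ 2 * ν * (freqNorm j * ‖z‖) ^ 2 := by positivity
      linarith
    exact (abs_le_of_sq_le_sq' h1 (by positivity)).2
  | succ n ih =>
    have hsum : PolyFamily n fun j z => rootSymbol ν j z / z + ν :=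
      ih.add (PolyFamily.const n (c := fun _ => (ν : ℂ)) (C := ν) (e := 0) fun j _ => by
        simp [abs_of_pos hν])
    have hne : ∀ j : ℤ × ℤ, j ≠ 0 → ∀ z ∈ halfPlane 1, ν ≤ ‖rootSymbol ν j z / z + ν‖ :=
      fun j _ z hz => by
        have hz1 := one_lt_norm_of_mem hz
        have hz0 := ne_zero_of_mem_halfPlane hz
        have h1 := norm_le_norm_rootSymbol_add hν j (z := z) (zero_lt_one.trans hz)
        have e : rootSymbol ν j z / z + ν = (rootSymbol ν j z + ν * z) / z := by field_simp
        rw [e, norm_div, le_div_iff₀ (by linarith)]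
        exact h1
    have hinv := hsum.inv (C := ν⁻¹) (e := 0)
      (fun j hj z hz => norm_pos_iff.mp (hν.trans_le (hne j hj z hz)))
      (fun j hj z hz => by
        rw [norm_inv, pow_zero, mul_one]
        exact inv_anti₀ hν (hne j hj z hz))
    have hr2 : PolyFamily n fun j _ => (freqNorm j : ℂ) ^ 2 :=
      PolyFamily.const n (C := 1) (e := 2) fun j _ => by simp
    refine (PolyFamily.add_div (c := fun _ => (ν : ℂ)) (C := ν) (e := 0)
      (fun j _ => by simp [abs_of_pos hν]) (hr2.mul hinv.div_self)).congr fun j hj z hz => ?_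
    have hz0 := ne_zero_of_mem_halfPlane hz
    have hsq : rootSymbol ν j z ^ 2 = (ν : ℂ) ^ 2 * z ^ 2 + (freqNorm j : ℂ) ^ 2 := cpow_half_sq _
    have hn := norm_pos_iff.mp (hν.trans_le (hne j hj z hz))
    have hn' : rootSymbol ν j z + z * ν ≠ 0 := by
      intro h
      apply hn
      rw [show rootSymbol ν j z / z + ν = (rootSymbol ν j z + z * ν) / z by field_simp, h,
        zero_div]
    field_simp
    linear_combination hsq

lemma lopatinskii_ne_zero {S : RefState} {ν C : ℝ} {j : ℤ × ℤ} {z : ℂ} (hz : 1 ≤ z.re)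
    (h : ‖z‖ ^ 3 ≤ C * freqNorm j * ‖lopatinskii S ν z j‖) : lopatinskii S ν z j ≠ 0 := by
  intro h0
  rw [h0, norm_zero, mul_zero] at h
  have : 0 < ‖z‖ := by linarith [Complex.re_le_norm z]
  linarith [pow_pos this 3]

/-- The reciprocal of the Lopatinskii symbol, normalized, as a family of symbols. -/
lemma polyFamily_div_lopatinskii {S : RefState} {ν C : ℝ} (hν : 0 < ν)
    (hC : ∀ j : ℤ × ℤ, j ≠ 0 → ∀ z : ℂ, 1 ≤ z.re →
      ‖z‖ ^ 3 ≤ C * freqNorm j * ‖lopatinskii S ν z j‖) (n : ℕ) :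
    PolyFamily n fun j z => z ^ 3 / lopatinskii S ν z j := by
  have hlin : ∀ p q : ℝ, PolyFamily n fun j _ => (p : ℂ) * (j.1 : ℂ) + (q : ℂ) * (j.2 : ℂ) :=
    fun p q => PolyFamily.const n fun j _ => norm_linear_le
  have hconst : ∀ c : ℂ, PolyFamily n fun _ _ => c := fun c =>
    PolyFamily.const n (C := ‖c‖) (e := 0) fun j _ => by simp
  have hI := hconst Complex.I
  have hfreq : PolyFamily n fun j _ => (freqNorm j : ℂ) :=
    PolyFamily.const n (C := 1) (e := 1) fun j hj => by
      have := one_le_freqNorm hj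
      rw [Complex.norm_real, Real.norm_of_nonneg (by linarith)]
      simp
  -- After division by z³ the symbol is a polynomial in s/z and 1/z with coefficients of polynomial
  -- growth in j.
  have hsum : PolyFamily n fun j z => lopatinskii S ν z j / z ^ 3 := by
    have hA := (hconst 1).add (hI.mul (hlin S.u₁ S.u₂).div_self)
    have hB := hI.mul (hlin S.B₁ S.B₂).div_self
    have hH := hI.mul (hlin S.H₁ S.H₂).div_self
    have h1 := (hconst ((S.H₁ : ℂ) * ν)).add (hI.mul (hlin 0 S.E₃).div_self)
    have h2 := (hconst ((S.H₂ : ℂ) * ν)).add (hI.mul (hlin (-S.E₃) 0).div_self)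
    refine (((polyFamily_rootSymbol hν n).mul ((hA.mul hA).add ((hconst (-1)).mul
      (hB.mul hB)))).add (hfreq.mul (((h1.mul h1).add (h2.mul h2)).add
        ((hconst (-1)).mul (hH.mul hH)))).div_self).congr fun j _ z hz => ?_
    have hz0 := ne_zero_of_mem_halfPlane hz
    unfold lopatinskii rootSymbol
    generalize ((ν : ℂ) ^ 2 * z ^ 2 + (freqNorm j : ℂ) ^ 2) ^ (1 / 2 : ℂ) = s
    push_cast
    field_simp
    ring
  -- The stability estimate is exactly the bound on the reciprocal that inverting a symbol requires.
  refine (hsum.inv (C := C) (e := 1) (fun j hj z hz => ?_) (fun j hj z hz => ?_)).congr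
    fun j hj z hz => by rw [inv_div]
  · have h1 := lopatinskii_ne_zero (le_of_lt hz) (hC j hj z (le_of_lt hz))
    exact div_ne_zero h1 (pow_ne_zero 3 (ne_zero_of_mem_halfPlane hz))
  · have h1 := lopatinskii_ne_zero (le_of_lt hz) (hC j hj z (le_of_lt hz))
    rw [inv_div, norm_div, norm_pow, div_le_iff₀ (norm_pos_iff.mpr h1), pow_one]
    exact hC j hj z (le_of_lt hz)

/-! ### Time regularity of inverse transforms of symbols -/

lemma vline_mem_halfPlane {σ₀ σ : ℝ} (h : σ₀ < σ) (τ : ℝ) : vline σ τ ∈ halfPlane σ₀ := by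
  simpa [halfPlane] using h

lemma invLaplace_add {F G : ℂ → ℂ} {σ t : ℝ}
    (hF : Integrable fun τ : ℝ => Complex.exp (vline σ τ * t) * F (vline σ τ))
    (hG : Integrable fun τ : ℝ => Complex.exp (vline σ τ * t) * G (vline σ τ)) :
    invLaplace σ (fun z => F z + G z) t = invLaplace σ F t + invLaplace σ G t := by
  simp only [invLaplace, mul_add]
  rw [integral_add hF hG, mul_add]

lemma invLaplace_const_mul (c : ℂ) (F : ℂ → ℂ) (σ t : ℝ) :
    invLaplace σ (fun z => c * F z) t = c * invLaplace σ F t := by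
  simp only [invLaplace]
  rw [mul_left_comm, ← integral_const_mul c]
  congr 2
  funext τ
  ring

lemma invLaplace_congr {F G : ℂ → ℂ} {σ : ℝ} (h : ∀ τ, F (vline σ τ) = G (vline σ τ)) (t : ℝ) :
    invLaplace σ F t = invLaplace σ G t := by
  simp only [invLaplace, h]

lemma IsSymbol.norm_div_sq_le {n : ℕ} {M σ : ℝ} {F : ℂ → ℂ} (hF : IsSymbol n M F) (hσ : 1 < σ)
    (τ : ℝ) : ‖F (vline σ τ) / vline σ τ ^ 2‖ ≤ M / ‖vline σ τ‖ ^ 2 := by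
  rw [norm_div, norm_pow]
  gcongr
  exact hF.norm_le _ (vline_mem_halfPlane hσ τ)

/-- The inverse Laplace transform of `F / z²` is as smooth for `t > 0` as the expansion of `F`
is long. -/
lemma IsSymbol.exists_derivs {n : ℕ} {M : ℝ} {F : ℂ → ℂ} (hF : IsSymbol n M F)
    (hc : Continuous fun τ => F (vline 2 τ)) :
    ∃ φ : ℕ → ℝ → ℂ, (∀ t, 0 < t → φ 0 t = invLaplace 2 (fun z => F z / z ^ 2) t) ∧
      (∀ k < n, ∀ t, 0 < t → HasDerivAt (φ k) (φ (k + 1) t) t) ∧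
      ∀ k ≤ n, ∀ t, 0 < t → ‖φ k t‖ ≤ 2 * M * Real.exp (2 * t) := by
  have hbase : ∀ (m : ℕ) (G : ℂ → ℂ), IsSymbol m M G → ∀ t,
      ‖invLaplace 2 (fun z => G z / z ^ 2) t‖ ≤ M * Real.exp (2 * t) := fun m G hG t => by
    have := norm_invLaplace_le (F := fun z => G z / z ^ 2) two_pos
      (hG.norm_div_sq_le one_lt_two) t
    have h1 : 0 ≤ Real.exp (2 * t) * M := mul_nonneg (Real.exp_pos _).le hG.nonneg
    linarith
  induction n generalizing F with
  | zero =>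
    refine ⟨fun _ => invLaplace 2 fun z => F z / z ^ 2, fun _ _ => rfl,
      fun k hk => absurd hk (Nat.not_lt_zero k), fun k _ t _ => (hbase 0 F hF t).trans ?_⟩
    have h1 : 0 ≤ M * Real.exp (2 * t) := mul_nonneg hF.nonneg (Real.exp_pos _).le
    linarith
  | succ n ih =>
    have hM := hF.nonneg
    have hF' := hF
    obtain ⟨-, a, F₁, ha, h1, h2⟩ := hF
    have hz0 : ∀ τ, vline 2 τ ≠ 0 := vline_ne_zero two_pos
    have hv := continuous_vline 2
    have h2' : ∀ τ, F (vline 2 τ) = a + F₁ (vline 2 τ) / vline 2 τ := fun τ =>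
      h2 _ (vline_mem_halfPlane one_lt_two τ)
    have hc₁ : Continuous fun τ => F₁ (vline 2 τ) := by
      have e : (fun τ => F₁ (vline 2 τ)) = fun τ => (F (vline 2 τ) - a) * vline 2 τ := by
        funext τ
        have := hz0 τ
        rw [h2' τ]
        field_simp
        ring
      rw [e]
      exact (hc.sub continuous_const).mul hv
    obtain ⟨ψ, hψ0, hψ1, hψ2⟩ := ih h1 hc₁
    have hc₂ : Continuous fun τ => F₁ (vline 2 τ) / vline 2 τ ^ 2 :=
      hc₁.div (hv.pow 2) fun τ => pow_ne_zero 2 (hz0 τ)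
    have hder := fun t => hasDerivAt_invLaplace (G := fun z => F₁ z / z ^ 2) two_pos hc₂
      (h1.norm_div_sq_le one_lt_two) t
    have hexp : ∀ t : ℝ, 0 < t → 1 ≤ Real.exp (2 * t) := fun t ht =>
      Real.one_le_exp (by positivity)
    -- Dividing F = a + F₁/z by z² separates the explicit function at from a time integral of the
    -- inverse transform of F₁/z², to which induction applies. The singularity at t = 0 sits in the
    -- explicit term, which equals at only for t ≥ 0.
    have hsplit : ∀ t, 0 < t → invLaplace 2 (fun z => F z / z ^ 2) t
        = a * t + invLaplace 2 (fun z => F₁ z / z ^ 2 / z) t := fun t ht => by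
      rw [← invLaplace_inv_sq two_pos ht.le, ← invLaplace_const_mul, ← invLaplace_add]
      · refine invLaplace_congr (fun τ => ?_) t
        have := hz0 τ
        rw [h2' τ]
        field_simp
      · refine integrable_invLaplace (M := M) (F := fun z => a * (1 / z ^ 2)) two_pos ?_ ?_ t
        · exact continuous_const.mul (continuous_const.div (hv.pow 2)
            fun τ => pow_ne_zero 2 (hz0 τ))
        · intro τ
          rw [norm_mul, norm_div, norm_one, norm_pow, ← mul_div_assoc, mul_one]
          gcongr
      · refine integrable_invLaplace (M := M) (F := fun z => F₁ z / z ^ 2 / z) two_pos ?_ ?_ t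
        · exact hc₂.div hv hz0
        · intro τ
          rw [norm_div]
          refine (div_le_self (norm_nonneg _) ?_).trans (h1.norm_div_sq_le one_lt_two τ)
          exact one_le_two.trans (le_norm_vline τ)
    -- The chain ψ belongs to F₁, so indices shift by one: differentiating at contributes a to the
    -- first derivative and nothing after it. The sum a + ψ 0 is the reason for the factor 2 in the
    -- bound.
    refine ⟨fun k => match k with
      | 0 => fun t => a * t + invLaplace 2 (fun z => F₁ z / z ^ 2 / z) t
      | 1 => fun t => a + ψ 0 t
      | k + 2 => ψ (k + 1), fun t ht => (hsplit t ht).symm, ?_, ?_⟩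
    · intro k hk t ht
      match k with
      | 0 =>
        have h3 : HasDerivAt (fun t : ℝ => a * (t : ℂ)) a t := by
          simpa using (Complex.ofRealCLM.hasDerivAt (x := t)).const_mul a
        have h4 := h3.add (hder t)
        refine h4.congr_deriv ?_
        simp only [hψ0 t ht]
      | 1 => exact (hψ1 0 (by omega) t ht).const_add a
      | k + 2 => exact hψ1 (k + 1) (by omega) t ht
    · intro k hk t ht
      match k with
      | 0 =>
        simp only
        rw [← hsplit t ht]
        refine (hbase _ F hF' t).trans ?_
        have : 0 ≤ M * Real.exp (2 * t) := by positivity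
        linarith
      | 1 =>
        simp only
        rw [hψ0 t ht]
        refine (norm_add_le _ _).trans ?_
        have h3 := hbase _ F₁ h1 t
        have h4 : M * 1 ≤ M * Real.exp (2 * t) := by gcongr; exact hexp t ht
        linarith
      | k + 2 => exact hψ2 (k + 1) (by omega) t ht

/-- A chain of successive derivatives on an open set computes the iterated derivatives. -/
lemma iteratedDeriv_eq_of_chain {f : ℝ → ℂ} {φ : ℕ → ℝ → ℂ} {U : Set ℝ} (hU : IsOpen U) {n : ℕ}
    (h0 : ∀ t ∈ U, f t = φ 0 t) (h : ∀ k < n, ∀ t ∈ U, HasDerivAt (φ k) (φ (k + 1) t) t) :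
    ∀ k ≤ n, ∀ t ∈ U, iteratedDeriv k f t = φ k t := by
  intro k
  induction k with
  | zero => intro _ t ht; simpa using h0 t ht
  | succ k ih =>
    intro hk t ht
    rw [iteratedDeriv_succ]
    have : iteratedDeriv k f =ᶠ[𝓝 t] φ k := by
      filter_upwards [hU.mem_nhds ht] with s hs using ih (by omega) s hs
    rw [this.deriv_eq]
    exact (h k (by omega) t ht).deriv

/-- Iterated derivatives, with bounds, of a function which on `(0, T)` is an inverse Laplace
transform of `F / z²`. -/
lemma IsSymbol.iteratedDeriv_bound {n : ℕ} {M T : ℝ} {F : ℂ → ℂ} (hF : IsSymbol n M F)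
    (hc : Continuous fun τ => F (vline 2 τ)) {f : ℝ → ℂ}
    (hf : ∀ t ∈ Ioo 0 T, f t = invLaplace 2 (fun z => F z / z ^ 2) t) :
    (∀ k < n, ∀ t ∈ Ioo 0 T, HasDerivAt (iteratedDeriv k f) (iteratedDeriv (k + 1) f t) t) ∧
      ∀ k ≤ n, ∀ t ∈ Ioo 0 T, ‖iteratedDeriv k f t‖ ≤ 2 * M * Real.exp (2 * T) := by
  obtain ⟨φ, h0, h1, h2⟩ := hF.exists_derivs hc
  have key := iteratedDeriv_eq_of_chain (isOpen_Ioo (a := (0 : ℝ)) (b := T)) (n := n) (φ := φ)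
    (f := f) (fun t ht => (hf t ht).trans (h0 t ht.1).symm) fun k hk t ht => h1 k hk t ht.1
  refine ⟨fun k hk t ht => ?_, fun k hk t ht => ?_⟩
  · rw [key (k + 1) hk t ht]
    refine (h1 k hk t ht.1).congr_of_eventuallyEq ?_
    filter_upwards [isOpen_Ioo.mem_nhds ht] with s hs using key k hk.le s hs
  · rw [key k hk t ht]
    refine (h2 k hk t ht.1).trans ?_
    have := hF.nonneg
    have := ht.2
    gcongr

/-! ### Test functions and weak derivatives on an interval -/

/-- Integration by parts against a primitive of an integrable function. -/
lemma integral_mul_primitive {T : ℝ} {φ φ' g : ℝ → ℂ}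
    (hφ : ∀ t, HasDerivAt φ (φ' t) t) (hφ' : Continuous φ') (hg : IntegrableOn g (Ioo 0 T)) :
    ∫ t in Ioo 0 T, φ' t * ∫ s in (0 : ℝ)..t, g s = ∫ s in Ioo 0 T, (φ T - φ s) * g s := by
  set μ : Measure ℝ := volume.restrict (Ioo 0 T) with hμ
  have hφi : Integrable φ' μ :=
    (hφ'.integrableOn_Icc (a := 0) (b := T)).mono_set Ioo_subset_Icc_self
  have hprod : Integrable (fun p : ℝ × ℝ => φ' p.1 * g p.2) (μ.prod μ) := hφi.mul_prod hg
  have hset : MeasurableSet {p : ℝ × ℝ | p.2 < p.1} :=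
    measurableSet_lt measurable_snd measurable_fst
  -- Fubini on the triangle s < t; integrating first in t leaves φ T - φ s.
  have hswap := integral_integral_swap (f := fun t s => {p : ℝ × ℝ | p.2 < p.1}.indicator
    (fun p : ℝ × ℝ => φ' p.1 * g p.2) (t, s)) (hprod.indicator hset)
  have h1 : ∀ t ∈ Ioo 0 T, ∫ s, {p : ℝ × ℝ | p.2 < p.1}.indicator
      (fun p : ℝ × ℝ => φ' p.1 * g p.2) (t, s) ∂μ = φ' t * ∫ s in (0 : ℝ)..t, g s := by
    intro t ht
    have e : (fun s => {p : ℝ × ℝ | p.2 < p.1}.indicator (fun p : ℝ × ℝ => φ' p.1 * g p.2) (t, s))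
        = (Iio t).indicator fun s => φ' t * g s := by
      funext s
      by_cases h : s < t <;> simp [indicator, h]
    rw [e, integral_indicator measurableSet_Iio, hμ, Measure.restrict_restrict measurableSet_Iio,
      integral_const_mul, intervalIntegral.integral_of_le ht.1.le,
      integral_Ioc_eq_integral_Ioo]
    congr 3
    ext s
    simp only [mem_inter_iff, mem_Iio, mem_Ioo]
    exact ⟨fun h => ⟨h.2.1, h.1⟩, fun h => ⟨h.2, h.1, h.2.trans ht.2⟩⟩
  have h2 : ∀ s ∈ Ioo 0 T, ∫ t, {p : ℝ × ℝ | p.2 < p.1}.indicator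
      (fun p : ℝ × ℝ => φ' p.1 * g p.2) (t, s) ∂μ = (φ T - φ s) * g s := by
    intro s hs
    have e : (fun t => {p : ℝ × ℝ | p.2 < p.1}.indicator (fun p : ℝ × ℝ => φ' p.1 * g p.2) (t, s))
        = (Ioi s).indicator fun t => φ' t * g s := by
      funext t
      by_cases h : s < t <;> simp [indicator, h]
    rw [e, integral_indicator measurableSet_Ioi, hμ, Measure.restrict_restrict measurableSet_Ioi,
      integral_mul_const, ← intervalIntegral.integral_eq_sub_of_hasDerivAt (fun t _ => hφ t)
        (hφ'.intervalIntegrable s T), intervalIntegral.integral_of_le hs.2.le,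
      integral_Ioc_eq_integral_Ioo]
    congr 3
    ext t
    simp only [mem_inter_iff, mem_Ioi, mem_Ioo]
    exact ⟨fun h => ⟨h.1, h.2.2⟩, fun h => ⟨h.1, hs.1.trans h.1, h.2⟩⟩
  rw [← setIntegral_congr_fun measurableSet_Ioo h1, ← setIntegral_congr_fun measurableSet_Ioo h2]
  exact hswap

/-- Smooth functions of one variable with compact support in `(0, T)`. -/
structure IsTestOne (T : ℝ) (χ : ℝ → ℝ) : Prop where
  smooth : ContDiff ℝ ∞ χ
  support : ∃ a b : ℝ, 0 < a ∧ b < T ∧ ∀ t, χ t ≠ 0 → t ∈ Icc a b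

namespace IsTestOne

lemma deriv {T : ℝ} {χ : ℝ → ℝ} (h : IsTestOne T χ) : IsTestOne T (deriv χ) := by
  obtain ⟨a, b, ha, hb, hs⟩ := h.support
  refine ⟨(contDiff_infty_iff_deriv.mp h.smooth).2, a, b, ha, hb, fun t ht => ?_⟩
  by_contra hmem
  apply ht
  have : χ =ᶠ[𝓝 t] fun _ => 0 := by
    filter_upwards [isClosed_Icc.isOpen_compl.mem_nhds hmem] with s hs'
    by_contra h0
    exact hs' (hs s h0)
  rw [this.deriv_eq]
  simp

lemma iteratedDeriv {T : ℝ} {χ : ℝ → ℝ} (h : IsTestOne T χ) (k : ℕ) :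
    IsTestOne T (iteratedDeriv k χ) := by
  induction k with
  | zero => simpa using h
  | succ k ih => rw [iteratedDeriv_succ]; exact ih.deriv

lemma continuous {T : ℝ} {χ : ℝ → ℝ} (h : IsTestOne T χ) : Continuous χ := h.smooth.continuous

lemma eq_zero_of_le {T : ℝ} {χ : ℝ → ℝ} (h : IsTestOne T χ) {t : ℝ} (ht : t ≤ 0) : χ t = 0 := by
  obtain ⟨a, b, ha, hb, hs⟩ := h.support
  by_contra h0
  linarith [(hs t h0).1]

lemma eq_zero_of_ge {T : ℝ} {χ : ℝ → ℝ} (h : IsTestOne T χ) {t : ℝ} (ht : T ≤ t) : χ t = 0 := by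
  obtain ⟨a, b, ha, hb, hs⟩ := h.support
  by_contra h0
  linarith [(hs t h0).2]

lemma exists_bound {T : ℝ} {χ : ℝ → ℝ} (h : IsTestOne T χ) : ∃ C, ∀ t, ‖(χ t : ℂ)‖ ≤ C := by
  obtain ⟨a, b, ha, hb, hs⟩ := h.support
  have hc : HasCompactSupport χ := HasCompactSupport.of_support_subset_isCompact isCompact_Icc
    fun t ht => hs t ht
  obtain ⟨C, hC⟩ := hc.exists_bound_of_continuous h.continuous
  exact ⟨C, fun t => by simpa using hC t⟩

lemma integrable_mul {T : ℝ} {χ : ℝ → ℝ} (h : IsTestOne T χ) {f : ℝ → ℂ}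
    (hf : IntegrableOn f (Ioo 0 T)) : IntegrableOn (fun t => (χ t : ℂ) * f t) (Ioo 0 T) := by
  obtain ⟨C, hC⟩ := h.exists_bound
  have := h.continuous
  exact Integrable.bdd_mul (c := C) hf
    (Continuous.aestronglyMeasurable (by fun_prop)) (Eventually.of_forall hC)

lemma of_tsupport {T : ℝ} {χ : ℝ → ℝ} (h : ContDiff ℝ ∞ χ) (hc : HasCompactSupport χ)
    (hs : tsupport χ ⊆ Ioo 0 T) : IsTestOne T χ := by
  rcases (tsupport χ).eq_empty_or_nonempty with h0 | h0
  -- For the zero function any endpoints will do; 0 < 1 and T - 1 < T hold whatever T is, and no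
  -- order between them is needed.
  · refine ⟨h, 1, T - 1, one_pos, by linarith, fun t ht => ?_⟩
    have := subset_tsupport χ ht
    rw [h0] at this
    exact absurd this (notMem_empty t)
  · obtain ⟨a, ha⟩ := hc.isCompact.exists_isLeast h0
    obtain ⟨b, hb⟩ := hc.isCompact.exists_isGreatest h0
    exact ⟨h, a, b, (hs ha.1).1, (hs hb.1).2, fun t ht =>
      ⟨ha.2 (subset_tsupport χ ht), hb.2 (subset_tsupport χ ht)⟩⟩

end IsTestOne

lemma ae_eq_zero_of_forall_test {T : ℝ} {f : ℝ → ℂ} (hf : IntegrableOn f (Ioo 0 T))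
    (h : ∀ χ, IsTestOne T χ → ∫ t in Ioo 0 T, (χ t : ℂ) * f t = 0) :
    ∀ᵐ t ∂(volume.restrict (Ioo 0 T)), f t = 0 := by
  rw [ae_restrict_iff' measurableSet_Ioo]
  refine isOpen_Ioo.ae_eq_zero_of_integral_contDiff_smul_eq_zero hf.locallyIntegrableOn ?_
  intro χ hχ hc hs
  have ht := IsTestOne.of_tsupport hχ hc hs
  rw [← h χ ht]
  refine (setIntegral_eq_integral_of_forall_compl_eq_zero (s := Ioo 0 T) fun t hmem => ?_).symm.trans ?_
  · by_cases h0 : t ≤ 0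
    · rw [ht.eq_zero_of_le h0, zero_smul]
    · rw [ht.eq_zero_of_ge (not_lt.mp fun h1 => hmem ⟨not_le.mp h0, h1⟩), zero_smul]
  · simp only [Complex.real_smul]

lemma exists_test_integral_eq_one {T : ℝ} (hT : 0 < T) :
    ∃ θ, IsTestOne T θ ∧ ∫ t in Ioo 0 T, θ t = 1 := by
  let b : ContDiffBump (T / 2) := ⟨T / 8, T / 4, by positivity, by linarith⟩
  refine ⟨b.normed volume, ⟨b.contDiff_normed, T / 4, 3 * T / 4, by positivity, by linarith,
    fun t ht => ?_⟩, ?_⟩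
  · have h1 : t ∈ Metric.ball (T / 2) (T / 4) := by
      have h2 := b.support_normed_eq (μ := volume)
      rw [← h2]
      exact ht
    rw [Real.ball_eq_Ioo] at h1
    constructor <;> linarith [h1.1, h1.2]
  · rw [setIntegral_eq_integral_of_forall_compl_eq_zero, b.integral_normed]
    intro t ht
    by_contra h0
    have h1 : t ∈ Metric.ball (T / 2) (T / 4) := by
      have h2 := b.support_normed_eq (μ := volume)
      rw [← h2]
      exact h0
    rw [Real.ball_eq_Ioo] at h1
    exact ht ⟨by linarith [h1.1], by linarith [h1.2]⟩

/-- A test function with zero integral is the derivative of a test function. -/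
lemma IsTestOne.exists_primitive {T : ℝ} {ψ : ℝ → ℝ} (hψ : IsTestOne T ψ)
    (h0 : ∫ t in Ioo 0 T, ψ t = 0) : ∃ χ, IsTestOne T χ ∧ _root_.deriv χ = ψ := by
  obtain ⟨a, b, ha, hb, hs⟩ := hψ.support
  have hd : ∀ t, HasDerivAt (fun t => ∫ s in (0 : ℝ)..t, ψ s) (ψ t) t := fun t =>
    intervalIntegral.integral_hasDerivAt_right (hψ.continuous.intervalIntegrable _ _)
      (hψ.continuous.stronglyMeasurableAtFilter _ _) hψ.continuous.continuousAt
  have hderiv : _root_.deriv (fun t => ∫ s in (0 : ℝ)..t, ψ s) = ψ := funext fun t => (hd t).deriv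
  refine ⟨fun t => ∫ s in (0 : ℝ)..t, ψ s, ⟨?_, a, b, ha, hb, fun t ht => ?_⟩, hderiv⟩
  · rw [contDiff_infty_iff_deriv, hderiv]
    exact ⟨fun t => (hd t).differentiableAt, hψ.smooth⟩
  · by_contra hmem
    apply ht
    have hzero : ∀ s, s < a ∨ b < s → ψ s = 0 := fun s hs' => by
      by_contra h1
      have := hs s h1
      rcases hs' with h | h
      · exact absurd this.1 (not_le.mpr h)
      · exact absurd this.2 (not_le.mpr h)
    rcases lt_or_ge t a with h | h
    · refine intervalIntegral.integral_zero_ae (Eventually.of_forall fun s hs' => hzero s (Or.inl ?_))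
      exact hs'.2.trans_lt (max_lt ha h)
    · have hbt : b < t := by
        by_contra h2
        exact hmem ⟨h, not_lt.mp h2⟩
      rcases le_or_gt T 0 with hT | hT
      · refine intervalIntegral.integral_zero_ae (Eventually.of_forall fun s _ => ?_)
        rcases le_total s 0 with h3 | h3
        · exact hψ.eq_zero_of_le h3
        · exact hψ.eq_zero_of_ge (hT.trans h3)
      · have h3 : ∫ s in (0 : ℝ)..T, ψ s = 0 := by
          rw [intervalIntegral.integral_of_le hT.le, integral_Ioc_eq_integral_Ioo, h0]
        have h4 : ∫ s in T..t, ψ s = 0 := by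
          refine intervalIntegral.integral_zero_ae (Eventually.of_forall fun s hs' =>
            hzero s (Or.inr ?_))
          exact (lt_min hb hbt).trans hs'.1
        have h5 := intervalIntegral.integral_add_adjacent_intervals
          (hψ.continuous.intervalIntegrable (μ := volume) 0 T)
          (hψ.continuous.intervalIntegrable T t)
        change ∫ s in (0 : ℝ)..t, ψ s = 0
        rw [← h5, h3, h4, add_zero]

/-- The lemma of du Bois-Reymond: a function with an integrable weak derivative `g` is a
primitive of `g`. -/
lemma exists_ae_eq_const_add_primitive {T : ℝ} (hT : 0 < T) {f g : ℝ → ℂ}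
    (hf : IntegrableOn f (Ioo 0 T)) (hg : IntegrableOn g (Ioo 0 T))
    (h : ∀ χ, IsTestOne T χ → ∫ t in Ioo 0 T, ((deriv χ t : ℝ) : ℂ) * f t
      = -∫ t in Ioo 0 T, (χ t : ℂ) * g t) :
    ∃ c : ℂ, ∀ᵐ t ∂(volume.restrict (Ioo 0 T)), f t = c + ∫ s in (0 : ℝ)..t, g s := by
  have hgi : IntegrableOn (fun t => ∫ s in (0 : ℝ)..t, g s) (Ioo 0 T) := by
    have h1 : ContinuousOn (fun t => ∫ s in (0 : ℝ)..t, g s) (Icc 0 T) :=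
      intervalIntegral.continuousOn_primitive_interval
        (by rwa [uIcc_of_le hT.le, integrableOn_Icc_iff_integrableOn_Ioo])
        |>.mono (uIcc_of_le hT.le).ge
    exact (h1.integrableOn_Icc).mono_set Ioo_subset_Icc_self
  -- The difference of f and the primitive of g has zero weak derivative; it remains to see that it
  -- is constant.
  set d : ℝ → ℂ := fun t => f t - ∫ s in (0 : ℝ)..t, g s with hd
  have hdi : IntegrableOn d (Ioo 0 T) := hf.sub hgi
  have hd0 : ∀ χ, IsTestOne T χ → ∫ t in Ioo 0 T, ((deriv χ t : ℝ) : ℂ) * d t = 0 := fun χ hχ => by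
    have h1 : ∫ t in Ioo 0 T, ((deriv χ t : ℝ) : ℂ) * d t = (∫ t in Ioo 0 T, ((deriv χ t : ℝ) : ℂ) * f t)
        - ∫ t in Ioo 0 T, ((deriv χ t : ℝ) : ℂ) * ∫ s in (0 : ℝ)..t, g s := by
      rw [← integral_sub (hχ.deriv.integrable_mul hf) (hχ.deriv.integrable_mul hgi)]
      simp only [hd, mul_sub]
    have h2 := integral_mul_primitive (φ := fun t => (χ t : ℂ))
      (φ' := fun t => ((deriv χ t : ℝ) : ℂ)) (g := g)
      (fun t => ((hχ.smooth.differentiable (by simp)) t).hasDerivAt.ofReal_comp)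
      (by have := hχ.deriv.continuous; fun_prop) hg
    rw [h1, h2, h χ hχ, hχ.eq_zero_of_ge le_rfl]
    simp [integral_neg]
  obtain ⟨θ, hθ, hθ1⟩ := exists_test_integral_eq_one hT
  set c : ℂ := ∫ t in Ioo 0 T, (θ t : ℂ) * d t with hc
  refine ⟨c, ?_⟩
  have key := ae_eq_zero_of_forall_test (f := fun t => d t - c)
    (hdi.sub (integrableOn_const (by simp))) fun ψ hψ => by
      set m : ℝ := ∫ t in Ioo 0 T, ψ t with hm
      have hint : ∀ {χ : ℝ → ℝ}, IsTestOne T χ → IntegrableOn χ (Ioo 0 T) := fun hχ =>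
        (hχ.continuous.integrableOn_Icc (a := 0) (b := T)).mono_set Ioo_subset_Icc_self
      -- Subtracting from ψ its integral times the normalized bump θ leaves a test function of zero
      -- integral, hence a derivative, to which d is orthogonal. So d pairs with ψ as the constant c
      -- does.
      have hη : IsTestOne T fun t => ψ t - m * θ t := by
        obtain ⟨a, b, ha, hb, hs⟩ := hψ.support
        obtain ⟨a', b', ha', hb', hs'⟩ := hθ.support
        refine ⟨hψ.smooth.sub (contDiff_const.mul hθ.smooth), min a a', max b b', lt_min ha ha',
          max_lt hb hb', fun t ht => ?_⟩
        by_cases h1 : ψ t = 0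
        · have h2 : θ t ≠ 0 := fun h2 => ht (by rw [h1, h2]; ring)
          exact ⟨(min_le_right _ _).trans (hs' t h2).1, (hs' t h2).2.trans (le_max_right _ _)⟩
        · exact ⟨(min_le_left _ _).trans (hs t h1).1, (hs t h1).2.trans (le_max_left _ _)⟩
      have hη0 : ∫ t in Ioo 0 T, (ψ t - m * θ t) = 0 := by
        rw [integral_sub (hint hψ) ((hint hθ).const_mul m), integral_const_mul, hθ1, ← hm]
        ring
      obtain ⟨χ, hχ, hχ'⟩ := hη.exists_primitive hη0
      have h1 := hd0 χ hχ
      rw [hχ'] at h1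
      have h2 : ∫ t in Ioo 0 T, (((ψ t - m * θ t : ℝ)) : ℂ) * d t
          = (∫ t in Ioo 0 T, (ψ t : ℂ) * d t) - m * c := by
        rw [hc, ← integral_const_mul, ← integral_sub (hψ.integrable_mul hdi)
          ((hθ.integrable_mul hdi).const_mul _)]
        congr 1
        funext t
        push_cast
        ring
      rw [h2] at h1
      have h3 : ∫ t in Ioo 0 T, (ψ t : ℂ) * (d t - c)
          = (∫ t in Ioo 0 T, (ψ t : ℂ) * d t) - m * c := by
        have h4 : (m : ℂ) = ∫ t in Ioo 0 T, (ψ t : ℂ) := by rw [hm, integral_complex_ofReal]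
        simp only [mul_sub]
        rw [integral_sub (hψ.integrable_mul hdi)
            (hψ.integrable_mul (integrableOn_const (by simp))),
          integral_mul_const, h4]
      rw [h3, h1]
  filter_upwards [key] with t ht
  rw [sub_eq_zero] at ht
  rw [← ht, hd]
  ring

/-! ### Laplace transforms of truncated functions -/

lemma laplace_indicator (T : ℝ) (f : ℝ → ℂ) (z : ℂ) :
    laplace ((Ioo 0 T).indicator f) z = ∫ t in Ioo 0 T, Complex.exp (-z * t) * f t := by
  have e : (fun t : ℝ => Complex.exp (-z * t) * (Ioo 0 T).indicator f t)
      = (Ioo 0 T).indicator fun t : ℝ => Complex.exp (-z * t) * f t := by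
    funext t
    by_cases h : t ∈ Ioo 0 T <;> simp [indicator, h]
  rw [laplace, e, setIntegral_indicator measurableSet_Ioo]
  congr 2
  exact inter_eq_right.mpr fun t ht => ht.1

lemma integrableOn_exp_mul_indicator {T : ℝ} {f : ℝ → ℂ} (hf : IntegrableOn f (Ioo 0 T)) :
    IntegrableOn (fun t : ℝ => Complex.exp (-((0 : ℝ) : ℂ) * t) * (Ioo 0 T).indicator f t)
      (Ioi 0) := by
  have : Integrable ((Ioo 0 T).indicator f) := hf.integrable_indicator measurableSet_Ioo
  simpa using this.integrableOn

lemma norm_laplace_indicator_le {T : ℝ} {f : ℝ → ℂ} (hf : IntegrableOn f (Ioo 0 T)) {z : ℂ}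
    (hz : 0 ≤ z.re) : ‖laplace ((Ioo 0 T).indicator f) z‖ ≤ ∫ t in Ioo 0 T, ‖f t‖ := by
  rw [laplace_indicator]
  refine norm_integral_le_of_norm_le hf.norm ?_
  refine (ae_restrict_iff' measurableSet_Ioo).mpr (Eventually.of_forall fun t ht => ?_)
  rw [norm_mul, Complex.norm_exp]
  refine mul_le_of_le_one_left (norm_nonneg _) ?_
  rw [Real.exp_le_one_iff, Complex.re_mul_ofReal, Complex.neg_re]
  have := mul_nonneg hz ht.1.le
  linarith

lemma differentiableOn_laplace_indicator {T : ℝ} {f : ℝ → ℂ} (hf : IntegrableOn f (Ioo 0 T)) :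
    DifferentiableOn ℂ (laplace ((Ioo 0 T).indicator f)) (halfPlane 1) :=
  (differentiableOn_laplace (integrableOn_exp_mul_indicator hf)).mono
    fun z hz => show (0 : ℝ) < z.re from zero_lt_one.trans hz

lemma norm_primitive_le {T : ℝ} {g : ℝ → ℂ} (hg : IntegrableOn g (Ioo 0 T)) {t : ℝ}
    (h0 : 0 ≤ t) (ht : t ≤ T) : ‖∫ s in (0 : ℝ)..t, g s‖ ≤ ∫ s in Ioo 0 T, ‖g s‖ := by
  rw [intervalIntegral.integral_of_le h0, integral_Ioc_eq_integral_Ioo]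
  refine (norm_integral_le_integral_norm _).trans ?_
  exact setIntegral_mono_set hg.norm (Eventually.of_forall fun _ => norm_nonneg _)
    (LE.le.eventuallyLE (Ioo_subset_Ioo_right ht))

lemma integrableOn_primitive {T : ℝ} (hT : 0 < T) {g : ℝ → ℂ} (hg : IntegrableOn g (Ioo 0 T)) :
    IntegrableOn (fun t => ∫ s in (0 : ℝ)..t, g s) (Ioo 0 T) := by
  have h1 : ContinuousOn (fun t => ∫ s in (0 : ℝ)..t, g s) (Icc 0 T) :=
    intervalIntegral.continuousOn_primitive_interval
      (by rwa [uIcc_of_le hT.le, integrableOn_Icc_iff_integrableOn_Ioo])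
      |>.mono (uIcc_of_le hT.le).ge
  exact (h1.integrableOn_Icc).mono_set Ioo_subset_Icc_self

/-- The Laplace transform of a truncated primitive. -/
lemma laplace_indicator_primitive {T : ℝ} (hT : 0 < T) {f g : ℝ → ℂ} {c : ℂ}
    (hg : IntegrableOn g (Ioo 0 T))
    (h : ∀ᵐ t ∂(volume.restrict (Ioo 0 T)), f t = c + ∫ s in (0 : ℝ)..t, g s) {z : ℂ}
    (hz : z ≠ 0) :
    laplace ((Ioo 0 T).indicator f) z = (c + laplace ((Ioo 0 T).indicator g) z) / z
      - Complex.exp (-T * z) * ((c + ∫ s in Ioo 0 T, g s) / z) := by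
  have hd : ∀ t : ℝ, HasDerivAt (fun t : ℝ => -Complex.exp (-z * t)) (z * Complex.exp (-z * t)) t :=
    fun t => by
      have h1 : HasDerivAt (fun t : ℝ => -z * (t : ℂ)) (-z) t := by
        simpa using (Complex.ofRealCLM.hasDerivAt (x := t)).const_mul (-z)
      exact (h1.cexp.neg).congr_deriv (by ring)
  have hexp : ∀ {g : ℝ → ℂ}, IntegrableOn g (Ioo 0 T) →
      IntegrableOn (fun t : ℝ => Complex.exp (-z * t) * g t) (Ioo 0 T) := fun {g} hg => by
    obtain ⟨C, hC⟩ := isCompact_Icc.exists_bound_of_continuousOn (s := Icc 0 T)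
      (f := fun t : ℝ => Complex.exp (-z * t)) (Continuous.continuousOn (by fun_prop))
    exact Integrable.bdd_mul (c := C) hg (Continuous.aestronglyMeasurable (by fun_prop))
      ((ae_restrict_iff' measurableSet_Ioo).mpr (Eventually.of_forall fun t ht =>
        hC t (Ioo_subset_Icc_self ht)))
  have h1 := integral_mul_primitive (T := T) hd (by fun_prop) hg
  have h2 : ∫ t in Ioo 0 T, z * Complex.exp (-z * t) = 1 - Complex.exp (-T * z) := by
    rw [← integral_Ioc_eq_integral_Ioo, ← intervalIntegral.integral_of_le hT.le,
      intervalIntegral.integral_eq_sub_of_hasDerivAt (fun t _ => hd t)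
        (Continuous.intervalIntegrable (by fun_prop) _ _)]
    simp only [Complex.ofReal_zero, mul_zero, Complex.exp_zero]
    ring_nf
  have h3 : ∫ s in Ioo 0 T, (-Complex.exp (-z * T) - -Complex.exp (-z * s)) * g s
      = laplace ((Ioo 0 T).indicator g) z - Complex.exp (-T * z) * ∫ s in Ioo 0 T, g s := by
    rw [laplace_indicator, ← integral_const_mul, ← integral_sub (hexp hg) (hg.const_mul _)]
    congr 1
    funext s
    ring_nf
  have h4 : z * laplace ((Ioo 0 T).indicator f) z = c * (1 - Complex.exp (-T * z))
      + (laplace ((Ioo 0 T).indicator g) z - Complex.exp (-T * z) * ∫ s in Ioo 0 T, g s) := by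
    rw [laplace_indicator, ← h2, ← h3, ← h1, ← integral_const_mul, ← integral_const_mul,
      ← integral_add]
    · refine integral_congr_ae (h.mono fun t ht => ?_)
      simp only [ht]
      ring
    · exact ((continuous_const.mul (by fun_prop : Continuous fun t : ℝ =>
        z * Complex.exp (-z * t))).integrableOn_Icc).mono_set Ioo_subset_Icc_self
    · have := (hexp (integrableOn_primitive hT hg)).const_mul z
      exact this.congr (Eventually.of_forall fun t => by simp only []; ring)
  rw [← mul_right_inj' hz, h4]
  field_simp
  ring

/-- Averaging c = f - ∫g over (0, T): the primitive is bounded by m, so T|c| ≤ m + Tm. This controls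
the initial value of f by integral norms. -/
lemma norm_const_le_of_ae_eq {T m : ℝ} (hT : 0 < T) {f g : ℝ → ℂ} {c : ℂ}
    (hf : IntegrableOn f (Ioo 0 T)) (hg : IntegrableOn g (Ioo 0 T))
    (h : ∀ᵐ t ∂(volume.restrict (Ioo 0 T)), f t = c + ∫ s in (0 : ℝ)..t, g s)
    (hfm : ∫ t in Ioo 0 T, ‖f t‖ ≤ m) (hgm : ∫ t in Ioo 0 T, ‖g t‖ ≤ m) :
    ‖c‖ ≤ (1 / T + 1) * m := by
  have h1 : ∫ _ in Ioo 0 T, ‖c‖ ≤ ∫ t in Ioo 0 T, (‖f t‖ + m) := by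
    refine integral_mono_ae (integrableOn_const (by simp))
      (hf.norm.add (integrableOn_const (by simp))) ?_
    filter_upwards [h, ae_restrict_mem measurableSet_Ioo] with t ht hmem
    have h2 := (norm_primitive_le hg hmem.1.le hmem.2.le).trans hgm
    have h3 : c = f t - ∫ s in (0 : ℝ)..t, g s := by rw [ht]; ring
    calc ‖c‖ = ‖f t - ∫ s in (0 : ℝ)..t, g s‖ := by rw [← h3]
      _ ≤ ‖f t‖ + ‖∫ s in (0 : ℝ)..t, g s‖ := norm_sub_le _ _
      _ ≤ ‖f t‖ + m := by linarith
  rw [integral_add hf.norm (integrableOn_const (by simp)), setIntegral_const, setIntegral_const,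
    Real.volume_real_Ioo_of_le hT.le, smul_eq_mul, smul_eq_mul, sub_zero] at h1
  have h4 : T * ‖c‖ ≤ T * ((1 / T + 1) * m) := by
    have : T * ((1 / T + 1) * m) = m + T * m := by field_simp
    rw [this]; linarith
  exact le_of_mul_le_mul_left h4 hT

/-- A chain of weak derivatives gives an expansion of the Laplace transform, up to a term which
is invisible before the time `T`. -/
lemma exists_symbol_laplace {T : ℝ} (hT : 0 < T) {v : ℕ → ℝ → ℂ}
    (hv : ∀ k, IntegrableOn (v k) (Ioo 0 T))
    (hw : ∀ k χ, IsTestOne T χ → ∫ t in Ioo 0 T, ((deriv χ t : ℝ) : ℂ) * v k t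
      = -∫ t in Ioo 0 T, (χ t : ℂ) * v (k + 1) t) (n : ℕ) :
    ∀ k, ∃ (X Y : ℂ → ℂ) (K : ℝ), 0 ≤ K ∧
      (∀ z ∈ halfPlane 1, laplace ((Ioo 0 T).indicator (v k)) z
        = X z - Complex.exp (-T * z) * Y z) ∧
      DifferentiableOn ℂ X (halfPlane 1) ∧ DifferentiableOn ℂ Y (halfPlane 1) ∧
      (∀ z ∈ halfPlane 1, ‖Y z‖ ≤ K) ∧
      ∀ m, (∀ i ≤ n, ∫ t in Ioo 0 T, ‖v (k + i) t‖ ≤ m) → IsSymbol n ((1 + n * (1 / T + 1)) * m) X := by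
  induction n with
  | zero =>
    intro k
    refine ⟨laplace ((Ioo 0 T).indicator (v k)), fun _ => 0, 0, le_rfl, fun z _ => by simp,
      differentiableOn_laplace_indicator (hv k), differentiableOn_const _, fun z _ => by simp,
      fun m hm z hz => ?_⟩
    refine (norm_laplace_indicator_le (hv k) (zero_le_one.trans (le_of_lt hz))).trans ?_
    simpa using hm 0 le_rfl
  | succ n ih =>
    intro k
    obtain ⟨X, Y, K, hK, h1, h2, h3, h4, h5⟩ := ih (k + 1)
    obtain ⟨c, hc⟩ := exists_ae_eq_const_add_primitive hT (hv k) (hv (k + 1)) (hw k)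
    set b : ℂ := c + ∫ s in Ioo 0 T, v (k + 1) s with hb
    have hz0 : ∀ z ∈ halfPlane 1, z ≠ 0 := fun z hz => ne_zero_of_mem_halfPlane hz
    -- Here c and b are the values of `v k` at 0 and at T. Integrating by parts once and inserting
    -- the splitting for `v (k + 1)`, all terms with e^{-Tz} go into Y. Each step adds (1/T + 1)m,
    -- the bound for c, to the constant.
    refine ⟨fun z => (c + X z) / z, fun z => (b + Y z) / z, ‖b‖ + K, by positivity,
      fun z hz => ?_, ?_, ?_, fun z hz => ?_, fun m hm => ?_⟩
    · rw [laplace_indicator_primitive hT (hv (k + 1)) hc (hz0 z hz), h1 z hz, ← hb]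
      ring
    · exact (h2.const_add c).div differentiableOn_id hz0
    · exact (h3.const_add b).div differentiableOn_id hz0
    · rw [norm_div]
      refine (div_le_self (norm_nonneg _) (one_lt_norm_of_mem hz).le).trans ?_
      exact (norm_add_le _ _).trans (add_le_add_right (h4 z hz) _)
    · have hcm : ‖c‖ ≤ (1 / T + 1) * m :=
        norm_const_le_of_ae_eq hT (hv k) (hv (k + 1)) hc (by simpa using hm 0 (by omega))
          (hm 1 (by omega))
      have hX := h5 m fun i hi => by
        have := hm (i + 1) (by omega)
        rwa [show k + (i + 1) = k + 1 + i by ring] at this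
      refine (((IsSymbol.const n hcm).add hX).div_self).mono (le_of_eq ?_)
      push_cast
      ring

/-! ### Fourier coefficients and weak derivatives -/

lemma measurableSet_cell : MeasurableSet cell := measurableSet_Ioc.prod measurableSet_Ioc

lemma volume_cell_lt_top : volume cell < ⊤ := by
  rw [cell, Measure.volume_eq_prod, Measure.prod_prod]
  simp [ENNReal.mul_lt_top_iff]

instance : IsFiniteMeasure (volume.restrict cell) := ⟨by simpa using volume_cell_lt_top⟩

lemma restrict_cell : (volume.restrict cell : Measure (ℝ × ℝ))
    = (volume.restrict (Ioc 0 (2 * Real.pi))).prod (volume.restrict (Ioc 0 (2 * Real.pi))) := by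
  rw [Measure.prod_restrict]; rfl

lemma restrict_prod_cell (s : Set ℝ) : (volume.restrict (s ×ˢ cell) : Measure (ℝ × ℝ × ℝ))
    = (volume.restrict s).prod (volume.restrict cell) := by
  rw [Measure.prod_restrict]; rfl

/-- The character of index `j`. -/
def torusChar (j : ℤ × ℤ) (y : ℝ × ℝ) : ℂ :=
  Complex.exp (Complex.I * ((j.1 : ℂ) * (y.1 : ℂ) + (j.2 : ℂ) * (y.2 : ℂ)))

lemma norm_torusChar (j : ℤ × ℤ) (y : ℝ × ℝ) : ‖torusChar j y‖ = 1 := by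
  have : Complex.I * ((j.1 : ℂ) * (y.1 : ℂ) + (j.2 : ℂ) * (y.2 : ℂ))
      = ((j.1 * y.1 + j.2 * y.2 : ℝ) : ℂ) * Complex.I := by push_cast; ring
  rw [torusChar, this, Complex.norm_exp_ofReal_mul_I]

lemma continuous_torusChar (j : ℤ × ℤ) : Continuous (torusChar j) := by
  unfold torusChar; fun_prop

lemma fourierCoef_eq (j : ℤ × ℤ) (f : ℝ × ℝ × ℝ → ℝ) (t : ℝ) :
    fourierCoef j f t = ((2 * Real.pi : ℝ) ^ 2 : ℂ)⁻¹ * ∫ y in cell, torusChar (-j) y * (f (t, y) : ℂ) := by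
  rw [fourierCoef]
  congr 2
  funext y
  rw [torusChar]
  congr 2
  simp only [Prod.fst_neg, Prod.snd_neg, Int.cast_neg]
  ring

lemma integrable_torusChar_mul {s : Set ℝ} {f : ℝ × ℝ × ℝ → ℝ} (j : ℤ × ℤ)
    (hf : IntegrableOn f (s ×ˢ cell)) :
    Integrable (fun p : ℝ × ℝ × ℝ => torusChar j p.2 * (f p : ℂ))
      ((volume.restrict s).prod (volume.restrict cell)) := by
  rw [IntegrableOn, restrict_prod_cell] at hf
  have := continuous_torusChar j
  refine Integrable.bdd_mul (c := 1) hf.ofReal (Continuous.aestronglyMeasurable (by fun_prop))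
    (Eventually.of_forall fun p => (norm_torusChar j p.2).le)

lemma integrableOn_fourierCoef {s : Set ℝ} {f : ℝ × ℝ × ℝ → ℝ} (j : ℤ × ℤ)
    (hf : IntegrableOn f (s ×ˢ cell)) : IntegrableOn (fourierCoef j f) s := by
  have := (integrable_torusChar_mul (-j) hf).integral_prod_left
  exact (this.const_mul (((2 * Real.pi : ℝ) ^ 2 : ℂ)⁻¹)).congr
    (Eventually.of_forall fun t => (fourierCoef_eq j f t).symm)

lemma integral_norm_fourierCoef_le {s : Set ℝ} {f : ℝ × ℝ × ℝ → ℝ} (j : ℤ × ℤ)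
    (hf : IntegrableOn f (s ×ˢ cell)) :
    ∫ t in s, ‖fourierCoef j f t‖ ≤ ∫ p in s ×ˢ cell, |f p| := by
  have hf' := hf
  rw [IntegrableOn, restrict_prod_cell] at hf'
  rw [restrict_prod_cell, integral_prod _ hf'.abs]
  refine integral_mono (integrableOn_fourierCoef j hf).norm hf'.abs.integral_prod_left fun t => ?_
  rw [fourierCoef_eq, norm_mul]
  have h1 : ‖((2 * Real.pi : ℝ) ^ 2 : ℂ)⁻¹‖ ≤ 1 := by
    rw [norm_inv, norm_pow, Complex.norm_real, Real.norm_of_nonneg (by positivity)]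
    refine inv_le_one_of_one_le₀ (one_le_pow₀ ?_)
    linarith [Real.pi_gt_three]
  refine (mul_le_of_le_one_left (norm_nonneg _) h1).trans ((norm_integral_le_integral_norm _).trans ?_)
  refine le_of_eq (integral_congr_ae (Eventually.of_forall fun y => ?_))
  simp [norm_torusChar]

lemma torusChar_add_fst (j : ℤ × ℤ) (y₁ y₂ : ℝ) :
    torusChar j (y₁ + 2 * Real.pi, y₂) = torusChar j (y₁, y₂) := by
  have h := Complex.exp_int_mul_two_pi_mul_I j.1
  unfold torusChar
  rw [show Complex.I * ((j.1 : ℂ) * ((y₁ + 2 * Real.pi : ℝ) : ℂ) + (j.2 : ℂ) * (y₂ : ℂ))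
    = Complex.I * ((j.1 : ℂ) * (y₁ : ℂ) + (j.2 : ℂ) * (y₂ : ℂ))
      + (j.1 : ℂ) * (2 * Real.pi * Complex.I) by push_cast; ring, Complex.exp_add, h, mul_one]

lemma torusChar_add_snd (j : ℤ × ℤ) (y₁ y₂ : ℝ) :
    torusChar j (y₁, y₂ + 2 * Real.pi) = torusChar j (y₁, y₂) := by
  have h := Complex.exp_int_mul_two_pi_mul_I j.2
  unfold torusChar
  rw [show Complex.I * ((j.1 : ℂ) * (y₁ : ℂ) + (j.2 : ℂ) * ((y₂ + 2 * Real.pi : ℝ) : ℂ))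
    = Complex.I * ((j.1 : ℂ) * (y₁ : ℂ) + (j.2 : ℂ) * (y₂ : ℂ))
      + (j.2 : ℂ) * (2 * Real.pi * Complex.I) by push_cast; ring, Complex.exp_add, h, mul_one]

lemma hasDerivAt_torusChar_fst (j : ℤ × ℤ) (y₁ y₂ : ℝ) :
    HasDerivAt (fun s => torusChar j (s, y₂)) (Complex.I * j.1 * torusChar j (y₁, y₂)) y₁ := by
  have h1 : HasDerivAt (fun s : ℝ => Complex.I * ((j.1 : ℂ) * (s : ℂ) + (j.2 : ℂ) * (y₂ : ℂ)))
      (Complex.I * j.1) y₁ := by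
    have := ((Complex.ofRealCLM.hasDerivAt (x := y₁)).const_mul (j.1 : ℂ)).add_const
      ((j.2 : ℂ) * (y₂ : ℂ)) |>.const_mul Complex.I
    simpa using this
  exact h1.cexp.congr_deriv (mul_comm _ _)

lemma hasDerivAt_torusChar_snd (j : ℤ × ℤ) (y₁ y₂ : ℝ) :
    HasDerivAt (fun s => torusChar j (y₁, s)) (Complex.I * j.2 * torusChar j (y₁, y₂)) y₂ := by
  have h1 : HasDerivAt (fun s : ℝ => Complex.I * ((j.1 : ℂ) * (y₁ : ℂ) + (j.2 : ℂ) * (s : ℂ)))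
      (Complex.I * j.2) y₂ := by
    have := ((Complex.ofRealCLM.hasDerivAt (x := y₂)).const_mul (j.2 : ℂ)).const_add
      ((j.1 : ℂ) * (y₁ : ℂ)) |>.const_mul Complex.I
    simpa using this
  exact h1.cexp.congr_deriv (mul_comm _ _)

/-- The test function `χ(t) Re (w e^{-i j·y})`. -/
def modeTest (j : ℤ × ℤ) (χ : ℝ → ℝ) (w : ℂ) (p : ℝ × ℝ × ℝ) : ℝ :=
  χ p.1 * (w * torusChar (-j) p.2).re

lemma hasDerivAt_re {f : ℝ → ℂ} {f' : ℂ} {x : ℝ} (h : HasDerivAt f f' x) :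
    HasDerivAt (fun s => (f s).re) f'.re x :=
  Complex.reCLM.hasFDerivAt.comp_hasDerivAt x h

lemma partialT_modeTest (j : ℤ × ℤ) (χ : ℝ → ℝ) (w : ℂ) :
    partialT (modeTest j χ w) = modeTest j (deriv χ) w := by
  funext p
  simp only [partialT, modeTest]
  exact deriv_mul_const_field _

lemma partialY₁_modeTest (j : ℤ × ℤ) (χ : ℝ → ℝ) (w : ℂ) :
    partialY₁ (modeTest j χ w) = modeTest j χ (-(Complex.I * j.1) * w) := by
  funext p
  simp only [partialY₁, modeTest]
  have := (hasDerivAt_re ((hasDerivAt_torusChar_fst (-j) p.2.1 p.2.2).const_mul w)).const_mul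
    (χ p.1)
  rw [this.deriv]
  congr 2
  simp only [Prod.fst_neg, Int.cast_neg]
  ring

lemma partialY₂_modeTest (j : ℤ × ℤ) (χ : ℝ → ℝ) (w : ℂ) :
    partialY₂ (modeTest j χ w) = modeTest j χ (-(Complex.I * j.2) * w) := by
  funext p
  simp only [partialY₂, modeTest]
  have := (hasDerivAt_re ((hasDerivAt_torusChar_snd (-j) p.2.1 p.2.2).const_mul w)).const_mul
    (χ p.1)
  rw [this.deriv]
  congr 2
  simp only [Prod.snd_neg, Int.cast_neg]
  ring

lemma mixedPartial_modeTest (k l m : ℕ) (j : ℤ × ℤ) (χ : ℝ → ℝ) (w : ℂ) :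
    mixedPartial k l m (modeTest j χ w) = modeTest j (iteratedDeriv k χ)
      ((-(Complex.I * j.1)) ^ l * ((-(Complex.I * j.2)) ^ m * w)) := by
  have h2 : ∀ m, partialY₂^[m] (modeTest j χ w) = modeTest j χ ((-(Complex.I * j.2)) ^ m * w) := by
    intro m
    induction m with
    | zero => simp
    | succ m ih => rw [Function.iterate_succ_apply', ih, partialY₂_modeTest, pow_succ']; ring_nf
  have h1 : ∀ l w, partialY₁^[l] (modeTest j χ w)
      = modeTest j χ ((-(Complex.I * j.1)) ^ l * w) := by
    intro l w
    induction l with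
    | zero => simp
    | succ l ih => rw [Function.iterate_succ_apply', ih, partialY₁_modeTest, pow_succ']; ring_nf
  have h0 : ∀ k w, partialT^[k] (modeTest j χ w) = modeTest j (iteratedDeriv k χ) w := by
    intro k w
    induction k with
    | zero => simp
    | succ k ih => rw [Function.iterate_succ_apply', ih, partialT_modeTest, iteratedDeriv_succ]
  rw [mixedPartial, h2, h1, h0]

lemma IsTestOne.isTest_modeTest {T : ℝ} {χ : ℝ → ℝ} (hχ : IsTestOne T χ) (j : ℤ × ℤ) (w : ℂ) :
    IsTest T (modeTest j χ w) := by
  obtain ⟨a, b, ha, hb, hs⟩ := hχ.support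
  refine ⟨?_, fun t _ y₁ y₂ => ?_, a, b, ha, hb, fun p hp => hs _ fun h => hp ?_⟩
  · have h1 : ContDiff ℝ ∞ fun p : ℝ × ℝ × ℝ => χ p.1 := hχ.smooth.comp contDiff_fst
    refine h1.mul (Complex.reCLM.contDiff.comp (contDiff_const.mul ?_))
    unfold torusChar
    refine ContDiff.cexp (contDiff_const.mul (ContDiff.add (contDiff_const.mul ?_)
      (contDiff_const.mul ?_)))
    · exact Complex.ofRealCLM.contDiff.comp (contDiff_fst.comp contDiff_snd)
    · exact Complex.ofRealCLM.contDiff.comp (contDiff_snd.comp contDiff_snd)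
  · simp only [modeTest, torusChar_add_fst, torusChar_add_snd, and_self]
  · simp [modeTest, h]

/-- Test functions are real, so a single one sees only the real part of a Fourier coefficient; the
free complex factor w recovers the whole coefficient. -/
lemma integral_mul_modeTest {T : ℝ} {χ : ℝ → ℝ} (hχ : IsTestOne T χ) (j : ℤ × ℤ) (w : ℂ)
    {f : ℝ × ℝ × ℝ → ℝ} (hf : IntegrableOn f (Ioo 0 T ×ˢ cell)) :
    ∫ p in Ioo 0 T ×ˢ cell, f p * modeTest j χ w p
      = (w * ((2 * Real.pi : ℝ) ^ 2 * ∫ t in Ioo 0 T, (χ t : ℂ) * fourierCoef j f t)).re := by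
  have h1 := integrable_torusChar_mul (-j) hf
  have hχc := hχ.continuous
  obtain ⟨C, hC⟩ := hχ.exists_bound
  have h2 : Integrable (fun p : ℝ × ℝ × ℝ => (χ p.1 : ℂ) * (torusChar (-j) p.2 * (f p : ℂ)))
      ((volume.restrict (Ioo 0 T)).prod (volume.restrict cell)) :=
    Integrable.bdd_mul (c := C) h1 (Continuous.aestronglyMeasurable (by fun_prop))
      (Eventually.of_forall fun p => hC p.1)
  have h3 : ∀ p, f p * modeTest j χ w p
      = (w * ((χ p.1 : ℂ) * (torusChar (-j) p.2 * (f p : ℂ)))).re := fun p => by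
    have : w * ((χ p.1 : ℂ) * (torusChar (-j) p.2 * (f p : ℂ)))
        = ((f p * χ p.1 : ℝ) : ℂ) * (w * torusChar (-j) p.2) := by push_cast; ring
    rw [this, Complex.re_ofReal_mul, modeTest]
    ring
  simp only [h3]
  rw [restrict_prod_cell]
  have h4 := integral_re (𝕜 := ℂ) (h2.const_mul w)
  simp only [RCLike.re_to_complex] at h4
  rw [h4, integral_const_mul, integral_prod _ h2, ← integral_const_mul ((2 * Real.pi : ℝ) ^ 2 : ℂ)]
  congr 3
  funext t
  simp only [fourierCoef_eq, integral_const_mul]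
  have hpi : ((2 * Real.pi : ℝ) ^ 2 : ℂ) ≠ 0 := by
    exact_mod_cast (by positivity : (2 * Real.pi) ^ 2 ≠ 0)
  rw [mul_left_comm ((2 * Real.pi : ℝ) ^ 2 : ℂ), ← mul_assoc ((2 * Real.pi : ℝ) ^ 2 : ℂ),
    mul_inv_cancel₀ hpi, one_mul]

/-- Weak derivatives and Fourier coefficients. -/
lemma IsWeakDeriv.fourierCoef {T : ℝ} {k l m : ℕ} {f g : ℝ × ℝ × ℝ → ℝ}
    (h : IsWeakDeriv T k l m f g) (hf : IntegrableOn f (Ioo 0 T ×ˢ cell))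
    (hg : IntegrableOn g (Ioo 0 T ×ˢ cell)) (j : ℤ × ℤ) {χ : ℝ → ℝ} (hχ : IsTestOne T χ) :
    (Complex.I * j.1) ^ l * (Complex.I * j.2) ^ m *
        ∫ t in Ioo 0 T, ((iteratedDeriv k χ t : ℝ) : ℂ) * PlasmaVacuum.fourierCoef j f t
      = (-1) ^ k * ∫ t in Ioo 0 T, (χ t : ℂ) * PlasmaVacuum.fourierCoef j g t := by
  set I₁ := ∫ t in Ioo 0 T, ((iteratedDeriv k χ t : ℝ) : ℂ) * PlasmaVacuum.fourierCoef j f t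
  set I₂ := ∫ t in Ioo 0 T, (χ t : ℂ) * PlasmaVacuum.fourierCoef j g t with hI₂
  have key : ∀ w : ℂ, (w * ((2 * Real.pi : ℝ) ^ 2 *
      ((-(Complex.I * j.1)) ^ l * (-(Complex.I * j.2)) ^ m * I₁))).re
      = (w * ((2 * Real.pi : ℝ) ^ 2 * ((-1) ^ (k + l + m) * I₂))).re := fun w => by
    have h1 := h _ (hχ.isTest_modeTest j w)
    rw [mixedPartial_modeTest, integral_mul_modeTest (hχ.iteratedDeriv k) j _ hf,
      integral_mul_modeTest hχ j w hg] at h1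
    have h2 : ((-1 : ℝ) ^ (k + l + m)) * (w * ((2 * Real.pi : ℝ) ^ 2 * I₂)).re
        = (w * ((2 * Real.pi : ℝ) ^ 2 * ((-1) ^ (k + l + m) * I₂))).re := by
      rw [← Complex.re_ofReal_mul]
      congr 1
      push_cast
      ring
    rw [← h2, hI₂, ← h1]
    congr 1
    ring
  have key2 : ∀ x y : ℂ, (∀ w : ℂ, (w * x).re = (w * y).re) → x = y := fun x y hxy => by
    have h1 := hxy 1
    have h2 := hxy (-Complex.I)
    simp at h1 h2
    exact Complex.ext h1 h2
  have h3 := key2 _ _ key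
  have hpi : ((2 * Real.pi : ℝ) ^ 2 : ℂ) ≠ 0 := by
    exact_mod_cast (by positivity : (2 * Real.pi) ^ 2 ≠ 0)
  have h4 := mul_left_cancel₀ hpi h3
  rw [neg_pow, neg_pow (Complex.I * (j.2 : ℂ)), pow_add, pow_add] at h4
  have h5 : ((-1 : ℂ) ^ l) * (-1) ^ l = 1 := by rw [← mul_pow]; simp
  have h6 : ((-1 : ℂ) ^ m) * (-1) ^ m = 1 := by rw [← mul_pow]; simp
  calc (Complex.I * j.1) ^ l * (Complex.I * j.2) ^ m * I₁
      = ((-1 : ℂ) ^ l * (-1) ^ l) * ((-1 : ℂ) ^ m * (-1) ^ m) *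
        ((Complex.I * j.1) ^ l * (Complex.I * j.2) ^ m * I₁) := by rw [h5, h6]; ring
    _ = ((-1 : ℂ) ^ l * (-1) ^ m) * ((-1) ^ l * (Complex.I * j.1) ^ l *
        ((-1) ^ m * (Complex.I * j.2) ^ m) * I₁) := by ring
    _ = ((-1 : ℂ) ^ l * (-1) ^ l) * ((-1 : ℂ) ^ m * (-1) ^ m) * ((-1) ^ k * I₂) := by
        rw [h4]; ring
    _ = _ := by rw [h5, h6]; ring

/-- Pure derivatives in y₁ and in y₂ give decay in j₁ and in j₂ separately; this combines them into
decay in |j|. -/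
lemma freqNorm_pow_le (p : ℕ) (j : ℤ × ℤ) :
    freqNorm j ^ p ≤ 2 ^ p * (|(j.1 : ℝ)| ^ p + |(j.2 : ℝ)| ^ p) := by
  have h1 : freqNorm j ≤ |(j.1 : ℝ)| + |(j.2 : ℝ)| := by
    rw [freqNorm, Real.sqrt_le_left (by positivity), add_sq, sq_abs, sq_abs]
    have : 0 ≤ 2 * |(j.1 : ℝ)| * |(j.2 : ℝ)| := by positivity
    linarith
  have h0 : 0 ≤ freqNorm j := Real.sqrt_nonneg _
  have h2 : freqNorm j ≤ 2 * max |(j.1 : ℝ)| |(j.2 : ℝ)| := by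
    linarith [le_max_left |(j.1 : ℝ)| |(j.2 : ℝ)|, le_max_right |(j.1 : ℝ)| |(j.2 : ℝ)|]
  calc freqNorm j ^ p ≤ (2 * max |(j.1 : ℝ)| |(j.2 : ℝ)|) ^ p := by gcongr
    _ = 2 ^ p * max |(j.1 : ℝ)| |(j.2 : ℝ)| ^ p := mul_pow _ _ _
    _ ≤ 2 ^ p * (|(j.1 : ℝ)| ^ p + |(j.2 : ℝ)| ^ p) := by
        gcongr
        rcases max_choice |(j.1 : ℝ)| |(j.2 : ℝ)| with h | h <;> rw [h]
        · linarith [pow_nonneg (abs_nonneg (j.2 : ℝ)) p]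
        · linarith [pow_nonneg (abs_nonneg (j.1 : ℝ)) p]

/-- The Fourier coefficients of an `H^∞` function and of its weak time derivatives: they form
chains of weak derivatives and decay rapidly in the frequency. -/
lemma MemHInfty.exists_coef_derivs {T : ℝ} {f : ℝ × ℝ × ℝ → ℝ} (hf : MemHInfty T f) :
    ∃ v : ℤ × ℤ → ℕ → ℝ → ℂ, (∀ j k, IntegrableOn (v j k) (Ioo 0 T)) ∧
      (∀ j k χ, IsTestOne T χ → ∫ t in Ioo 0 T, ((deriv χ t : ℝ) : ℂ) * v j k t
        = -∫ t in Ioo 0 T, (χ t : ℂ) * v j (k + 1) t) ∧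
      (∀ j, ∀ᵐ t ∂(volume.restrict (Ioo 0 T)), v j 0 t = fourierCoef j f t) ∧
      ∀ k p : ℕ, ∃ C, 0 ≤ C ∧ ∀ j, j ≠ 0 →
        ∫ t in Ioo 0 T, ‖v j k t‖ ≤ C / freqNorm j ^ p := by
  have hfin : IsFiniteMeasure (volume.restrict (Ioo 0 T ×ˢ cell) : Measure (ℝ × ℝ × ℝ)) := by
    rw [restrict_prod_cell]; infer_instance
  choose g hg hw using hf.weakDeriv
  have hfi : IntegrableOn f (Ioo 0 T ×ˢ cell) := hf.memL2.integrable one_le_two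
  have hgi : ∀ k l m, IntegrableOn (g k l m) (Ioo 0 T ×ˢ cell) := fun k l m =>
    (hg k l m).integrable one_le_two
  have hk : ∀ j k χ, IsTestOne T χ →
      ∫ t in Ioo 0 T, ((iteratedDeriv k χ t : ℝ) : ℂ) * fourierCoef j f t
        = (-1) ^ k * ∫ t in Ioo 0 T, (χ t : ℂ) * fourierCoef j (g k 0 0) t := fun j k χ hχ => by
    simpa using (hw k 0 0).fourierCoef hfi (hgi k 0 0) j hχ
  have hvi : ∀ j k l m, IntegrableOn (fourierCoef j (g k l m)) (Ioo 0 T) := fun j k l m =>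
    integrableOn_fourierCoef j (hgi k l m)
  -- At order zero the chosen weak derivative `g 0 0 0` need not be f itself, so the coefficients of
  -- f are recovered only almost everywhere.
  refine ⟨fun j k => fourierCoef j (g k 0 0), fun j k => hvi j k 0 0, fun j k χ hχ => ?_,
    fun j => ?_, fun k p => ?_⟩
  · have h1 := hk j k (deriv χ) hχ.deriv
    have h2 := hk j (k + 1) χ hχ
    rw [← iteratedDeriv_succ'] at h1
    rw [h1, pow_succ] at h2
    have h3 : ((-1 : ℂ) ^ k) ≠ 0 := pow_ne_zero k (by norm_num)
    rw [mul_assoc] at h2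
    have := mul_left_cancel₀ h3 h2
    rw [this]; ring
  · have := ae_eq_zero_of_forall_test (f := fun t => fourierCoef j (g 0 0 0) t - fourierCoef j f t)
      ((hvi j 0 0 0).sub (integrableOn_fourierCoef j hfi)) fun χ hχ => by
        simp only [mul_sub]
        rw [integral_sub (hχ.integrable_mul (hvi j 0 0 0))
          (hχ.integrable_mul (integrableOn_fourierCoef j hfi))]
        have := hk j 0 χ hχ
        simp only [iteratedDeriv_zero, pow_zero, one_mul] at this
        rw [this, sub_self]
    exact this.mono fun t ht => sub_eq_zero.mp ht
  -- Tangential weak derivatives act on coefficients as multiplication by powers of ij₁ and ij₂; the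
  -- integrability of these derivatives is what yields the rapid decay.
  · have hae : ∀ (j : ℤ × ℤ) (l m : ℕ), ∀ᵐ t ∂(volume.restrict (Ioo 0 T)),
        (Complex.I * j.1) ^ l * (Complex.I * j.2) ^ m * fourierCoef j (g k 0 0) t
          = fourierCoef j (g k l m) t := fun j l m => by
      have := ae_eq_zero_of_forall_test (f := fun t => (Complex.I * j.1) ^ l *
          (Complex.I * j.2) ^ m * fourierCoef j (g k 0 0) t - fourierCoef j (g k l m) t)
        (((hvi j k 0 0).const_mul _).sub (hvi j k l m)) fun χ hχ => by
          simp only [mul_sub]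
          rw [integral_sub (hχ.integrable_mul ((hvi j k 0 0).const_mul _))
            (hχ.integrable_mul (hvi j k l m))]
          have h1 := hk j k χ hχ
          have h2 := (hw k l m).fourierCoef hfi (hgi k l m) j hχ
          rw [h1, mul_left_comm] at h2
          have h3 := mul_left_cancel₀ (pow_ne_zero k (by norm_num : (-1 : ℂ) ≠ 0)) h2
          rw [← h3, ← integral_const_mul, sub_eq_zero]
          congr 1
          funext t
          ring
      exact this.mono fun t ht => sub_eq_zero.mp ht
    have hbd : ∀ (j : ℤ × ℤ) (l m : ℕ), |(j.1 : ℝ)| ^ l * |(j.2 : ℝ)| ^ m *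
        ∫ t in Ioo 0 T, ‖fourierCoef j (g k 0 0) t‖ ≤ ∫ q in Ioo 0 T ×ˢ cell, |g k l m q| :=
      fun j l m => by
        refine le_trans (le_of_eq ?_) (integral_norm_fourierCoef_le j (hgi k l m))
        rw [← integral_const_mul]
        refine integral_congr_ae ((hae j l m).mono fun t ht => ?_)
        simp only [← ht, norm_mul, norm_pow, Complex.norm_I, one_mul]
        rw [← Complex.ofReal_intCast, ← Complex.ofReal_intCast, Complex.norm_real,
          Complex.norm_real, Real.norm_eq_abs, Real.norm_eq_abs]
    refine ⟨2 ^ p * ((∫ q in Ioo 0 T ×ˢ cell, |g k p 0 q|) + ∫ q in Ioo 0 T ×ˢ cell, |g k 0 p q|),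
      by positivity, fun j hj => ?_⟩
    have hr := one_le_freqNorm hj
    rw [le_div_iff₀ (by positivity)]
    have h1 := hbd j p 0
    have h2 := hbd j 0 p
    simp only [pow_zero, mul_one, one_mul] at h1 h2
    have h3 : 0 ≤ ∫ t in Ioo 0 T, ‖fourierCoef j (g k 0 0) t‖ :=
      integral_nonneg fun _ => norm_nonneg _
    calc (∫ t in Ioo 0 T, ‖fourierCoef j (g k 0 0) t‖) * freqNorm j ^ p
        ≤ (∫ t in Ioo 0 T, ‖fourierCoef j (g k 0 0) t‖) *
          (2 ^ p * (|(j.1 : ℝ)| ^ p + |(j.2 : ℝ)| ^ p)) := by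
            gcongr; exact freqNorm_pow_le p j
      _ = 2 ^ p * (|(j.1 : ℝ)| ^ p * (∫ t in Ioo 0 T, ‖fourierCoef j (g k 0 0) t‖)
          + |(j.2 : ℝ)| ^ p * ∫ t in Ioo 0 T, ‖fourierCoef j (g k 0 0) t‖) := by ring
      _ ≤ _ := by gcongr

/-! ### Construction and regularity of the solution modes -/

lemma differentiableOn_lopatinskii (S : RefState) {ν : ℝ} (hν : 0 < ν) {j : ℤ × ℤ} (hj : j ≠ 0) :
    DifferentiableOn ℂ (fun z => lopatinskii S ν z j) (halfPlane 1) := by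
  intro z hz
  have h1 := mem_slitPlane_of_re_pos hν (zero_lt_one.trans_le (one_le_freqNorm hj))
    (z := z) (zero_lt_one.trans hz)
  refine DifferentiableAt.differentiableWithinAt ?_
  unfold lopatinskii
  refine DifferentiableAt.add (DifferentiableAt.mul ?_ (by fun_prop)) (by fun_prop)
  exact DifferentiableAt.cpow (by fun_prop) (by fun_prop) h1

/-- The Fourier modes of the solution. -/
lemma exists_modes {S : RefState} {ν C₀ T : ℝ} (hν : 0 < ν) (hC₀ : 0 < C₀)
    (hC : ∀ j : ℤ × ℤ, j ≠ 0 → ∀ z : ℂ, 1 ≤ z.re →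
      ‖z‖ ^ 3 ≤ C₀ * freqNorm j * ‖lopatinskii S ν z j‖) (hT : 0 < T)
    {v : ℤ × ℤ → ℕ → ℝ → ℂ} (hv : ∀ j k, IntegrableOn (v j k) (Ioo 0 T))
    (hw : ∀ j k χ, IsTestOne T χ → ∫ t in Ioo 0 T, ((deriv χ t : ℝ) : ℂ) * v j k t
        = -∫ t in Ioo 0 T, (χ t : ℂ) * v j (k + 1) t)
    (hb : ∀ k p : ℕ, ∃ C, 0 ≤ C ∧ ∀ j, j ≠ 0 →
        ∫ t in Ioo 0 T, ‖v j k t‖ ≤ C / freqNorm j ^ p) :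
    ∃ φ φ' : ℤ × ℤ → ℝ → ℂ, φ 0 = 0 ∧ φ' 0 = 0 ∧
      (∀ j t, HasDerivAt (φ j) (φ' j t) t) ∧ (∀ j, φ j 0 = 0) ∧ (∀ j, φ' j 0 = 0) ∧
      (∀ p : ℕ, ∃ C, 0 ≤ C ∧ ∀ j, j ≠ 0 → ∀ t, ‖φ j t‖ ≤ C / freqNorm j ^ p * Real.exp (2 * t) ∧
        ‖φ' j t‖ ≤ C / freqNorm j ^ p * Real.exp (2 * t)) ∧
      (∀ j, j ≠ 0 → ∀ z ∈ halfPlane 1, lopatinskii S ν z j * laplace (φ j) z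
        = laplace ((Ioo 0 T).indicator (v j 0)) z) ∧
      (∀ k j, ∀ t ∈ Ioo 0 T, HasDerivAt (iteratedDeriv k (φ j)) (iteratedDeriv (k + 1) (φ j) t) t) ∧
      ∀ k p : ℕ, ∃ C, 0 ≤ C ∧ ∀ j, j ≠ 0 → ∀ t ∈ Ioo 0 T,
        ‖iteratedDeriv k (φ j) t‖ ≤ C / freqNorm j ^ p := by
  set L : ℤ × ℤ → ℂ → ℂ := fun j => laplace ((Ioo 0 T).indicator (v j 0)) with hL
  set D : ℤ × ℤ → ℂ → ℂ := fun j z => z ^ 3 / lopatinskii S ν z j with hD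
  have hz0 : ∀ z ∈ halfPlane 1, z ≠ 0 := fun z hz => ne_zero_of_mem_halfPlane hz
  have hlop : ∀ j, j ≠ 0 → ∀ z ∈ halfPlane 1, lopatinskii S ν z j ≠ 0 := fun j hj z hz =>
    lopatinskii_ne_zero (le_of_lt hz) (hC j hj z (le_of_lt hz))
  have hDn : ∀ j, j ≠ 0 → ∀ z ∈ halfPlane 1, ‖D j z‖ ≤ C₀ * freqNorm j := fun j hj z hz => by
    rw [hD]
    simp only [norm_div, norm_pow]
    rw [div_le_iff₀ (norm_pos_iff.mpr (hlop j hj z hz))]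
    exact hC j hj z (le_of_lt hz)
  have hDd : ∀ j, j ≠ 0 → DifferentiableOn ℂ (D j) (halfPlane 1) := fun j hj =>
    DifferentiableOn.div (by fun_prop) (differentiableOn_lopatinskii S hν hj) (hlop j hj)
  have hLd : ∀ j, DifferentiableOn ℂ (L j) (halfPlane 1) := fun j =>
    differentiableOn_laplace_indicator (hv j 0)
  set N : ℤ × ℤ → ℝ := fun j => ∫ t in Ioo 0 T, ‖v j 0 t‖ with hN
  have hN0 : ∀ j, 0 ≤ N j := fun j => integral_nonneg fun _ => norm_nonneg _
  have hLn : ∀ j, ∀ z ∈ halfPlane 1, ‖L j z‖ ≤ N j := fun j z hz =>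
    norm_laplace_indicator_le (hv j 0) (zero_le_one.trans (le_of_lt hz))
  -- With D = z³/Δ one has G = zL/Δ and, below, F = G/z = L/Δ. Both decay quadratically, so the
  -- inverse transforms of F and G are a mode and its time derivative, and both vanish at t = 0.
  set G : ℤ × ℤ → ℂ → ℂ := fun j z => L j z * D j z / z ^ 2 with hG
  set K : ℤ × ℤ → ℝ := fun j => N j * (C₀ * freqNorm j) with hK
  have hr0 : ∀ j : ℤ × ℤ, 0 ≤ freqNorm j := fun j => Real.sqrt_nonneg _
  have hK0 : ∀ j, 0 ≤ K j := fun j => mul_nonneg (hN0 j) (mul_nonneg hC₀.le (hr0 j))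
  have hGn : ∀ j, j ≠ 0 → ∀ z ∈ halfPlane 1, ‖G j z‖ ≤ K j / ‖z‖ ^ 2 := fun j hj z hz => by
    rw [hG]
    simp only [norm_div, norm_mul, norm_pow]
    gcongr
    exact mul_le_mul (hLn j z hz) (hDn j hj z hz) (norm_nonneg _) (hN0 j)
  have hGd : ∀ j, j ≠ 0 → DifferentiableOn ℂ (G j) (halfPlane 1) := fun j hj =>
    ((hLd j).mul (hDd j hj)).div (by fun_prop) fun z hz => pow_ne_zero 2 (hz0 z hz)
  set F : ℤ × ℤ → ℂ → ℂ := fun j z => G j z / z with hF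
  have hFn : ∀ j, j ≠ 0 → ∀ z ∈ halfPlane 1, ‖F j z‖ ≤ K j / ‖z‖ ^ 2 := fun j hj z hz => by
    rw [hF]
    simp only [norm_div]
    exact (div_le_self (norm_nonneg _) (one_lt_norm_of_mem hz).le).trans (hGn j hj z hz)
  have hFd : ∀ j, j ≠ 0 → DifferentiableOn ℂ (F j) (halfPlane 1) := fun j hj =>
    (hGd j hj).div differentiableOn_id hz0
  have hline : ∀ {H : ℂ → ℂ} {M : ℝ}, (∀ z ∈ halfPlane 1, ‖H z‖ ≤ M / ‖z‖ ^ 2) →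
      ∀ τ, ‖H (vline 2 τ)‖ ≤ M / ‖vline 2 τ‖ ^ 2 := fun h τ =>
    h _ (vline_mem_halfPlane one_lt_two τ)
  classical
  set φ : ℤ × ℤ → ℝ → ℂ := fun j => if j = 0 then 0 else invLaplace 2 (F j) with hφ
  set φ' : ℤ × ℤ → ℝ → ℂ := fun j => if j = 0 then 0 else invLaplace 2 (G j) with hφ'
  have hφ0 : φ 0 = 0 := by simp [hφ]
  have hφ'0 : φ' 0 = 0 := by simp [hφ']
  have hφj : ∀ {j}, j ≠ 0 → φ j = invLaplace 2 (F j) := fun hj => by simp [hφ, hj]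
  have hφ'j : ∀ {j}, j ≠ 0 → φ' j = invLaplace 2 (G j) := fun hj => by simp [hφ', hj]
  have hzero : ∀ {H : ℂ → ℂ} {M : ℝ}, 0 ≤ M → DifferentiableOn ℂ H (halfPlane 1) →
      (∀ z ∈ halfPlane 1, ‖H z‖ ≤ M / ‖z‖ ^ 2) → invLaplace 2 H 0 = 0 := fun hM hd hn =>
    invLaplace_eq_zero zero_le_one hd hM (T := 0) (fun z hz => by simpa using hn z hz)
      one_lt_two le_rfl
  refine ⟨φ, φ', hφ0, hφ'0, fun j t => ?_, fun j => ?_, fun j => ?_, fun p => ?_,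
    fun j hj z hz => ?_, ?_⟩
  · by_cases hj : j = 0
    · rw [hj, hφ0, hφ'0]; exact hasDerivAt_const t 0
    · rw [hφj hj, hφ'j hj]
      exact hasDerivAt_invLaplace two_pos (continuous_comp_vline (hGd j hj) one_lt_two)
        (hline (hGn j hj)) t
  · by_cases hj : j = 0
    · rw [hj, hφ0]; rfl
    · rw [hφj hj]
      exact hzero (hK0 j) (hFd j hj) (hFn j hj)
  · by_cases hj : j = 0
    · rw [hj, hφ'0]; rfl
    · rw [hφ'j hj]
      exact hzero (hK0 j) (hGd j hj) (hGn j hj)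
  -- One power of |j| is lost to the bound C₀|j| for D.
  · obtain ⟨C, hC', hC''⟩ := hb 0 (p + 1)
    refine ⟨C * C₀, by positivity, fun j hj t => ?_⟩
    have hr := one_le_freqNorm hj
    have hKj : K j / 2 ≤ C * C₀ / freqNorm j ^ p := by
      have h1 : K j ≤ C / freqNorm j ^ (p + 1) * (C₀ * freqNorm j) := by
        rw [hK]
        exact mul_le_mul_of_nonneg_right (hC'' j hj) (by positivity)
      have h2 : C / freqNorm j ^ (p + 1) * (C₀ * freqNorm j) = C * C₀ / freqNorm j ^ p := by
        rw [pow_succ]; field_simp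
      linarith [hK0 j]
    have hfin : ∀ {H : ℂ → ℂ}, (∀ z ∈ halfPlane 1, ‖H z‖ ≤ K j / ‖z‖ ^ 2) →
        ‖invLaplace 2 H t‖ ≤ C * C₀ / freqNorm j ^ p * Real.exp (2 * t) := fun hn => by
      refine (norm_invLaplace_le two_pos (hline hn) t).trans ?_
      rw [mul_div_assoc, mul_comm]
      gcongr
    rw [hφj hj, hφ'j hj]
    exact ⟨hfin (hFn j hj), hfin (hGn j hj)⟩
  · rw [hφj hj, laplace_invLaplace zero_le_one (hFd j hj) (hK0 j) (hFn j hj) one_lt_two hz]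
    have h1 := hlop j hj z hz
    have h2 := hz0 z hz
    simp only [hF, hG, hD, hL]
    field_simp
  · have hreg : ∀ n p : ℕ, ∃ C, 0 ≤ C ∧ ∀ j, j ≠ 0 →
        (∀ k < n, ∀ t ∈ Ioo 0 T,
          HasDerivAt (iteratedDeriv k (φ j)) (iteratedDeriv (k + 1) (φ j) t) t) ∧
        ∀ k ≤ n, ∀ t ∈ Ioo 0 T, ‖iteratedDeriv k (φ j) t‖ ≤ C / freqNorm j ^ p := fun n p => by
      -- The transform L itself need not have a long expansion, because of the cut at T. Only X
      -- does, and X is all that matters before T.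
      choose X Y B hB h1 h2 h3 h4 h5 using fun j =>
        exists_symbol_laplace hT (hv j) (hw j) n 0
      have hXr : RapidFamily n X := fun q => by
        choose c hc hc' using fun i => hb i q
        refine ⟨(1 + n * (1 / T + 1)) * ∑ i ∈ Finset.range (n + 1), c i, ?_, fun j hj => ?_⟩
        · have := Finset.sum_nonneg fun i (_ : i ∈ Finset.range (n + 1)) => hc i
          positivity
        · have hr := one_le_freqNorm hj
          refine (h5 j ((∑ i ∈ Finset.range (n + 1), c i) / freqNorm j ^ q) fun i hi => ?_).mono
            (le_of_eq (by ring))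
          rw [zero_add]
          refine (hc' i j hj).trans ?_
          gcongr
          exact Finset.single_le_sum (fun i _ => hc i) (Finset.mem_range.mpr (by omega))
      obtain ⟨C, hC1, hC2⟩ := (polyFamily_div_lopatinskii hν hC n).mul_rapid hXr p
      refine ⟨2 * C * Real.exp (2 * T), by positivity, fun j hj => ?_⟩
      have hr := one_le_freqNorm hj
      -- The mode corresponds to DX/z³; one factor 1/z goes into the symbol, leaving the
      -- normalization by z² that the regularity lemma expects.
      have hsym := (hC2 j hj).div_self.of_succ
      have hDc := continuous_comp_vline (hDd j hj) one_lt_two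
      have hXc := continuous_comp_vline (h2 j) one_lt_two
      have hvc := continuous_vline 2
      have hv0 := vline_ne_zero two_pos
      have hP := hC2 j hj
      have hPd : DifferentiableOn ℂ (fun z => D j z * X j z / z / z ^ 2) (halfPlane 1) :=
        ((((hDd j hj).mul (h2 j)).div differentiableOn_id hz0).div (by fun_prop)
          fun z hz => pow_ne_zero 2 (hz0 z hz))
      have hQd : DifferentiableOn ℂ (fun z => Complex.exp (-T * z) * (Y j z * D j z / z / z ^ 2))
          (halfPlane 1) :=
        DifferentiableOn.mul (by fun_prop) ((((h3 j).mul (hDd j hj)).div differentiableOn_id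
          hz0).div (by fun_prop) fun z hz => pow_ne_zero 2 (hz0 z hz))
      have hQn : ∀ z ∈ halfPlane 1, ‖Complex.exp (-T * z) * (Y j z * D j z / z / z ^ 2)‖
          ≤ B j * (C₀ * freqNorm j) * Real.exp (-T * z.re) / ‖z‖ ^ 2 := fun z hz => by
        rw [norm_mul, Complex.norm_exp, ← Complex.ofReal_neg, Complex.re_ofReal_mul, norm_div,
          norm_pow, mul_comm, div_mul_eq_mul_div]
        gcongr
        rw [norm_div, norm_mul]
        refine (div_le_self (by positivity) (one_lt_norm_of_mem hz).le).trans ?_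
        exact mul_le_mul (h4 j z hz) (hDn j hj z hz) (norm_nonneg _) (hB j)
      have hf : ∀ t ∈ Ioo 0 T, φ j t = invLaplace 2 (fun z => D j z * X j z / z / z ^ 2) t :=
        fun t ht => by
          have hK' : 0 ≤ B j * (C₀ * freqNorm j) := mul_nonneg (hB j) (by positivity)
          -- The part with e^{-Tz} vanishes for t ≤ T by causality.
          have hQ0 := invLaplace_eq_zero zero_le_one hQd hK' hQn one_lt_two ht.2.le
          have hQ1 := hFn j hj
          have hFeq : ∀ τ, D j (vline 2 τ) * X j (vline 2 τ) / vline 2 τ / vline 2 τ ^ 2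
              = F j (vline 2 τ) + Complex.exp (-T * vline 2 τ)
                * (Y j (vline 2 τ) * D j (vline 2 τ) / vline 2 τ / vline 2 τ ^ 2) := fun τ => by
            have h6 := h1 j _ (vline_mem_halfPlane one_lt_two τ)
            simp only [hF, hG, hL]
            rw [h6]
            have := hv0 τ
            field_simp
            ring
          rw [invLaplace_congr (G := fun z => F j z + Complex.exp (-T * z)
            * (Y j z * D j z / z / z ^ 2)) hFeq, invLaplace_add, hQ0, add_zero, hφj hj]
          · exact integrable_invLaplace two_pos (continuous_comp_vline (hFd j hj) one_lt_two)
              (hline (hFn j hj)) t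
          · refine integrable_invLaplace (M := B j * (C₀ * freqNorm j))
              (F := fun z => Complex.exp (-T * z) * (Y j z * D j z / z / z ^ 2)) two_pos
              (continuous_comp_vline hQd one_lt_two) (hline fun z hz => (hQn z hz).trans ?_) t
            refine div_le_div_of_nonneg_right (mul_le_of_le_one_right hK' ?_) (by positivity)
            rw [Real.exp_le_one_iff, neg_mul, neg_nonpos]
            exact mul_nonneg hT.le (zero_le_one.trans (le_of_lt hz))
      obtain ⟨a1, a2⟩ := hsym.iteratedDeriv_bound ((hDc.mul hXc).div hvc hv0) hf
      refine ⟨a1, fun k hk t ht => (a2 k hk t ht).trans (le_of_eq ?_)⟩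
      ring
    refine ⟨fun k j t ht => ?_, fun k p => ?_⟩
    · by_cases hj : j = 0
      · have hc : ∀ k, iteratedDeriv k (φ 0) = fun _ => 0 := fun k => by
          rw [hφ0]
          induction k with
          | zero => simp; rfl
          | succ k ih => rw [iteratedDeriv_succ, ih]; simp
        rw [hj, hc, hc]
        exact hasDerivAt_const t 0
      · obtain ⟨C, -, h⟩ := hreg (k + 1) 0
        exact (h j hj).1 k (by omega) t ht
    · obtain ⟨C, hC1, h⟩ := hreg k p
      exact ⟨C, hC1, fun j hj => (h j hj).2 k le_rfl⟩

/-! ### Integration by parts on `(0, T) × 𝕋²` -/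

namespace IsTest

variable {T : ℝ} {ψ : ℝ × ℝ × ℝ → ℝ}

lemma hasDerivAt_partialT (h : IsTest T ψ) (t y₁ y₂ : ℝ) :
    HasDerivAt (fun s => ψ (s, y₁, y₂)) (partialT ψ (t, y₁, y₂)) t := by
  have hd : Differentiable ℝ fun s => ψ (s, y₁, y₂) :=
    (h.smooth.differentiable (by simp)).comp (by fun_prop)
  exact (hd t).hasDerivAt

lemma hasDerivAt_partialY₁ (h : IsTest T ψ) (t y₁ y₂ : ℝ) :
    HasDerivAt (fun s => ψ (t, s, y₂)) (partialY₁ ψ (t, y₁, y₂)) y₁ := by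
  have hd : Differentiable ℝ fun s => ψ (t, s, y₂) :=
    (h.smooth.differentiable (by simp)).comp (by fun_prop)
  exact (hd y₁).hasDerivAt

lemma hasDerivAt_partialY₂ (h : IsTest T ψ) (t y₁ y₂ : ℝ) :
    HasDerivAt (fun s => ψ (t, y₁, s)) (partialY₂ ψ (t, y₁, y₂)) y₂ := by
  have hd : Differentiable ℝ fun s => ψ (t, y₁, s) :=
    (h.smooth.differentiable (by simp)).comp (by fun_prop)
  exact (hd y₂).hasDerivAt

lemma contDiff_fderiv_apply (h : IsTest T ψ) (w : ℝ × ℝ × ℝ) :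
    ContDiff ℝ ∞ fun p => fderiv ℝ ψ p w :=
  (h.smooth.fderiv_right (m := ∞) (by simp)).clm_apply contDiff_const

lemma partialT_eq (h : IsTest T ψ) : partialT ψ = fun p => fderiv ℝ ψ p (1, 0, 0) := by
  funext p
  have h1 : HasDerivAt (fun s : ℝ => ((s, p.2.1, p.2.2) : ℝ × ℝ × ℝ)) (1, 0, 0) p.1 :=
    (hasDerivAt_id _).prodMk ((hasDerivAt_const _ _).prodMk (hasDerivAt_const _ _))
  exact (((h.smooth.differentiable (by simp)) p).hasFDerivAt.comp_hasDerivAt p.1 h1).deriv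

lemma partialY₁_eq (h : IsTest T ψ) : partialY₁ ψ = fun p => fderiv ℝ ψ p (0, 1, 0) := by
  funext p
  have h1 : HasDerivAt (fun s : ℝ => ((p.1, s, p.2.2) : ℝ × ℝ × ℝ)) (0, 1, 0) p.2.1 :=
    (hasDerivAt_const _ _).prodMk ((hasDerivAt_id _).prodMk (hasDerivAt_const _ _))
  exact (((h.smooth.differentiable (by simp)) p).hasFDerivAt.comp_hasDerivAt p.2.1 h1).deriv

lemma partialY₂_eq (h : IsTest T ψ) : partialY₂ ψ = fun p => fderiv ℝ ψ p (0, 0, 1) := by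
  funext p
  have h1 : HasDerivAt (fun s : ℝ => ((p.1, p.2.1, s) : ℝ × ℝ × ℝ)) (0, 0, 1) p.2.2 :=
    (hasDerivAt_const _ _).prodMk ((hasDerivAt_const _ _).prodMk (hasDerivAt_id _))
  exact (((h.smooth.differentiable (by simp)) p).hasFDerivAt.comp_hasDerivAt p.2.2 h1).deriv

lemma fst_mem (h : IsTest T ψ) : ∃ a b : ℝ, 0 < a ∧ b < T ∧
    ∀ t ∉ Icc a b, ∀ y, ψ (t, y) = 0 := by
  obtain ⟨a, b, ha, hb, hs⟩ := h.support
  exact ⟨a, b, ha, hb, fun t ht y => by_contra fun hy => ht (hs _ hy)⟩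

lemma partialT (h : IsTest T ψ) : IsTest T (partialT ψ) := by
  refine ⟨by rw [h.partialT_eq]; exact h.contDiff_fderiv_apply _, fun t _ y₁ y₂ => ?_, ?_⟩
  · simp only [PlasmaVacuum.partialT, fun s => (h.periodic s (mem_univ s) y₁ y₂).1,
      fun s => (h.periodic s (mem_univ s) y₁ y₂).2, and_self]
  · obtain ⟨a, b, ha, hb, hs⟩ := h.fst_mem
    refine ⟨a, b, ha, hb, fun p hp => by_contra fun hm => hp ?_⟩
    have h1 : (fun s => ψ (s, p.2.1, p.2.2)) =ᶠ[𝓝 p.1] fun _ => 0 := by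
      filter_upwards [isClosed_Icc.isOpen_compl.mem_nhds hm] with s h2
      exact hs s h2 _
    exact h1.deriv_eq.trans (deriv_const _ _)

lemma partialY₁ (h : IsTest T ψ) : IsTest T (partialY₁ ψ) := by
  refine ⟨by rw [h.partialY₁_eq]; exact h.contDiff_fderiv_apply _, fun t _ y₁ y₂ => ?_, ?_⟩
  · have h1 := deriv_comp_add_const (fun s => ψ (t, s, y₂)) (2 * Real.pi) y₁
    simp only [fun s => (h.periodic t (mem_univ t) s y₂).1] at h1
    simp only [PlasmaVacuum.partialY₁, fun s => (h.periodic t (mem_univ t) s y₂).2, and_true, h1]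
  · obtain ⟨a, b, ha, hb, hs⟩ := h.fst_mem
    refine ⟨a, b, ha, hb, fun p hp => by_contra fun hm => hp ?_⟩
    simp [PlasmaVacuum.partialY₁, hs p.1 hm]

lemma partialY₂ (h : IsTest T ψ) : IsTest T (partialY₂ ψ) := by
  refine ⟨by rw [h.partialY₂_eq]; exact h.contDiff_fderiv_apply _, fun t _ y₁ y₂ => ?_, ?_⟩
  · have h1 := deriv_comp_add_const (fun s => ψ (t, y₁, s)) (2 * Real.pi) y₂
    simp only [fun s => (h.periodic t (mem_univ t) y₁ s).2] at h1
    simp only [PlasmaVacuum.partialY₂, fun s => (h.periodic t (mem_univ t) y₁ s).1, true_and, h1]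
  · obtain ⟨a, b, ha, hb, hs⟩ := h.fst_mem
    refine ⟨a, b, ha, hb, fun p hp => by_contra fun hm => hp ?_⟩
    simp [PlasmaVacuum.partialY₂, hs p.1 hm]

lemma exists_bound (h : IsTest T ψ) : ∃ C, ∀ p ∈ Ioo 0 T ×ˢ cell, ‖ψ p‖ ≤ C := by
  have hK : IsCompact (Icc 0 T ×ˢ (Icc 0 (2 * Real.pi) ×ˢ Icc 0 (2 * Real.pi))) :=
    isCompact_Icc.prod (isCompact_Icc.prod isCompact_Icc)
  obtain ⟨C, hC⟩ := hK.exists_bound_of_continuousOn h.smooth.continuous.continuousOn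
  exact ⟨C, fun p hp => hC p ⟨Ioo_subset_Icc_self hp.1, Ioc_subset_Icc_self hp.2.1,
    Ioc_subset_Icc_self hp.2.2⟩⟩

lemma integrableOn_mul (h : IsTest T ψ) {f : ℝ × ℝ × ℝ → ℝ}
    (hf : IntegrableOn f (Ioo 0 T ×ˢ cell)) :
    IntegrableOn (fun p => f p * ψ p) (Ioo 0 T ×ˢ cell) := by
  obtain ⟨C, hC⟩ := h.exists_bound
  exact Integrable.mul_bdd (c := C) hf h.smooth.continuous.aestronglyMeasurable
    ((ae_restrict_iff' (measurableSet_Ioo.prod measurableSet_cell)).mpr (Eventually.of_forall hC))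

end IsTest

lemma integral_Ioc_deriv_periodic {F G : ℝ → ℝ} (hF : ∀ s, HasDerivAt F (G s) s)
    (hp : F (2 * Real.pi) = F 0) (hG : IntegrableOn G (Ioc 0 (2 * Real.pi))) :
    ∫ s in Ioc 0 (2 * Real.pi), G s = 0 := by
  rw [← intervalIntegral.integral_of_le Real.two_pi_pos.le,
    intervalIntegral.integral_eq_sub_of_hasDerivAt (fun s _ => hF s)
      ((intervalIntegrable_iff_integrableOn_Ioc_of_le Real.two_pi_pos.le).mpr hG), hp, sub_self]

lemma integral_mul_partialT {T : ℝ} (hT : 0 < T) {f g ψ : ℝ × ℝ × ℝ → ℝ} (hψ : IsTest T ψ)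
    (hf : IntegrableOn f (Ioo 0 T ×ˢ cell)) (hg : IntegrableOn g (Ioo 0 T ×ˢ cell))
    (hd : ∀ t ∈ Ioo 0 T, ∀ y, HasDerivAt (fun s => f (s, y)) (g (t, y)) t) :
    ∫ p in Ioo 0 T ×ˢ cell, f p * partialT ψ p = -∫ p in Ioo 0 T ×ˢ cell, g p * ψ p := by
  obtain ⟨a, b, ha, hb, hs⟩ := hψ.fst_mem
  have h1 := hψ.integrableOn_mul hg
  have h2 := hψ.partialT.integrableOn_mul hf
  rw [eq_neg_iff_add_eq_zero, add_comm, ← integral_add h1 h2]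
  have h3 : IntegrableOn (fun p => g p * ψ p + f p * partialT ψ p) (Ioo 0 T ×ˢ cell) := h1.add h2
  rw [IntegrableOn, restrict_prod_cell] at h3
  rw [restrict_prod_cell, integral_prod_symm _ h3]
  refine integral_eq_zero_of_ae (h3.prod_left_ae.mono fun y hy => ?_)
  have hder : ∀ t, HasDerivAt (fun s => f (s, y) * ψ (s, y))
      (g (t, y) * ψ (t, y) + f (t, y) * partialT ψ (t, y)) t := fun t => by
    by_cases ht : t ∈ Ioo 0 T
    · exact (hd t ht y).mul (hψ.hasDerivAt_partialT t y.1 y.2)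
    -- Outside (0, T) nothing is known about f, but ψ vanishes near t, so the product is locally
    -- zero.
    · have hm : t ∉ Icc a b := fun h => ht ⟨ha.trans_le h.1, h.2.trans_lt hb⟩
      have h4 : (fun s => ψ (s, y)) =ᶠ[𝓝 t] fun _ => 0 := by
        filter_upwards [isClosed_Icc.isOpen_compl.mem_nhds hm] with s h2
        exact hs s h2 _
      have h5 : partialT ψ (t, y) = 0 := h4.deriv_eq.trans (deriv_const _ _)
      rw [hs t hm, h5, mul_zero, mul_zero, add_zero]
      refine (hasDerivAt_const t (0 : ℝ)).congr_of_eventuallyEq ?_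
      filter_upwards [h4] with s h6
      exact mul_eq_zero_of_right _ h6
  have h0 : ∀ t, t = 0 ∨ t = T → ψ (t, y) = 0 := fun t ht => hs t (fun h => by
    rcases ht with rfl | rfl
    · exact absurd h.1 (not_le.mpr ha)
    · exact absurd h.2 (not_le.mpr hb)) y
  simp only [Pi.zero_apply]
  have h7 : IntegrableOn (fun t => g (t, y) * ψ (t, y) + f (t, y) * partialT ψ (t, y))
    (Ioo 0 T) := hy
  rw [← integral_Ioc_eq_integral_Ioo, ← intervalIntegral.integral_of_le hT.le,
    intervalIntegral.integral_eq_sub_of_hasDerivAt (fun t _ => hder t)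
      ((intervalIntegrable_iff_integrableOn_Ioo_of_le hT.le).mpr h7), h0 T (Or.inr rfl),
    h0 0 (Or.inl rfl), mul_zero, mul_zero, sub_self]

lemma integral_mul_partialY₁ {T : ℝ} {f g ψ : ℝ × ℝ × ℝ → ℝ} (hψ : IsTest T ψ)
    (hf : IntegrableOn f (Ioo 0 T ×ˢ cell)) (hg : IntegrableOn g (Ioo 0 T ×ˢ cell))
    (hp : TorusPeriodicOn univ f)
    (hd : ∀ t ∈ Ioo 0 T, ∀ y₁ y₂, HasDerivAt (fun s => f (t, s, y₂)) (g (t, y₁, y₂)) y₁) :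
    ∫ p in Ioo 0 T ×ˢ cell, f p * partialY₁ ψ p = -∫ p in Ioo 0 T ×ˢ cell, g p * ψ p := by
  have h1 := hψ.integrableOn_mul hg
  have h2 := hψ.partialY₁.integrableOn_mul hf
  rw [eq_neg_iff_add_eq_zero, add_comm, ← integral_add h1 h2]
  have h3 : IntegrableOn (fun p => g p * ψ p + f p * partialY₁ ψ p) (Ioo 0 T ×ˢ cell) := h1.add h2
  rw [IntegrableOn, restrict_prod_cell] at h3
  rw [restrict_prod_cell, integral_prod _ h3]
  refine integral_eq_zero_of_ae ?_
  filter_upwards [h3.prod_right_ae, ae_restrict_mem measurableSet_Ioo] with t hy ht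
  rw [restrict_cell] at hy
  rw [restrict_cell, integral_prod_symm _ hy]
  refine integral_eq_zero_of_ae (hy.prod_left_ae.mono fun y₂ hy₂ => ?_)
  refine integral_Ioc_deriv_periodic (F := fun s => f (t, s, y₂) * ψ (t, s, y₂))
    (fun s => (hd t ht s y₂).mul (hψ.hasDerivAt_partialY₁ t s y₂)) ?_ hy₂
  have h4 := (hp t (mem_univ t) 0 y₂).1
  have h5 := (hψ.periodic t (mem_univ t) 0 y₂).1
  rw [zero_add] at h4 h5
  simp only [h4, h5]

lemma integral_mul_partialY₂ {T : ℝ} {f g ψ : ℝ × ℝ × ℝ → ℝ} (hψ : IsTest T ψ)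
    (hf : IntegrableOn f (Ioo 0 T ×ˢ cell)) (hg : IntegrableOn g (Ioo 0 T ×ˢ cell))
    (hp : TorusPeriodicOn univ f)
    (hd : ∀ t ∈ Ioo 0 T, ∀ y₁ y₂, HasDerivAt (fun s => f (t, y₁, s)) (g (t, y₁, y₂)) y₂) :
    ∫ p in Ioo 0 T ×ˢ cell, f p * partialY₂ ψ p = -∫ p in Ioo 0 T ×ˢ cell, g p * ψ p := by
  have h1 := hψ.integrableOn_mul hg
  have h2 := hψ.partialY₂.integrableOn_mul hf
  rw [eq_neg_iff_add_eq_zero, add_comm, ← integral_add h1 h2]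
  have h3 : IntegrableOn (fun p => g p * ψ p + f p * partialY₂ ψ p) (Ioo 0 T ×ˢ cell) := h1.add h2
  rw [IntegrableOn, restrict_prod_cell] at h3
  rw [restrict_prod_cell, integral_prod _ h3]
  refine integral_eq_zero_of_ae ?_
  filter_upwards [h3.prod_right_ae, ae_restrict_mem measurableSet_Ioo] with t hy ht
  rw [restrict_cell] at hy
  rw [restrict_cell, integral_prod _ hy]
  refine integral_eq_zero_of_ae (hy.prod_right_ae.mono fun y₁ hy₁ => ?_)
  refine integral_Ioc_deriv_periodic (F := fun s => f (t, y₁, s) * ψ (t, y₁, s))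
    (fun s => (hd t ht y₁ s).mul (hψ.hasDerivAt_partialY₂ t y₁ s)) ?_ hy₁
  have h4 := (hp t (mem_univ t) y₁ 0).2
  have h5 := (hψ.periodic t (mem_univ t) y₁ 0).2
  rw [zero_add] at h4 h5
  simp only [h4, h5]

lemma integral_mul_iterate {T : ℝ} {P : (ℝ × ℝ × ℝ → ℝ) → ℝ × ℝ × ℝ → ℝ}
    (hP : ∀ ψ, IsTest T ψ → IsTest T (P ψ)) {D : ℕ → ℝ × ℝ × ℝ → ℝ}
    (hD : ∀ k ψ, IsTest T ψ → ∫ p in Ioo 0 T ×ˢ cell, D k p * P ψ p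
      = -∫ p in Ioo 0 T ×ˢ cell, D (k + 1) p * ψ p) (n : ℕ) :
    ∀ k ψ, IsTest T ψ → ∫ p in Ioo 0 T ×ˢ cell, D k p * P^[n] ψ p
      = (-1) ^ n * ∫ p in Ioo 0 T ×ˢ cell, D (k + n) p * ψ p := by
  induction n with
  | zero => intro k ψ _; simp
  | succ n ih =>
    intro k ψ hψ
    rw [Function.iterate_succ_apply, ih k _ (hP ψ hψ), hD _ ψ hψ, pow_succ, add_assoc]
    ring

lemma IsTest.iterate {T : ℝ} {P : (ℝ × ℝ × ℝ → ℝ) → ℝ × ℝ × ℝ → ℝ}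
    (hP : ∀ ψ, IsTest T ψ → IsTest T (P ψ)) (n : ℕ) {ψ : ℝ × ℝ × ℝ → ℝ} (hψ : IsTest T ψ) :
    IsTest T (P^[n] ψ) := by
  induction n with
  | zero => exact hψ
  | succ n ih => rw [Function.iterate_succ_apply']; exact hP _ ih

/-- Classical derivatives are weak derivatives. -/
lemma isWeakDeriv_of_hasDerivAt {T : ℝ} (hT : 0 < T) {D : ℕ → ℕ → ℕ → ℝ × ℝ × ℝ → ℝ}
    (hi : ∀ k l m, IntegrableOn (D k l m) (Ioo 0 T ×ˢ cell))
    (hp : ∀ k l m, TorusPeriodicOn univ (D k l m))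
    (h0 : ∀ k l m, ∀ t ∈ Ioo 0 T, ∀ y,
      HasDerivAt (fun s => D k l m (s, y)) (D (k + 1) l m (t, y)) t)
    (h1 : ∀ k l m, ∀ t ∈ Ioo 0 T, ∀ y₁ y₂,
      HasDerivAt (fun s => D k l m (t, s, y₂)) (D k (l + 1) m (t, y₁, y₂)) y₁)
    (h2 : ∀ k l m, ∀ t ∈ Ioo 0 T, ∀ y₁ y₂,
      HasDerivAt (fun s => D k l m (t, y₁, s)) (D k l (m + 1) (t, y₁, y₂)) y₂) (k l m : ℕ) :
    IsWeakDeriv T k l m (D 0 0 0) (D k l m) := fun ψ hψ => by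
  have t2 := IsTest.iterate (fun _ h => IsTest.partialY₂ h) m hψ
  have t1 := IsTest.iterate (fun _ h => IsTest.partialY₁ h) l t2
  rw [mixedPartial,
    integral_mul_iterate (D := fun i => D i 0 0) (fun _ h => IsTest.partialT h)
      (fun i ψ h => integral_mul_partialT hT h (hi _ _ _) (hi _ _ _) (h0 i 0 0)) k 0 _ t1,
    integral_mul_iterate (D := fun i => D (0 + k) i 0) (fun _ h => IsTest.partialY₁ h)
      (fun i ψ h => integral_mul_partialY₁ h (hi _ _ _) (hi _ _ _) (hp _ _ _) (h1 _ i 0)) l 0 _ t2,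
    integral_mul_iterate (D := fun i => D (0 + k) (0 + l) i) (fun _ h => IsTest.partialY₂ h)
      (fun i ψ h => integral_mul_partialY₂ h (hi _ _ _) (hi _ _ _) (hp _ _ _) (h2 _ _ i)) m 0 _ hψ]
  simp only [zero_add, pow_add]
  ring

/-! ### Rapidly converging Fourier series -/

/-- Comparison with a product of two summable weights, 1/n² for n ≠ 0 and 1 for n = 0. The term j =
0 is a division by zero, hence 0. -/
lemma summable_div_freqNorm_pow_four (C : ℝ) :
    Summable fun j : ℤ × ℤ => C / freqNorm j ^ 4 := by
  set w : ℤ → ℝ := fun n => 1 / (n : ℝ) ^ 2 + if n = 0 then 1 else 0 with hw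
  have hs : Summable w :=
    (Real.summable_one_div_int_pow.mpr one_lt_two).add (hasSum_ite_eq 0 (1 : ℝ)).summable
  have hw0 : ∀ n, 0 ≤ w n := fun n => by
    simp only [hw]; split_ifs <;> positivity
  have h := hs.mul_of_nonneg hs hw0 hw0
  simp only [div_eq_mul_one_div C]
  refine (h.of_nonneg_of_le (fun j => by positivity) fun j => ?_).mul_left C
  have hr : freqNorm j ^ 4 = ((j.1 : ℝ) ^ 2 + (j.2 : ℝ) ^ 2) ^ 2 := by
    rw [show 4 = 2 * 2 by norm_num, pow_mul, freqNorm_sq]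
  have hsq : ∀ n : ℤ, n ≠ 0 → 1 ≤ (n : ℝ) ^ 2 := fun n hn => by
    have : 1 ≤ n ^ 2 := by have := Int.one_le_abs hn; nlinarith [sq_abs n]
    exact_mod_cast this
  rw [hr]
  by_cases h1 : j.1 = 0 <;> by_cases h2 : j.2 = 0
  · simp [hw, h1, h2]
  · have := hsq _ h2
    simp only [hw, h1, h2]
    norm_num
    exact inv_anti₀ (by positivity) (by nlinarith)
  · have := hsq _ h1
    simp only [hw, h1, h2]
    norm_num
    exact inv_anti₀ (by positivity) (by nlinarith)
  · have a1 := hsq _ h1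
    have a2 := hsq _ h2
    simp only [hw, h1, h2, if_false, add_zero]
    rw [one_div_mul_one_div]
    exact one_div_le_one_div_of_le (by positivity) (by nlinarith)

/-- Coefficients which decay faster than any power of the frequency, uniformly on `I`. At `j = 0`
the condition says that the coefficient vanishes. -/
def IsRapidOn (I : Set ℝ) (a : ℤ × ℤ → ℝ → ℂ) : Prop :=
  ∀ p : ℕ, ∃ C, 0 ≤ C ∧ ∀ j, ∀ t ∈ I, ‖a j t‖ ≤ C / freqNorm j ^ p

/-- The Fourier series with coefficients `a`. -/
def modeSum (a : ℤ × ℤ → ℝ → ℂ) (p : ℝ × ℝ × ℝ) : ℂ := ∑' j, a j p.1 * torusChar j p.2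

lemma abs_fst_le_freqNorm (j : ℤ × ℤ) : |(j.1 : ℝ)| ≤ freqNorm j :=
  Real.abs_le_sqrt (by nlinarith [sq_nonneg (j.2 : ℝ)])

lemma abs_snd_le_freqNorm (j : ℤ × ℤ) : |(j.2 : ℝ)| ≤ freqNorm j :=
  Real.abs_le_sqrt (by nlinarith [sq_nonneg (j.1 : ℝ)])

namespace IsRapidOn

variable {I : Set ℝ} {a a' : ℤ × ℤ → ℝ → ℂ}

lemma of_ne_zero (h0 : ∀ t ∈ I, a 0 t = 0)
    (h : ∀ p : ℕ, ∃ C, 0 ≤ C ∧ ∀ j, j ≠ 0 → ∀ t ∈ I, ‖a j t‖ ≤ C / freqNorm j ^ p) :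
    IsRapidOn I a := fun p => by
  obtain ⟨C, hC, h1⟩ := h p
  refine ⟨C, hC, fun j t ht => ?_⟩
  by_cases hj : j = 0
  · rw [hj, h0 t ht, norm_zero]
    have : 0 ≤ freqNorm 0 := Real.sqrt_nonneg _
    positivity
  · exact h1 j hj t ht

lemma mul_coef (h : IsRapidOn I a) {c : ℤ × ℤ → ℂ} (hc : ∀ j, ‖c j‖ ≤ freqNorm j) :
    IsRapidOn I fun j t => c j * a j t := by
  refine of_ne_zero (fun t _ => ?_) fun p => ?_
  · have h1 := hc 0
    simp only [freqNorm, Prod.fst_zero, Prod.snd_zero, Int.cast_zero] at h1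
    norm_num at h1
    simp [h1]
  · obtain ⟨C, hC, h1⟩ := h (p + 1)
    refine ⟨C, hC, fun j hj t ht => ?_⟩
    have hr := one_le_freqNorm hj
    rw [norm_mul]
    calc ‖c j‖ * ‖a j t‖ ≤ freqNorm j * (C / freqNorm j ^ (p + 1)) := by
          gcongr
          · exact hc j
          · exact h1 j t ht
      _ = C / freqNorm j ^ p := by rw [pow_succ]; field_simp

lemma norm_term_le {C : ℝ} (h : ∀ j, ∀ t ∈ I, ‖a j t‖ ≤ C / freqNorm j ^ 4) (j : ℤ × ℤ) {t : ℝ}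
    (ht : t ∈ I) (y : ℝ × ℝ) : ‖a j t * torusChar j y‖ ≤ C / freqNorm j ^ 4 := by
  rw [norm_mul, norm_torusChar, mul_one]
  exact h j t ht

lemma summable_norm (h : IsRapidOn I a) {t : ℝ} (ht : t ∈ I) : Summable fun j => ‖a j t‖ := by
  obtain ⟨C, -, h1⟩ := h 4
  exact (summable_div_freqNorm_pow_four C).of_nonneg_of_le (fun _ => norm_nonneg _)
    fun j => h1 j t ht

lemma summable (h : IsRapidOn I a) {t : ℝ} (ht : t ∈ I) (y : ℝ × ℝ) :
    Summable fun j => a j t * torusChar j y :=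
  Summable.of_norm (by simpa [norm_torusChar] using h.summable_norm ht)

lemma exists_bound (h : IsRapidOn I a) : ∃ C, ∀ p ∈ I ×ˢ (univ : Set (ℝ × ℝ)),
    ‖modeSum a p‖ ≤ C := by
  obtain ⟨C, -, h1⟩ := h 4
  exact ⟨∑' j, C / freqNorm j ^ 4, fun p hp => tsum_of_norm_bounded
    (summable_div_freqNorm_pow_four C).hasSum fun j => norm_term_le h1 j hp.1 _⟩

lemma continuousOn (h : IsRapidOn I a) (hc : ∀ j, ContinuousOn (a j) I) :
    ContinuousOn (modeSum a) (I ×ˢ univ) := by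
  obtain ⟨C, -, h1⟩ := h 4
  refine continuousOn_tsum (fun j => ?_) (summable_div_freqNorm_pow_four C)
    fun j p hp => norm_term_le h1 j hp.1 _
  exact ((hc j).comp continuousOn_fst fun p hp => hp.1).mul
    ((continuous_torusChar j).comp continuous_snd).continuousOn

lemma hasDerivAt_fst (hI : IsOpen I) (hI' : IsPreconnected I) (h : IsRapidOn I a)
    (h' : IsRapidOn I a') (hd : ∀ j, ∀ t ∈ I, HasDerivAt (a j) (a' j t) t) {t : ℝ} (ht : t ∈ I)
    (y : ℝ × ℝ) : HasDerivAt (fun s => modeSum a (s, y)) (modeSum a' (t, y)) t := by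
  obtain ⟨C, -, h1⟩ := h' 4
  exact hasDerivAt_tsum_of_isPreconnected (summable_div_freqNorm_pow_four C) hI hI'
    (fun j s hs => (hd j s hs).mul_const (torusChar j y)) (fun j s hs => norm_term_le h1 j hs y)
    ht (h.summable ht y) ht

lemma norm_I_mul_int (n : ℤ) : ‖Complex.I * (n : ℂ)‖ = |(n : ℝ)| := by
  rw [norm_mul, Complex.norm_I, one_mul, ← Complex.ofReal_intCast, Complex.norm_real,
    Real.norm_eq_abs]

lemma mul_I_fst (h : IsRapidOn I a) : IsRapidOn I fun j t => Complex.I * j.1 * a j t :=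
  h.mul_coef fun j => by rw [norm_I_mul_int]; exact abs_fst_le_freqNorm j

lemma mul_I_snd (h : IsRapidOn I a) : IsRapidOn I fun j t => Complex.I * j.2 * a j t :=
  h.mul_coef fun j => by rw [norm_I_mul_int]; exact abs_snd_le_freqNorm j

lemma hasDerivAt_snd_fst (h : IsRapidOn I a) {t : ℝ} (ht : t ∈ I) (y₁ y₂ : ℝ) :
    HasDerivAt (fun s => modeSum a (t, s, y₂))
      (modeSum (fun j t => Complex.I * j.1 * a j t) (t, y₁, y₂)) y₁ := by
  obtain ⟨C, -, h1⟩ := h.mul_I_fst 4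
  refine hasDerivAt_tsum_of_isPreconnected (summable_div_freqNorm_pow_four C) isOpen_univ
    isPreconnected_univ (fun j s _ => ?_) (fun j s _ => norm_term_le h1 j ht (s, y₂))
    (mem_univ y₁) (h.summable ht (y₁, y₂)) (mem_univ y₁)
  exact ((hasDerivAt_torusChar_fst j s y₂).const_mul (a j t)).congr_deriv (by ring)

lemma hasDerivAt_snd_snd (h : IsRapidOn I a) {t : ℝ} (ht : t ∈ I) (y₁ y₂ : ℝ) :
    HasDerivAt (fun s => modeSum a (t, y₁, s))
      (modeSum (fun j t => Complex.I * j.2 * a j t) (t, y₁, y₂)) y₂ := by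
  obtain ⟨C, -, h1⟩ := h.mul_I_snd 4
  refine hasDerivAt_tsum_of_isPreconnected (summable_div_freqNorm_pow_four C) isOpen_univ
    isPreconnected_univ (fun j s _ => ?_) (fun j s _ => norm_term_le h1 j ht (y₁, s))
    (mem_univ y₂) (h.summable ht (y₁, y₂)) (mem_univ y₂)
  exact ((hasDerivAt_torusChar_snd j y₁ s).const_mul (a j t)).congr_deriv (by ring)

end IsRapidOn

lemma torusPeriodicOn_modeSum (I : Set ℝ) (a : ℤ × ℤ → ℝ → ℂ) :
    TorusPeriodicOn I fun p => (modeSum a p).re := fun t _ y₁ y₂ => by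
  simp only [modeSum, torusChar_add_fst, torusChar_add_snd, and_self]

/-- A Fourier series whose coefficients and all their time derivatives decay rapidly is `H^∞`. -/
lemma memHInfty_modeSum {T : ℝ} (hT : 0 < T) {a : ℤ × ℤ → ℝ → ℂ}
    (hr : ∀ k, IsRapidOn (Ioo 0 T) fun j => iteratedDeriv k (a j))
    (hd : ∀ k j, ∀ t ∈ Ioo 0 T,
      HasDerivAt (iteratedDeriv k (a j)) (iteratedDeriv (k + 1) (a j) t) t) :
    MemHInfty T fun p => (modeSum a p).re := by
  set b : ℕ → ℕ → ℕ → ℤ × ℤ → ℝ → ℂ := fun k l m j t =>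
    (Complex.I * j.1) ^ l * ((Complex.I * j.2) ^ m * iteratedDeriv k (a j) t) with hb
  have hb1 : ∀ k l m, b k (l + 1) m = fun j t => Complex.I * j.1 * b k l m j t := fun k l m => by
    funext j t; simp only [hb]; ring
  have hb2 : ∀ k l m, b k l (m + 1) = fun j t => Complex.I * j.2 * b k l m j t := fun k l m => by
    funext j t; simp only [hb]; ring
  have hbr : ∀ k l m, IsRapidOn (Ioo 0 T) (b k l m) := fun k l m => by
    induction l with
    | zero =>
      induction m with
      | zero => simpa [hb] using hr k
      | succ m ih => rw [hb2]; exact ih.mul_I_snd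
    | succ l ih => rw [hb1]; exact ih.mul_I_fst
  have hbd : ∀ k l m j, ∀ t ∈ Ioo 0 T, HasDerivAt (b k l m j) (b (k + 1) l m j t) t :=
    fun k l m j t ht => ((hd k j t ht).const_mul _).const_mul _
  have hbc : ∀ k l m, ContinuousOn (fun p => (modeSum (b k l m) p).re) (Ioo 0 T ×ˢ univ) :=
    fun k l m => Complex.continuous_re.comp_continuousOn ((hbr k l m).continuousOn fun j t ht =>
      (hbd k l m j t ht).continuousAt.continuousWithinAt)
  have hfin : IsFiniteMeasure (volume.restrict (Ioo 0 T ×ˢ cell) : Measure (ℝ × ℝ × ℝ)) := by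
    rw [restrict_prod_cell]; infer_instance
  have hmeas : MeasurableSet (Ioo 0 T ×ˢ cell) := measurableSet_Ioo.prod measurableSet_cell
  have hL : ∀ k l m, MemLp (fun p => (modeSum (b k l m) p).re) 2
      (volume.restrict (Ioo 0 T ×ˢ cell)) := fun k l m => by
    obtain ⟨C, hC⟩ := (hbr k l m).exists_bound
    refine MemLp.of_bound (((hbc k l m).mono (prod_mono_right (subset_univ _))).aestronglyMeasurable
      hmeas) C ((ae_restrict_iff' hmeas).mpr (Eventually.of_forall fun p hp => ?_))
    exact (Complex.abs_re_le_norm _).trans (hC p ⟨hp.1, mem_univ _⟩)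
  have h0 : a = b 0 0 0 := by simp [hb]
  rw [h0]
  refine ⟨torusPeriodicOn_modeSum _ _, hL 0 0 0, fun k l m => ⟨_, hL k l m, ?_⟩⟩
  refine isWeakDeriv_of_hasDerivAt (D := fun k l m p => (modeSum (b k l m) p).re) hT
    (fun k l m => (hL k l m).integrable one_le_two) (fun k l m => torusPeriodicOn_modeSum _ _)
    (fun k l m t ht y => ?_) (fun k l m t ht y₁ y₂ => ?_) (fun k l m t ht y₁ y₂ => ?_) k l m
  · exact hasDerivAt_re ((hbr k l m).hasDerivAt_fst isOpen_Ioo isPreconnected_Ioo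
      (hbr (k + 1) l m) (hbd k l m) ht y)
  · have := hasDerivAt_re ((hbr k l m).hasDerivAt_snd_fst ht y₁ y₂)
    rwa [← hb1] at this
  · have := hasDerivAt_re ((hbr k l m).hasDerivAt_snd_snd ht y₁ y₂)
    rwa [← hb2] at this

/-! ### Fourier coefficients of a Fourier series -/

lemma integral_exp_int_mul (n : ℤ) : ∫ s in Ioc 0 (2 * Real.pi), Complex.exp (Complex.I * (n * s))
    = if n = 0 then ((2 * Real.pi : ℝ) : ℂ) else 0 := by
  split_ifs with h
  · simp [h, Real.pi_pos.le]
  · have hn : Complex.I * (n : ℂ) ≠ 0 := mul_ne_zero Complex.I_ne_zero (by exact_mod_cast h)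
    rw [← intervalIntegral.integral_of_le Real.two_pi_pos.le]
    simp only [← mul_assoc]
    rw [integral_exp_mul_complex hn]
    have := Complex.exp_int_mul_two_pi_mul_I n
    rw [show Complex.I * (n : ℂ) * ((2 * Real.pi : ℝ) : ℂ) = n * (2 * Real.pi * Complex.I) by
      push_cast; ring, this]
    simp

lemma integral_torusChar (j : ℤ × ℤ) :
    ∫ y in cell, torusChar j y = if j = 0 then ((2 * Real.pi : ℝ) ^ 2 : ℂ) else 0 := by
  have h1 : ∀ y : ℝ × ℝ, torusChar j y = Complex.exp (Complex.I * (j.1 * y.1))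
      * Complex.exp (Complex.I * (j.2 * y.2)) := fun y => by
    rw [← Complex.exp_add, torusChar, mul_add]
  simp only [h1]
  rw [restrict_cell, integral_prod_mul (fun s : ℝ => Complex.exp (Complex.I * (j.1 * s)))
    (fun s : ℝ => Complex.exp (Complex.I * (j.2 * s))), integral_exp_int_mul, integral_exp_int_mul]
  by_cases h1 : j.1 = 0 <;> by_cases h2 : j.2 = 0 <;> simp [h1, h2, Prod.ext_iff, sq]

lemma torusChar_add (j k : ℤ × ℤ) (y : ℝ × ℝ) :
    torusChar (j + k) y = torusChar j y * torusChar k y := by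
  rw [torusChar, torusChar, torusChar, ← Complex.exp_add]
  congr 1
  simp only [Prod.fst_add, Prod.snd_add, Int.cast_add]
  ring

lemma conj_torusChar (j : ℤ × ℤ) (y : ℝ × ℝ) :
    (starRingEnd ℂ) (torusChar j y) = torusChar (-j) y := by
  rw [torusChar, torusChar, ← Complex.exp_conj]
  congr 1
  simp
  ring

/-- The symmetrization of the coefficients of a Fourier series which corresponds to taking the
real part of its sum. -/
def symmCoef (a : ℤ × ℤ → ℝ → ℂ) (j : ℤ × ℤ) (t : ℝ) : ℂ :=
  (a j t + (starRingEnd ℂ) (a (-j) t)) / 2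

lemma IsRapidOn.re_modeSum {I : Set ℝ} {a : ℤ × ℤ → ℝ → ℂ} (h : IsRapidOn I a) {t : ℝ}
    (ht : t ∈ I) (y : ℝ × ℝ) :
    (((modeSum a (t, y)).re : ℝ) : ℂ) = ∑' j, symmCoef a j t * torusChar j y := by
  have h1 := h.summable ht y
  have h2 : Summable fun j => (starRingEnd ℂ) (a (-j) t) * torusChar j y := by
    have := ((Equiv.neg (ℤ × ℤ)).summable_iff.mpr h1).star
    refine this.congr fun j => ?_
    simp only [Function.comp_apply, Equiv.neg_apply, RCLike.star_def, map_mul, conj_torusChar,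
      neg_neg]
  rw [Complex.re_eq_add_conj]
  have h3 : (starRingEnd ℂ) (modeSum a (t, y))
      = ∑' j, (starRingEnd ℂ) (a (-j) t) * torusChar j y := by
    rw [modeSum, Complex.conj_tsum, ← (Equiv.neg (ℤ × ℤ)).tsum_eq]
    simp only [Equiv.neg_apply, map_mul, conj_torusChar, neg_neg]
  rw [h3, modeSum, ← h1.tsum_add h2, ← tsum_div_const]
  congr 1
  funext j
  rw [symmCoef]
  ring

lemma IsRapidOn.fourierCoef_re_modeSum {I : Set ℝ} {a : ℤ × ℤ → ℝ → ℂ} (h : IsRapidOn I a) {t : ℝ}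
    (ht : t ∈ I) (j : ℤ × ℤ) :
    fourierCoef j (fun p => (modeSum a p).re) t = symmCoef a j t := by
  have hs : Summable fun k => ‖symmCoef a k t‖ := by
    have h1 := h.summable_norm ht
    refine (h1.add ((Equiv.neg (ℤ × ℤ)).summable_iff.mpr h1)).of_nonneg_of_le
      (fun _ => norm_nonneg _) fun k => ?_
    rw [symmCoef, norm_div, Complex.norm_two]
    refine (half_le_self (norm_nonneg _)).trans ((norm_add_le _ _).trans (le_of_eq ?_))
    simp
  have hpi : ((2 * Real.pi : ℝ) ^ 2 : ℂ) ≠ 0 := by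
    exact_mod_cast (by positivity : (2 * Real.pi) ^ 2 ≠ 0)
  have hF : ∀ k, ∀ y, ‖symmCoef a k t * torusChar (-j + k) y‖ = ‖symmCoef a k t‖ := fun k y => by
    rw [norm_mul, norm_torusChar, mul_one]
  have hint : ∀ k, Integrable (fun y => symmCoef a k t * torusChar (-j + k) y)
      (volume.restrict cell) := fun k =>
    Integrable.of_bound ((continuous_torusChar _).const_mul _ |>.aestronglyMeasurable)
      ‖symmCoef a k t‖ (Eventually.of_forall fun y => (hF k y).le)
  rw [fourierCoef_eq]
  have h1 : ∀ y, torusChar (-j) y * (((modeSum a (t, y)).re : ℝ) : ℂ)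
      = ∑' k, symmCoef a k t * torusChar (-j + k) y := fun y => by
    rw [h.re_modeSum ht, ← tsum_mul_left]
    congr 1
    funext k
    rw [torusChar_add]
    ring
  simp only [h1]
  rw [← integral_tsum_of_summable_integral_norm hint]
  · simp only [integral_const_mul, integral_torusChar]
    rw [tsum_eq_single j fun k hk => by
      rw [if_neg fun h => hk (by rw [← sub_eq_zero, ← h]; ring), mul_zero]]
    rw [if_pos (neg_add_cancel j), mul_comm (symmCoef a j t), inv_mul_cancel_left₀ hpi]
  · simp only [hF]
    simpa [integral_const] using hs.mul_left _

/-! ### Existence -/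

lemma freqNorm_neg (j : ℤ × ℤ) : freqNorm (-j) = freqNorm j := by simp [freqNorm]

/-- The symbol is that of a real operator. The principal root commutes with conjugation because its
argument avoids the negative axis when Re z > 0. Consequently the conjugate of the mode -j solves
the equation of the mode j. -/
lemma lopatinskii_neg_conj (S : RefState) {ν : ℝ} (hν : 0 < ν) {j : ℤ × ℤ} (hj : j ≠ 0) {z : ℂ}
    (hz : 0 < z.re) : (starRingEnd ℂ) (lopatinskii S ν ((starRingEnd ℂ) z) (-j))
      = lopatinskii S ν z j := by
  have hr := zero_lt_one.trans_le (one_le_freqNorm hj)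
  have h1 : ((ν : ℂ) ^ 2 * ((starRingEnd ℂ) z) ^ 2 + (freqNorm j : ℂ) ^ 2)
      = (starRingEnd ℂ) ((ν : ℂ) ^ 2 * z ^ 2 + (freqNorm j : ℂ) ^ 2) := by simp
  have h2 := Complex.conj_cpow ((ν : ℂ) ^ 2 * z ^ 2 + (freqNorm j : ℂ) ^ 2) (1 / 2 : ℂ)
    (Complex.mem_slitPlane_iff_arg.mp (mem_slitPlane_of_re_pos hν hr hz)).1
  have h3 : (starRingEnd ℂ) (1 / 2 : ℂ) = 1 / 2 := by rw [map_div₀, map_one, map_ofNat]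
  rw [lopatinskii, freqNorm_neg, h1, h2, h3, lopatinskii]
  simp only [map_add, map_mul, map_sub, map_pow, Complex.conj_conj, Complex.conj_I,
    Complex.conj_ofReal, Prod.fst_neg, Prod.snd_neg, Int.cast_neg, map_neg, map_intCast]
  ring

lemma laplace_conj (f : ℝ → ℂ) (z : ℂ) : laplace (fun t => (starRingEnd ℂ) (f t)) z
    = (starRingEnd ℂ) (laplace f ((starRingEnd ℂ) z)) := by
  rw [laplace, laplace, ← integral_conj]
  congr 1
  funext t
  rw [map_mul, ← Complex.exp_conj]
  simp

lemma fourierCoef_neg (j : ℤ × ℤ) (f : ℝ × ℝ × ℝ → ℝ) (t : ℝ) :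
    fourierCoef (-j) f t = (starRingEnd ℂ) (fourierCoef j f t) := by
  rw [fourierCoef_eq, fourierCoef_eq, map_mul, ← integral_conj]
  simp only [map_inv₀, map_pow, map_mul, Complex.conj_ofReal, conj_torusChar]

lemma laplace_congr_ae {f g : ℝ → ℂ} (h : ∀ᵐ t ∂(volume.restrict (Ioi (0 : ℝ))), f t = g t)
    (z : ℂ) : laplace f z = laplace g z :=
  integral_congr_ae (h.mono fun t ht => by simp only [ht])

lemma ae_indicator_eq {T : ℝ} {f g : ℝ → ℂ}
    (h : ∀ᵐ t ∂(volume.restrict (Ioo 0 T)), f t = g t) :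
    ∀ᵐ t ∂(volume.restrict (Ioi (0 : ℝ))), (Ioo 0 T).indicator f t = (Ioo 0 T).indicator g t := by
  refine ae_restrict_of_ae ?_
  filter_upwards [(ae_restrict_iff' measurableSet_Ioo).mp h] with t ht
  by_cases hm : t ∈ Ioo 0 T
  · simp only [indicator_of_mem hm, ht hm]
  · simp only [indicator_of_notMem hm]

lemma memLp_exp_fst {ε : ℝ} (hε : 0 < ε) :
    MemLp (fun p : ℝ × ℝ × ℝ => Real.exp (-ε * p.1)) 2 (volume.restrict (Ioi 0 ×ˢ cell)) := by
  rw [memLp_two_iff_integrable_sq (Continuous.aestronglyMeasurable (by fun_prop)),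
    restrict_prod_cell]
  have h1 : Integrable (fun t : ℝ => Real.exp (-(2 * ε) * t)) (volume.restrict (Ioi 0)) :=
    exp_neg_integrableOn_Ioi 0 (by positivity)
  refine (h1.comp_fst (volume.restrict cell)).congr (Eventually.of_forall fun p => ?_)
  simp only []
  rw [sq, ← Real.exp_add]
  ring_nf

lemma memWeightedL2_of_bound {f : ℝ × ℝ × ℝ → ℝ} {γ ρ K : ℝ} (h : ρ < γ)
    (hp : TorusPeriodicOn (Ioi 0) f) (hc : Continuous f)
    (hf : ∀ p, |f p| ≤ K * Real.exp (ρ * p.1)) : MemWeightedL2 γ f := by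
  refine ⟨hp, ((memLp_exp_fst (sub_pos.mpr h)).const_mul K).mono
    (Continuous.aestronglyMeasurable (by fun_prop)) (Eventually.of_forall fun p => ?_)⟩
  rw [norm_mul, Real.norm_eq_abs, Real.abs_exp, Real.norm_eq_abs]
  calc Real.exp (-γ * p.1) * |f p| ≤ Real.exp (-γ * p.1) * (K * Real.exp (ρ * p.1)) := by
        gcongr; exact hf p
    _ = K * Real.exp (-(γ - ρ) * p.1) := by
        rw [mul_left_comm, ← Real.exp_add]; ring_nf
    _ ≤ _ := le_abs_self _

/-- Extension by zero of a function on `(0, T) × 𝕋²`. -/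
def truncate (T : ℝ) (f : ℝ × ℝ × ℝ → ℝ) : ℝ × ℝ × ℝ → ℝ := (Ioo 0 T ×ˢ univ).indicator f

lemma truncate_of_mem {T : ℝ} (f : ℝ × ℝ × ℝ → ℝ) {p : ℝ × ℝ × ℝ} (hp : p.1 ∈ Ioo 0 T) :
    truncate T f p = f p :=
  indicator_of_mem (show p ∈ Ioo 0 T ×ˢ univ from ⟨hp, mem_univ _⟩) f

lemma fourierCoef_truncate (T : ℝ) (f : ℝ × ℝ × ℝ → ℝ) (j : ℤ × ℤ) :
    fourierCoef j (truncate T f) = (Ioo 0 T).indicator (fourierCoef j f) := by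
  funext t
  by_cases ht : t ∈ Ioo 0 T
  · have : ∀ y, truncate T f (t, y) = f (t, y) := fun y => truncate_of_mem f ht
    simp only [fourierCoef, this, indicator_of_mem ht]
  · have : ∀ y, truncate T f (t, y) = 0 := fun y => indicator_of_notMem (fun h => ht h.1) _
    simp [fourierCoef, this, indicator_of_notMem ht]

lemma MemHInfty.memWeightedL2_truncate {T γ : ℝ} (hγ : 0 ≤ γ) {f : ℝ × ℝ × ℝ → ℝ}
    (hf : MemHInfty T f) : MemWeightedL2 γ (truncate T f) := by
  have hm : MeasurableSet (Ioo 0 T ×ˢ (univ : Set (ℝ × ℝ))) := measurableSet_Ioo.prod .univ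
  refine ⟨fun t _ y₁ y₂ => ?_, ?_⟩
  · by_cases ht : t ∈ Ioo 0 T
    · have : ∀ y, truncate T f (t, y) = f (t, y) := fun y => truncate_of_mem f ht
      simp only [this]
      exact hf.periodic t (Ioo_subset_Icc_self ht) y₁ y₂
    · have : ∀ y, truncate T f (t, y) = 0 := fun y => indicator_of_notMem (fun h => ht h.1) _
      simp only [this, and_self]
  · have h1 : MemLp (truncate T f) 2 (volume.restrict (Ioi 0 ×ˢ cell)) := by
      rw [truncate, memLp_indicator_iff_restrict hm, Measure.restrict_restrict hm, prod_inter_prod,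
        univ_inter, inter_eq_left.mpr Ioo_subset_Ioi_self]
      exact hf.memL2
    refine h1.mono ((Continuous.aestronglyMeasurable (by fun_prop)).mul h1.1)
      ((ae_restrict_iff' (measurableSet_Ioi.prod measurableSet_cell)).mpr
        (Eventually.of_forall fun p hp => ?_))
    rw [norm_mul, Real.norm_eq_abs, Real.abs_exp]
    refine mul_le_of_le_one_left (norm_nonneg _) (Real.exp_le_one_iff.mpr ?_)
    have : 0 < p.1 := hp.1
    nlinarith

/-- Existence of the slow front, given a lower bound for the symbol. -/
lemma exists_isSlowFront {S : RefState} {ν C₀ T : ℝ} (hν : 0 < ν) (hC₀ : 0 < C₀)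
    (hC : ∀ j : ℤ × ℤ, j ≠ 0 → ∀ z : ℂ, 1 ≤ z.re →
      ‖z‖ ^ 3 ≤ C₀ * freqNorm j * ‖lopatinskii S ν z j‖) (hT : 0 < T) {𝔄 : ℝ × ℝ × ℝ → ℝ}
    (h𝔄 : MemHInfty T 𝔄) : ∃ Φ, IsSlowFront S ν T 𝔄 Φ := by
  obtain ⟨v, hv, hw, hv0, hb⟩ := h𝔄.exists_coef_derivs
  obtain ⟨φ, φ', hφ0, hφ'0, hd, hi, hi', hbd, hlap, hreg, hregb⟩ := exists_modes hν hC₀ hC hT hv hw hb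
  -- The modes are defined on the whole line and grow at most like e^{2t}, so they are uniformly
  -- rapid on every half-line t < R.
  have hrap : ∀ R, IsRapidOn (Iio R) φ ∧ IsRapidOn (Iio R) φ' := fun R => by
    constructor
    · refine IsRapidOn.of_ne_zero (fun t _ => by rw [hφ0]; rfl) fun p => ?_
      obtain ⟨C, hC0, hC1⟩ := hbd p
      refine ⟨C * Real.exp (2 * R), by positivity, fun j hj t ht => ?_⟩
      have hr := one_le_freqNorm hj
      rw [mul_div_right_comm]
      refine (hC1 j hj t).1.trans ?_
      gcongr
      exact le_of_lt ht
    · refine IsRapidOn.of_ne_zero (fun t _ => by rw [hφ'0]; rfl) fun p => ?_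
      obtain ⟨C, hC0, hC1⟩ := hbd p
      refine ⟨C * Real.exp (2 * R), by positivity, fun j hj t ht => ?_⟩
      have hr := one_le_freqNorm hj
      rw [mul_div_right_comm]
      refine (hC1 j hj t).2.trans ?_
      gcongr
      exact le_of_lt ht
  have hφc : ∀ j, Continuous (φ j) := fun j =>
    continuous_iff_continuousAt.mpr fun t => (hd j t).continuousAt
  have hcont : Continuous (modeSum φ) := continuous_iff_continuousAt.mpr fun p =>
    ((hrap (p.1 + 1)).1.continuousOn fun j => (hφc j).continuousOn).continuousAt
      ((isOpen_Iio.prod isOpen_univ).mem_nhds ⟨by simp, mem_univ _⟩)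
  have hcoef : ∀ j t, fourierCoef j (fun p => (modeSum φ p).re) t = symmCoef φ j t := fun j t =>
    (hrap (t + 1)).1.fourierCoef_re_modeSum (by simp) j
  obtain ⟨K, hK⟩ : ∃ K, ∀ p, |(modeSum φ p).re| ≤ K * Real.exp (2 * p.1) := by
    obtain ⟨C, hC0, hC1⟩ := hbd 4
    refine ⟨∑' j, C / freqNorm j ^ 4, fun p => (Complex.abs_re_le_norm _).trans ?_⟩
    rw [← tsum_mul_right]
    refine tsum_of_norm_bounded ((summable_div_freqNorm_pow_four C).mul_right _).hasSum fun j => ?_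
    rw [norm_mul, norm_torusChar, mul_one]
    by_cases hj : j = 0
    · have : 0 ≤ freqNorm 0 := Real.sqrt_nonneg _
      rw [hj, hφ0, Pi.zero_apply, norm_zero]
      positivity
    · exact (hC1 j hj p.1).1
  refine ⟨fun p => (modeSum φ p).re, ?_, ?_, fun t _ => ?_, fun y => ?_, fun y => ?_, ?_⟩
  · refine memHInfty_modeSum hT (fun k => IsRapidOn.of_ne_zero (fun t _ => ?_) (hregb k)) hreg
    have : ∀ k, iteratedDeriv k (φ 0) = fun _ => 0 := fun k => by
      rw [hφ0]
      induction k with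
      | zero => rw [iteratedDeriv_zero]; rfl
      | succ k ih => rw [iteratedDeriv_succ, ih]; simp
    rw [this]
  · exact (Complex.continuous_re.comp hcont).continuousOn
  · have h1 := hcoef 0 t
    have hpi : ((2 * Real.pi : ℝ) ^ 2 : ℂ) ≠ 0 := by
      exact_mod_cast (by positivity : (2 * Real.pi) ^ 2 ≠ 0)
    rw [fourierCoef_eq, symmCoef, neg_zero, hφ0] at h1
    simp only [Pi.zero_apply, map_zero, add_zero, zero_div, mul_eq_zero, inv_eq_zero, hpi,
      false_or, torusChar, Prod.fst_zero, Prod.snd_zero, Int.cast_zero, zero_mul, mul_zero,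
      Complex.exp_zero, one_mul, integral_complex_ofReal] at h1
    exact_mod_cast h1
  · simp [modeSum, hi]
  · have h1 := (hrap 1).1.hasDerivAt_fst isOpen_Iio isPreconnected_Iio (hrap 1).2
      (fun j t _ => hd j t) (zero_lt_one : (0 : ℝ) < 1) y
    have h2 : modeSum φ' (0, y) = 0 := by simp [modeSum, hi']
    rw [h2] at h1
    exact (hasDerivAt_re h1).hasDerivWithinAt
  · have hm : MeasurableSet (Ioo 0 T ×ˢ cell) := measurableSet_Ioo.prod measurableSet_cell
    -- The source is extended by zero and the solution by its own series; any weight above the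
    -- growth rate 2 would do.
    refine ⟨3, truncate T 𝔄, fun p => (modeSum φ p).re, by norm_num,
      h𝔄.memWeightedL2_truncate (by norm_num), memWeightedL2_of_bound (by norm_num : (2 : ℝ) < 3)
      (torusPeriodicOn_modeSum _ _) (Complex.continuous_re.comp hcont) hK,
      (ae_restrict_iff' hm).mpr (Eventually.of_forall fun p hp =>
        truncate_of_mem 𝔄 hp.1), ae_of_all _ fun _ => rfl,
      fun j hj z hz => ?_⟩
    have hint : ∀ j z, 3 < z.re →
        IntegrableOn (fun t : ℝ => Complex.exp (-z * t) * φ j t) (Ioi 0) := fun j z hz => by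
      obtain ⟨C, hC0, hC1⟩ := hbd 0
      refine integrableOn_exp_mul (σ := 3) (integrableOn_exp_mul_of_norm_le (ρ := 2) (C := C)
        (by norm_num) (hφc j).aestronglyMeasurable fun t _ => ?_) hz.le
      by_cases hj : j = 0
      · rw [hj, hφ0, Pi.zero_apply, norm_zero]; positivity
      · simpa using (hC1 j hj t).1
    have hzc : 3 < ((starRingEnd ℂ) z).re := by simpa using hz
    have hv1 : ∀ j z, laplace ((Ioo 0 T).indicator (v j 0)) z
        = laplace ((Ioo 0 T).indicator (fourierCoef j 𝔄)) z := fun j z =>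
      laplace_congr_ae (ae_indicator_eq (hv0 j)) z
    have h1 := hlap j hj z (show (1 : ℝ) < z.re by linarith)
    have h2 := hlap (-j) (neg_ne_zero.mpr hj) ((starRingEnd ℂ) z)
      (show (1 : ℝ) < ((starRingEnd ℂ) z).re by linarith)
    have h3 := congrArg (starRingEnd ℂ) h2
    rw [map_mul, lopatinskii_neg_conj S hν hj (by linarith), ← laplace_conj, hv1, ← laplace_conj]
      at h3
    have h4 : (fun t => (starRingEnd ℂ) ((Ioo 0 T).indicator (fourierCoef (-j) 𝔄) t))
        = (Ioo 0 T).indicator (fourierCoef j 𝔄) := by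
      funext t
      by_cases ht : t ∈ Ioo 0 T
      · rw [indicator_of_mem ht, indicator_of_mem ht, fourierCoef_neg, Complex.conj_conj]
      · rw [indicator_of_notMem ht, indicator_of_notMem ht, map_zero]
    rw [h4] at h3
    rw [hv1] at h1
    have h5 : laplace (fourierCoef j fun p => (modeSum φ p).re) z
        = (laplace (φ j) z + laplace (fun t => (starRingEnd ℂ) (φ (-j) t)) z) / 2 := by
      have hc : IntegrableOn (fun t : ℝ => Complex.exp (-z * t) * (starRingEnd ℂ) (φ (-j) t))
          (Ioi 0) := by
        have h6 := (hint (-j) _ hzc)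
        refine (h6.norm.mono' ?_ (ae_of_all _ fun t => ?_))
        · exact (Continuous.aestronglyMeasurable
            ((by fun_prop : Continuous fun t : ℝ => Complex.exp (-z * t)).mul
              (Complex.continuous_conj.comp (hφc _))))
        · simp [Complex.norm_exp]
      rw [laplace, laplace, laplace, ← integral_add (hint j z hz) hc, ← integral_div]
      congr 1
      funext t
      rw [hcoef, symmCoef]
      ring
    rw [h5, fourierCoef_truncate]
    -- The real part of the series has symmetrized coefficients, so its equation is the mean of the
    -- equation for j and the conjugate of the equation for -j.
    linear_combination (h1 + h3) / 2

/-! ### Uniqueness -/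

/-- Cauchy–Schwarz against e^{-(σ-γ)t}, which is square integrable on the half-line times the cell.
-/
lemma MemWeightedL2.integrableOn {γ σ : ℝ} {f : ℝ × ℝ × ℝ → ℝ} (hf : MemWeightedL2 γ f)
    (h : γ < σ) : IntegrableOn (fun p => Real.exp (-σ * p.1) * f p) (Ioi 0 ×ˢ cell) := by
  refine ((memLp_exp_fst (sub_pos.mpr h)).integrable_mul hf.memL2).congr (ae_of_all _ fun p => ?_)
  simp only [Pi.mul_apply]
  rw [← mul_assoc, ← Real.exp_add]
  ring_nf

lemma fourierCoef_exp_mul (j : ℤ × ℤ) (σ : ℝ) (f : ℝ × ℝ × ℝ → ℝ) (t : ℝ) :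
    fourierCoef j (fun p => Real.exp (-σ * p.1) * f p) t
      = Complex.exp (-σ * t) * fourierCoef j f t := by
  rw [fourierCoef_eq, fourierCoef_eq, mul_left_comm, ← integral_const_mul (Complex.exp (-σ * t))]
  congr 2
  funext y
  push_cast
  ring

lemma MemWeightedL2.integrableOn_fourierCoef {γ σ : ℝ} {f : ℝ × ℝ × ℝ → ℝ}
    (hf : MemWeightedL2 γ f) (h : γ < σ) (j : ℤ × ℤ) :
    IntegrableOn (fun t : ℝ => Complex.exp (-σ * t) * fourierCoef j f t) (Ioi 0) :=
  (PlasmaVacuum.integrableOn_fourierCoef j (hf.integrableOn h)).congr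
    (ae_of_all _ fun t => fourierCoef_exp_mul j σ f t)

lemma fourierCoef_congr_ae {s : Set ℝ} {f g : ℝ × ℝ × ℝ → ℝ}
    (h : ∀ᵐ p ∂(volume.restrict (s ×ˢ cell)), f p = g p) :
    ∀ᵐ t ∂(volume.restrict s), ∀ j, fourierCoef j f t = fourierCoef j g t := by
  rw [restrict_prod_cell] at h
  filter_upwards [Measure.ae_ae_of_ae_prod h] with t ht j
  rw [fourierCoef_eq, fourierCoef_eq]
  congr 1
  exact integral_congr_ae (ht.mono fun y hy => by simp only [hy])

/-- Causality: if the source vanishes before the time `T`, so does the solution. -/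
lemma ae_eq_zero_of_lopatinskii_mul_laplace {S : RefState} {ν C₀ T σ : ℝ} (hν : 0 < ν)
    (hC₀ : 0 < C₀) {j : ℤ × ℤ} (hj : j ≠ 0) (hC : ∀ z : ℂ, 1 ≤ z.re →
      ‖z‖ ^ 3 ≤ C₀ * freqNorm j * ‖lopatinskii S ν z j‖) (hT : 0 < T) (hσ : 1 ≤ σ) {d R : ℝ → ℂ}
    (hd : IntegrableOn (fun t : ℝ => Complex.exp (-σ * t) * d t) (Ioi 0))
    (hR : IntegrableOn (fun t : ℝ => Complex.exp (-σ * t) * R t) (Ioi 0))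
    (hR0 : ∀ᵐ t ∂(volume.restrict (Ioo 0 T)), R t = 0)
    (h : ∀ z : ℂ, σ < z.re → lopatinskii S ν z j * laplace d z = laplace R z) :
    ∀ᵐ t ∂(volume.restrict (Ioo 0 T)), d t = 0 := by
  have hr := one_le_freqNorm hj
  have hσ0 : 0 ≤ σ := zero_le_one.trans hσ
  have hsub : halfPlane σ ⊆ halfPlane 1 := fun z hz => hσ.trans_lt hz
  have hlop : ∀ z ∈ halfPlane σ, lopatinskii S ν z j ≠ 0 := fun z hz =>
    lopatinskii_ne_zero (le_of_lt (hsub hz)) (hC z (le_of_lt (hsub hz)))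
  set I := ∫ t in Ioi (0 : ℝ), ‖Complex.exp (-σ * t) * R t‖ with hI
  have hI0 : 0 ≤ I := integral_nonneg fun _ => norm_nonneg _
  -- Since R lives on t ≥ T, the additional damping e^{-(Re z - σ)t} is at most e^{-(Re z - σ)T}
  -- there.
  have hLR : ∀ z ∈ halfPlane σ, ‖laplace R z‖ ≤ Real.exp (T * σ) * I * Real.exp (-T * z.re) :=
    fun z hz => by
      have e : Real.exp (T * σ) * I * Real.exp (-T * z.re)
          = ∫ t in Ioi (0 : ℝ), Real.exp (-(z.re - σ) * T) * ‖Complex.exp (-σ * t) * R t‖ := by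
        rw [integral_const_mul, ← hI, mul_right_comm, ← Real.exp_add]
        ring_nf
      rw [e]
      refine norm_integral_le_of_norm_le (hR.norm.const_mul _) ?_
      have h1 := (ae_restrict_iff' measurableSet_Ioo).mp hR0
      filter_upwards [ae_restrict_of_ae h1, ae_restrict_mem measurableSet_Ioi] with t ht ht0
      rcases lt_or_ge t T with htT | htT
      · rw [ht ⟨ht0, htT⟩]; simp
      · rw [norm_mul, norm_mul, ← mul_assoc, Complex.norm_exp, Complex.norm_exp, ← Real.exp_add]
        gcongr
        simp only [Complex.mul_re, Complex.neg_re, Complex.ofReal_re, Complex.ofReal_im, mul_zero,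
          sub_zero, Complex.neg_im]
        have hz' : σ < z.re := hz
        nlinarith
  set F : ℂ → ℂ := fun z => laplace R z / lopatinskii S ν z j with hF
  set M := C₀ * freqNorm j * (Real.exp (T * σ) * I) with hM
  have hM0 : 0 ≤ M := by positivity
  have hFn : ∀ z ∈ halfPlane σ, ‖F z‖ ≤ M * Real.exp (-T * z.re) / ‖z‖ ^ 2 := fun z hz => by
    have h1 := one_lt_norm_of_mem (hsub hz)
    have h2 := hC z (le_of_lt (hsub hz))
    have h3 := norm_pos_iff.mpr (hlop z hz)
    have h4 := hLR z hz
    rw [hF]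
    simp only [norm_div]
    rw [div_le_div_iff₀ h3 (by positivity)]
    calc ‖laplace R z‖ * ‖z‖ ^ 2
        ≤ (Real.exp (T * σ) * I * Real.exp (-T * z.re)) * (C₀ * freqNorm j * ‖lopatinskii S ν z j‖)
          := by
          refine mul_le_mul h4 (le_trans ?_ h2) (by positivity) (by positivity)
          exact pow_le_pow_right₀ h1.le (by norm_num)
      _ = M * Real.exp (-T * z.re) * ‖lopatinskii S ν z j‖ := by rw [hM]; ring
  have hFn' : ∀ z ∈ halfPlane σ, ‖F z‖ ≤ M / ‖z‖ ^ 2 := fun z hz => by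
    refine (hFn z hz).trans (div_le_div_of_nonneg_right (mul_le_of_le_one_right hM0 ?_)
      (by positivity))
    have : 0 < z.re := zero_lt_one.trans (hsub hz)
    rw [Real.exp_le_one_iff]
    nlinarith
  have hFd : DifferentiableOn ℂ F (halfPlane σ) :=
    (differentiableOn_laplace hR).div ((differentiableOn_lopatinskii S hν hj).mono hsub) hlop
  have h1 : σ < σ + 1 := lt_add_one σ
  have h2 : σ + 1 < σ + 2 := by linarith
  have hline : ∀ τ, ‖F (vline (σ + 1) τ)‖ ≤ M / ‖vline (σ + 1) τ‖ ^ 2 := fun τ =>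
    hFn' _ (vline_mem_halfPlane h1 τ)
  have hFc := continuous_comp_vline hFd h1
  -- The inverse transform along Re z = σ + 1 may grow like e^{(σ+1)t}; it is compared with d on the
  -- line σ + 2, where both are integrable.
  have hinv : IntegrableOn (fun t : ℝ => Complex.exp (-(σ + 2 : ℝ) * t) * invLaplace (σ + 1) F t)
      (Ioi 0) := by
    refine integrableOn_exp_mul_of_norm_le (C := M / (σ + 1)) h2
      (continuous_invLaplace (by linarith) hFc hline).aestronglyMeasurable fun t _ => ?_
    refine (norm_invLaplace_le (by linarith) hline t).trans (le_of_eq ?_)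
    ring
  have hd2 : IntegrableOn (fun t : ℝ => Complex.exp (-(σ + 2 : ℝ) * t) * d t) (Ioi 0) :=
    integrableOn_exp_mul hd (by simp)
  have h3 := ae_eq_of_laplace_eq hd2 hinv fun τ => by
    have h4 : σ < (vline (σ + 2) τ).re := by simp
    rw [laplace_invLaplace hσ0 hFd hM0 hFn' h1 h4, hF]
    simp only []
    rw [← h _ h4, mul_div_cancel_left₀ _ (hlop _ h4)]
  filter_upwards [ae_restrict_of_ae_restrict_of_subset Ioo_subset_Ioi_self h3,
    ae_restrict_mem measurableSet_Ioo] with t ht hmem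
  rw [ht]
  exact invLaplace_eq_zero hσ0 hFd hM0 hFn h1 hmem.2.le

/-- Zero coefficients are summable, so the Fourier series converges pointwise to the continuous
function f, and its sum is 0. -/
lemma eq_zero_of_fourier_eq_zero {f : ℝ → ℂ} (hc : Continuous f)
    (hp : ∀ s, f (s + 2 * Real.pi) = f s)
    (h : ∀ n : ℤ, ∫ s in (0 : ℝ)..(2 * Real.pi), Complex.exp (Complex.I * (n * s)) * f s = 0)
    (s : ℝ) : f s = 0 := by
  have hT : Fact (0 < 2 * Real.pi) := ⟨Real.two_pi_pos⟩
  have hper : Function.Periodic f (2 * Real.pi) := hp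
  set g : C(AddCircle (2 * Real.pi), ℂ) := ⟨hper.lift, continuous_coinduced_dom.mpr hc⟩ with hg
  have hgs : ∀ x : ℝ, g (x : AddCircle (2 * Real.pi)) = f x := fun x => hper.lift_coe x
  have h0 : fourierCoeff g = 0 := by
    funext n
    rw [fourierCoeff_eq_intervalIntegral g n 0, zero_add]
    have : ∀ x : ℝ, fourier (-n) (x : AddCircle (2 * Real.pi)) • g (x : AddCircle (2 * Real.pi))
        = Complex.exp (Complex.I * (((-n : ℤ) : ℂ) * x)) * f x := fun x => by
      rw [hgs, fourier_coe_apply, smul_eq_mul]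
      congr 2
      have hpi : (Real.pi : ℂ) ≠ 0 := by exact_mod_cast Real.pi_ne_zero
      push_cast
      field_simp
    simp only [this]
    rw [h, smul_zero]
    rfl
  have h1 := has_pointwise_sum_fourier_series_of_summable (f := g) (by rw [h0]; exact summable_zero)
    (s : AddCircle (2 * Real.pi))
  rw [hgs, h0] at h1
  simp only [Pi.zero_apply, zero_smul] at h1
  exact h1.unique hasSum_zero

/-- The one-variable statement is used twice: the partial coefficient in y₂ is a continuous periodic
function of y₁ with vanishing coefficients, hence zero; then so is each slice in y₂. -/
lemma eq_zero_of_torus_fourier_eq_zero {f : ℝ × ℝ → ℂ} (hc : Continuous f)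
    (hp₁ : ∀ y₁ y₂, f (y₁ + 2 * Real.pi, y₂) = f (y₁, y₂))
    (hp₂ : ∀ y₁ y₂, f (y₁, y₂ + 2 * Real.pi) = f (y₁, y₂))
    (h : ∀ j, ∫ y in cell, torusChar j y * f y = 0) (y : ℝ × ℝ) : f y = 0 := by
  have hI : ∀ j : ℤ × ℤ, Integrable (fun y => torusChar j y * f y)
      ((volume.restrict (Ioc 0 (2 * Real.pi))).prod (volume.restrict (Ioc 0 (2 * Real.pi)))) :=
    fun j => by
      rw [← restrict_cell]
      have hK : IsCompact (Icc 0 (2 * Real.pi) ×ˢ Icc 0 (2 * Real.pi)) :=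
        isCompact_Icc.prod isCompact_Icc
      exact (((continuous_torusChar j).mul hc).continuousOn.integrableOn_compact hK).mono_set
        (prod_mono Ioc_subset_Icc_self Ioc_subset_Icc_self)
  have h2pi := Real.two_pi_pos.le
  have h1 : ∀ (n : ℤ) (y₁ : ℝ),
      ∫ s in (0 : ℝ)..(2 * Real.pi), Complex.exp (Complex.I * (n * s)) * f (y₁, s) = 0 := by
    intro n
    refine eq_zero_of_fourier_eq_zero
      (intervalIntegral.continuous_parametric_intervalIntegral_of_continuous' (by
        simp only [Function.uncurry_def]; fun_prop) _ _) (fun s => by simp only [hp₁]) fun m => ?_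
    have h2 := h (m, n)
    rw [restrict_cell, integral_prod _ (hI _)] at h2
    rw [intervalIntegral.integral_of_le h2pi, ← h2]
    congr 1
    funext s
    rw [intervalIntegral.integral_of_le h2pi, ← integral_const_mul]
    congr 1
    funext r
    rw [torusChar, mul_add, Complex.exp_add, mul_assoc]
  obtain ⟨y₁, y₂⟩ := y
  exact eq_zero_of_fourier_eq_zero (f := fun s => f (y₁, s)) (by fun_prop) (hp₂ y₁)
    (fun n => h1 n y₁) y₂

/-- The two solutions may come with different extensions and weights. Beyond a common abscissa the
equations can be subtracted, and the extended sources agree before T, so causality applies to the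
difference. -/
lemma SolvesOn.ae_fourierCoef_eq {S : RefState} {ν C₀ T : ℝ} (hν : 0 < ν) (hC₀ : 0 < C₀)
    (hC : ∀ j : ℤ × ℤ, j ≠ 0 → ∀ z : ℂ, 1 ≤ z.re →
      ‖z‖ ^ 3 ≤ C₀ * freqNorm j * ‖lopatinskii S ν z j‖) (hT : 0 < T) {𝔄 Φ Ψ : ℝ × ℝ × ℝ → ℝ}
    (hΦ : SolvesOn S ν T 𝔄 Φ) (hΨ : SolvesOn S ν T 𝔄 Ψ) {j : ℤ × ℤ} (hj : j ≠ 0) :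
    ∀ᵐ t ∂(volume.restrict (Ioo 0 T)), fourierCoef j Φ t = fourierCoef j Ψ t := by
  obtain ⟨γ₁, A₁, P₁, -, hA₁, hP₁, hA₁', hP₁', h₁⟩ := hΦ
  obtain ⟨γ₂, A₂, P₂, -, hA₂, hP₂, hA₂', hP₂', h₂⟩ := hΨ
  obtain ⟨σ, hσ, hσ₁, hσ₂⟩ : ∃ σ, 1 ≤ σ ∧ γ₁ < σ ∧ γ₂ < σ :=
    ⟨max 1 (max γ₁ γ₂ + 1), le_max_left _ _,
      lt_max_of_lt_right ((le_max_left _ _).trans_lt (lt_add_one _)),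
      lt_max_of_lt_right ((le_max_right _ _).trans_lt (lt_add_one _))⟩
  have a1 := hA₁.integrableOn_fourierCoef hσ₁ j
  have a2 := hA₂.integrableOn_fourierCoef hσ₂ j
  have p1 := hP₁.integrableOn_fourierCoef hσ₁ j
  have p2 := hP₂.integrableOn_fourierCoef hσ₂ j
  have hsub : ∀ {f g : ℝ → ℂ} {z : ℂ}, σ < z.re →
      IntegrableOn (fun t : ℝ => Complex.exp (-σ * t) * f t) (Ioi 0) →
      IntegrableOn (fun t : ℝ => Complex.exp (-σ * t) * g t) (Ioi 0) →
      laplace (fun t => f t - g t) z = laplace f z - laplace g z := fun {f g z} hz hf hg => by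
    rw [laplace, laplace, laplace, ← integral_sub (integrableOn_exp_mul hf hz.le)
      (integrableOn_exp_mul hg hz.le)]
    simp only [mul_sub]
  have key := ae_eq_zero_of_lopatinskii_mul_laplace (T := T) (σ := σ)
    (d := fun t => fourierCoef j P₁ t - fourierCoef j P₂ t)
    (R := fun t => fourierCoef j A₁ t - fourierCoef j A₂ t) hν hC₀ hj (hC j hj) hT hσ
    (by simp only [mul_sub]; exact p1.sub p2) (by simp only [mul_sub]; exact a1.sub a2)
    (by
      filter_upwards [fourierCoef_congr_ae hA₁', fourierCoef_congr_ae hA₂'] with t e1 e2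
      rw [e1, e2, sub_self])
    (fun z hz => by
      rw [hsub hz p1 p2, hsub hz a1 a2, mul_sub, h₁ j hj z (hσ₁.trans hz),
        h₂ j hj z (hσ₂.trans hz)])
  filter_upwards [key, fourierCoef_congr_ae hP₁', fourierCoef_congr_ae hP₂'] with t e e1 e2
  rw [← e1, ← e2]
  exact sub_eq_zero.mp e

lemma IsSlowFront.continuous_slice {S : RefState} {ν T : ℝ} {𝔄 Φ : ℝ × ℝ × ℝ → ℝ}
    (h : IsSlowFront S ν T 𝔄 Φ) {t : ℝ} (ht : t ∈ Icc 0 T) : Continuous fun y => Φ (t, y) :=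
  h.continuousOn.comp_continuous (by fun_prop) fun _ => ⟨ht, mem_univ _⟩

/-- Uniqueness of the slow front, given a lower bound for the symbol. -/
lemma IsSlowFront.eq {S : RefState} {ν C₀ T : ℝ} (hν : 0 < ν) (hC₀ : 0 < C₀)
    (hC : ∀ j : ℤ × ℤ, j ≠ 0 → ∀ z : ℂ, 1 ≤ z.re →
      ‖z‖ ^ 3 ≤ C₀ * freqNorm j * ‖lopatinskii S ν z j‖) (hT : 0 < T) {𝔄 Φ Ψ : ℝ × ℝ × ℝ → ℝ}
    (hΦ : IsSlowFront S ν T 𝔄 Φ) (hΨ : IsSlowFront S ν T 𝔄 Ψ) :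
    ∀ t ∈ Icc 0 T, ∀ y, Φ (t, y) = Ψ (t, y) := by
  have h0 : ∀ {Φ}, IsSlowFront S ν T 𝔄 Φ → ∀ t ∈ Icc 0 T, fourierCoef 0 Φ t = 0 :=
    fun {Φ} h t ht => by
      have h1 := h.zeroMean t ht
      have h2 : ∫ y in cell, ((Φ (t, y) : ℝ) : ℂ) = 0 := by
        rw [integral_complex_ofReal, h1, Complex.ofReal_zero]
      simp [fourierCoef, h2]
  have hae : ∀ᵐ t ∂(volume.restrict (Ioo 0 T)), ∀ y, Φ (t, y) = Ψ (t, y) := by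
    have h1 : ∀ᵐ t ∂(volume.restrict (Ioo 0 T)), ∀ j, j ≠ 0 →
        fourierCoef j Φ t = fourierCoef j Ψ t := by
      refine ae_all_iff.mpr fun j => ?_
      by_cases hj : j = 0
      · exact ae_of_all _ fun t h => absurd hj h
      · exact (hΦ.solves.ae_fourierCoef_eq hν hC₀ hC hT hΨ.solves hj).mono fun t ht _ => ht
    filter_upwards [h1, ae_restrict_mem measurableSet_Ioo] with t ht hmem y
    have htm := Ioo_subset_Icc_self hmem
    have c1 := hΦ.continuous_slice htm
    have c2 := hΨ.continuous_slice htm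
    have hi : ∀ {Φ : ℝ × ℝ × ℝ → ℝ} (j), Continuous (fun y => Φ (t, y)) →
        IntegrableOn (fun y => torusChar j y * (Φ (t, y) : ℂ)) cell := fun {Φ} j c => by
      have hK : IsCompact (Icc 0 (2 * Real.pi) ×ˢ Icc 0 (2 * Real.pi)) :=
        isCompact_Icc.prod isCompact_Icc
      exact (((continuous_torusChar j).mul
        (Complex.continuous_ofReal.comp c)).continuousOn.integrableOn_compact hK).mono_set
        (prod_mono Ioc_subset_Icc_self Ioc_subset_Icc_self)
    have key := eq_zero_of_torus_fourier_eq_zero (f := fun y => (Φ (t, y) : ℂ) - (Ψ (t, y) : ℂ))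
      ((Complex.continuous_ofReal.comp c1).sub (Complex.continuous_ofReal.comp c2))
      (fun y₁ y₂ => by
        simp only [(hΦ.memHInfty.periodic t htm y₁ y₂).1, (hΨ.memHInfty.periodic t htm y₁ y₂).1])
      (fun y₁ y₂ => by
        simp only [(hΦ.memHInfty.periodic t htm y₁ y₂).2, (hΨ.memHInfty.periodic t htm y₁ y₂).2])
      (fun j => by
        simp only [mul_sub]
        rw [integral_sub (hi j c1) (hi j c2), sub_eq_zero]
        have h2 : fourierCoef (-j) Φ t = fourierCoef (-j) Ψ t := by
          by_cases hj : -j = 0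
          · rw [hj, h0 hΦ t htm, h0 hΨ t htm]
          · exact ht (-j) hj
        rw [fourierCoef_eq, fourierCoef_eq, neg_neg] at h2
        exact mul_left_cancel₀ (inv_ne_zero (by
          exact_mod_cast (by positivity : (2 * Real.pi) ^ 2 ≠ 0))) h2) y
    exact_mod_cast sub_eq_zero.mp key
  intro t ht y
  have hc : ∀ {Φ}, IsSlowFront S ν T 𝔄 Φ → ContinuousOn (fun s => Φ (s, y)) (Icc 0 T) :=
    fun {Φ} h => h.continuousOn.comp (by fun_prop) fun s hs => ⟨hs, mem_univ _⟩
  have h2 : EqOn (fun s => Φ (s, y)) (fun s => Ψ (s, y)) (Icc 0 T) := by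
    -- Equality for almost every t extends to the closed interval by continuity in t.
    refine Measure.eqOn_Icc_of_ae_eq volume hT.ne ?_ (hc hΦ) (hc hΨ)
    rw [← Measure.restrict_congr_set Ioo_ae_eq_Icc]
    exact hae.mono fun s hs => hs y
  exact h2 ht

end PlasmaVacuum

end

theorem lemma5p3 (S : PlasmaVacuum.RefState) (hS : S.Stable) :
    ∃ ν₀ : ℝ, 0 < ν₀ ∧ ∀ ν : ℝ, 0 < ν → ν < ν₀ →
      ∀ T : ℝ, 0 < T → ∀ 𝔄 : ℝ × ℝ × ℝ → ℝ, PlasmaVacuum.MemHInfty T 𝔄 →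
        (∀ᵐ t ∂(volume.restrict (Ioo 0 T)), ∫ y in PlasmaVacuum.cell, 𝔄 (t, y) = 0) →
        ∃ Φ : ℝ × ℝ × ℝ → ℝ, PlasmaVacuum.IsSlowFront S ν T 𝔄 Φ ∧
          ∀ Ψ : ℝ × ℝ × ℝ → ℝ, PlasmaVacuum.IsSlowFront S ν T 𝔄 Ψ →
            ∀ t ∈ Icc 0 T, ∀ y : ℝ × ℝ, Ψ (t, y) = Φ (t, y) := by
  obtain ⟨ν₀, hν₀, h⟩ := PlasmaVacuum.exists_lopatinskii_lower hS
  refine ⟨ν₀, hν₀, fun ν hν hνν T hT 𝔄 h𝔄 _ => ?_⟩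
  obtain ⟨C, hC, hlow⟩ := h ν hν hνν
  obtain ⟨Φ, hΦ⟩ := PlasmaVacuum.exists_isSlowFront hν hC hlow hT h𝔄
  exact ⟨Φ, hΦ, fun Ψ hΨ => hΨ.eq hν hC hlow hT hΦ⟩
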